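/- Let $k$ be a commutative ring, $A$ a commutative $k$-algebra containing $\mathbb{Q}$, and $(A,L)$ a Lie–Rinehart algebra over $k$ such that $L$ is a finitely generated projective $A$-module of constant rank. Let $\mathcal{V}L$ be its universal enveloping algebra, an $A$-module by left multiplication, with its canonical left coproduct $\Delta_l:\mathcal{V}L\to \mathcal{V}L\otimes_A\mathcal{V}L$, $\Delta_l(D)=D_{(1)}\otimes D_{(2)}$ (determined by $\Delta_l(1)=1\otimes 1$, $\Delta_l(aD)=a\Delta_l(D)$, $\Delta_l(XD)=(X\otimes1+1\otimes X)\Delta_l(D)$ for $a\in A$, $X\in L$), its canonical action $(D,a)\mapsto D(a)$ on $A$ extending the anchor, and left counit $\epsilon_l(D)=D(1)$. Let $\mathcal{V}L_{\le p}$ be the left $A$-submodule generated by products of at most $p$ elements of $L$, let $\mathcal{J}^pL=\mathrm{Hom}_A(\mathcal{V}L_{\le p},A)$, and let $\mathcal{J}^\infty L=\varprojlim_p\mathcal{J}^pL$, filtered by $F_n=\{\phi : \phi|_{\mathcal{V}L_{\le m}}=0 \text{ for all } m<n\}$. All tensor products of $\mathcal{J}^\infty L$ with itself are completed with respect to this filtration.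 Let $\mathcal{V}L\otimes^{rl}\mathcal{V}L$ be the quotient of $\mathcal{V}L\otimes_k\mathcal{V}L$ by the relations $Da\otimes E=D\otimes aE$. Then: 1. With the product $(\phi_1\phi_2)(D)=\phi_1(D_{(1)})\phi_2(D_{(2)})$ and unit $\epsilon_l$, $\mathcal{J}^\infty L$ is a commutative $k$-algebra, and the filtration $F$ makes it a complete filtered algebra: $F_0=\mathcal{J}^\infty L$, $F_pF_q\subseteq F_{p+q}$, and $\mathcal{J}^\infty L\cong\varprojlim_n\mathcal{J}^\infty L/F_n$ canonically. 2. The Hopf–Galois map $\beta:\mathcal{V}L\otimes^{rl}\mathcal{V}L\to\mathcal{V}L\otimes_A\mathcal{V}L$, $D\otimes E\mapsto D_{(1)}\otimes D_{(2)}E$, is bijective. Write $D_+\otimes D_-:=\beta^{-1}(D\otimes1)$. 3. There is exactly one Hopf algebroid structure on the $k$-algebra $\mathcal{J}^\infty L$ (in the sense of Böhm–Szlachányi: a left bialgebroid and a right bialgebroid, both over $A$, on the same algebra, with an antipode $S$; tensor products completed, structure maps continuous) with the following structure maps. Put $s(a)(D)=a\,\epsilon_l(D)$ and $t(a)(D)=D(a)$.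 The left source and target maps are $s$ and $t$; the right source and target maps are $t$ and $s$. The left and the right counit are both $\phi\mapsto\phi(1)$. The left and the right coproduct are both dual to the product of $\mathcal{V}L$, that is, writing the coproduct of $\phi$ as $\phi_{(1)}\otimes\phi_{(2)}$, $$\phi_{(1)}\bigl(D\,\phi_{(2)}(E)\bigr)=\phi(DE)\qquad(D,E\in\mathcal{V}L).$$ The antipode is $$(S\phi)(D)=D_+\bigl(\phi(D_-)\bigr).$$ 4. This antipode is involutive: $S^2=\mathrm{id}$. In particular the Hopf algebroid structure on $\mathcal{J}^\infty L$ is determined by the canonical left Hopf algebroid structure of $\mathcal{V}L$ ($\Delta_l$, $\epsilon_l$, the product and $\beta$); no flat right $(A,L)$-connection on $A$ is assumed or chosen. -/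

import Mathlib

open scoped TensorProduct

set_option linter.unusedSectionVars false

noncomputable section

namespace LieRinehart

variable (k A L : Type*) [CommRing k] [CommRing A] [Algebra k A] [LieRing L] [LieAlgebra k L]
  [Module A L] [LieRingModule L A] [LieRinehartRing A L] [LieRinehartAlgebra k A L]

/-! ### The universal enveloping algebra of a Lie-Rinehart algebra -/

/-- The defining relations of the universal enveloping algebra of `(A, L)`: generators are the
elements of `A` and of `L`; the inclusion of `A` is a morphism of `k`-algebras, the inclusion of `L`
is additive and compatible with brackets, `a ⬝ X = aX` and `X ⬝ a - a ⬝ X = X(a)`. -/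
inductive EnvRel : FreeAlgebra k (A ⊕ L) → FreeAlgebra k (A ⊕ L) → Prop
  | algebraMap (c : k) :
      EnvRel (FreeAlgebra.ι k (Sum.inl (algebraMap k A c))) (algebraMap k _ c)
  | add (a b : A) : EnvRel (FreeAlgebra.ι k (Sum.inl (a + b)))
      (FreeAlgebra.ι k (Sum.inl a) + FreeAlgebra.ι k (Sum.inl b))
  | mul (a b : A) : EnvRel (FreeAlgebra.ι k (Sum.inl (a * b)))
      (FreeAlgebra.ι k (Sum.inl a) * FreeAlgebra.ι k (Sum.inl b))
  | add_lie (X Y : L) : EnvRel (FreeAlgebra.ι k (Sum.inr (X + Y)))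
      (FreeAlgebra.ι k (Sum.inr X) + FreeAlgebra.ι k (Sum.inr Y))
  | smul (a : A) (X : L) : EnvRel (FreeAlgebra.ι k (Sum.inr (a • X)))
      (FreeAlgebra.ι k (Sum.inl a) * FreeAlgebra.ι k (Sum.inr X))
  | lie (X Y : L) : EnvRel
      (FreeAlgebra.ι k (Sum.inr ⁅X, Y⁆) + FreeAlgebra.ι k (Sum.inr Y) * FreeAlgebra.ι k (Sum.inr X))
      (FreeAlgebra.ι k (Sum.inr X) * FreeAlgebra.ι k (Sum.inr Y))
  | anchor (X : L) (a : A) : EnvRel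
      (FreeAlgebra.ι k (Sum.inr X) * FreeAlgebra.ι k (Sum.inl a))
      (FreeAlgebra.ι k (Sum.inl a) * FreeAlgebra.ι k (Sum.inr X) +
        FreeAlgebra.ι k (Sum.inl ⁅X, a⁆))

/-- The universal enveloping algebra of the Lie-Rinehart algebra `(A, L)` over `k`. Its universal
property is `Env.lift`, `Env.lift_iA`, `Env.lift_iL` and `Env.hom_ext` below. -/
def Env : Type _ := RingQuot (EnvRel k A L)

instance : Ring (Env k A L) := inferInstanceAs (Ring (RingQuot (EnvRel k A L)))
instance : Algebra k (Env k A L) := inferInstanceAs (Algebra k (RingQuot (EnvRel k A L)))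

namespace Env

/-- The quotient map from the free algebra. -/
def mkHom : FreeAlgebra k (A ⊕ L) →ₐ[k] Env k A L := RingQuot.mkAlgHom k (EnvRel k A L)

variable {A L} in
/-- The image of a generator in the enveloping algebra. -/
def gen (x : A ⊕ L) : Env k A L := mkHom k A L (FreeAlgebra.ι k x)

variable {k A L} in
lemma rel {x y : FreeAlgebra k (A ⊕ L)} (h : EnvRel k A L x y) :
    mkHom k A L x = mkHom k A L y :=
  RingQuot.mkAlgHom_rel k h

/-- The canonical morphism `A → VL`. -/
def iA : A →ₐ[k] Env k A L :=
  AlgHom.ofLinearMap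
    { toFun := fun a => gen k (Sum.inl a)
      map_add' := fun a b => by
        have := rel (EnvRel.add (k := k) (L := L) a b)
        rw [map_add] at this; exact this
      map_smul' := fun c a => by
        have h1 := rel (EnvRel.mul (k := k) (L := L) (algebraMap k A c) a)
        have h2 := rel (EnvRel.algebraMap (k := k) (A := A) (L := L) c)
        rw [map_mul, h2, AlgHom.commutes] at h1
        rw [Algebra.smul_def, RingHom.id_apply]
        refine Eq.trans h1 ?_
        exact (Algebra.smul_def c (gen k (Sum.inl a) : Env k A L)).symm }
    (by
      have h2 := rel (EnvRel.algebraMap (k := k) (A := A) (L := L) 1)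
      rw [map_one, map_one, map_one] at h2
      exact h2)
    (fun a b => by
      have h1 := rel (EnvRel.mul (k := k) (L := L) a b)
      rw [map_mul] at h1
      exact h1)

/-- The canonical map `L → VL`. -/
def iL : L →ₗ[k] Env k A L where
  toFun X := gen k (Sum.inr X)
  map_add' X Y := by
    have := rel (EnvRel.add_lie (k := k) (A := A) X Y)
    rw [map_add] at this; exact this
  map_smul' c X := by
    have h1 := rel (EnvRel.smul (k := k) (algebraMap k A c) X)
    have h2 := rel (EnvRel.algebraMap (k := k) (A := A) (L := L) c)
    rw [map_mul, h2, AlgHom.commutes, algebraMap_smul] at h1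
    rw [RingHom.id_apply]
    refine Eq.trans h1 ?_
    exact (Algebra.smul_def c (gen k (Sum.inr X) : Env k A L)).symm

lemma iL_smul (a : A) (X : L) : iL k A L (a • X) = iA k A L a * iL k A L X := by
  have h := rel (EnvRel.smul (k := k) a X)
  rw [map_mul] at h; exact h

lemma iL_lie (X Y : L) :
    iL k A L ⁅X, Y⁆ = iL k A L X * iL k A L Y - iL k A L Y * iL k A L X := by
  have h := rel (EnvRel.lie (k := k) (A := A) X Y)
  rw [map_add, map_mul, map_mul] at h
  exact eq_sub_of_add_eq h

lemma iL_mul_iA (X : L) (a : A) :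
    iL k A L X * iA k A L a = iA k A L a * iL k A L X + iA k A L ⁅X, a⁆ := by
  have h := rel (EnvRel.anchor (k := k) X a)
  rw [map_add, map_mul, map_mul] at h; exact h

variable {k A L}

section lift
variable {W : Type*} [Ring W] [Algebra k W] (fA : A →ₐ[k] W) (fL : L →ₗ[k] W)
  (hlie : ∀ X Y, fL ⁅X, Y⁆ = fL X * fL Y - fL Y * fL X)
  (hsmul : ∀ (a : A) X, fL (a • X) = fA a * fL X)
  (hanchor : ∀ X (a : A), fL X * fA a - fA a * fL X = fA ⁅X, a⁆)

/-- The universal property of the enveloping algebra: existence. -/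
def lift : Env k A L →ₐ[k] W :=
  RingQuot.liftAlgHom k (s := EnvRel k A L)
    ⟨FreeAlgebra.lift k (Sum.elim fA fL), by
      intro x y h
      induction h with
      | algebraMap c => simp
      | add a b => simp
      | mul a b => simp
      | add_lie X Y => simp
      | smul a X => simp [hsmul]
      | lie X Y => simp [hlie]
      | anchor X a => simp [← hanchor]⟩

@[simp] lemma lift_iA (a : A) : lift fA fL hlie hsmul hanchor (iA k A L a) = fA a := by
  have : lift fA fL hlie hsmul hanchor (iA k A L a) =
    FreeAlgebra.lift k (Sum.elim fA fL) (FreeAlgebra.ι k (Sum.inl a)) :=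
    RingQuot.liftAlgHom_mkAlgHom_apply _ _ _ _
  simpa using this

@[simp] lemma lift_iL (X : L) : lift fA fL hlie hsmul hanchor (iL k A L X) = fL X := by
  have : lift fA fL hlie hsmul hanchor (iL k A L X) =
    FreeAlgebra.lift k (Sum.elim fA fL) (FreeAlgebra.ι k (Sum.inr X)) :=
    RingQuot.liftAlgHom_mkAlgHom_apply _ _ _ _
  simpa using this

/-- The universal property of the enveloping algebra: uniqueness. -/
lemma hom_ext {f g : Env k A L →ₐ[k] W} (hA : ∀ a, f (iA k A L a) = g (iA k A L a))
    (hL : ∀ X, f (iL k A L X) = g (iL k A L X)) : f = g := by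
  refine RingQuot.ringQuot_ext' k f g ?_
  ext x
  rcases x with a | X
  · exact hA a
  · exact hL X

end lift

/-- Induction along the generation of `VL` from `1` by left multiplication with elements of `A`
and of `L`. -/
lemma induction {P : Env k A L → Prop} (one : P 1) (add : ∀ D E, P D → P E → P (D + E))
    (mulA : ∀ a D, P D → P (iA k A L a * D)) (mulL : ∀ X D, P D → P (iL k A L X * D))
    (D : Env k A L) : P D := by
  suffices h : ∀ D : Env k A L, ∀ E, P E → P (D * E) by simpa using h D 1 one
  intro D
  obtain ⟨x, rfl⟩ : ∃ x, mkHom k A L x = D := RingQuot.mkAlgHom_surjective k (EnvRel k A L) D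
  induction x using FreeAlgebra.induction with
  | grade0 c =>
    intro E hE
    have h2 := rel (EnvRel.algebraMap (k := k) (A := A) (L := L) c)
    rw [← h2]
    exact mulA _ _ hE
  | grade1 x =>
    intro E hE
    rcases x with a | X
    · exact mulA a E hE
    · exact mulL X E hE
  | mul x y hx hy =>
    intro E hE
    rw [map_mul, mul_assoc]
    exact hx _ (hy _ hE)
  | add x y hx hy =>
    intro E hE
    rw [map_add, add_mul]
    exact add _ _ (hx _ hE) (hy _ hE)

/-- `VL` is regarded as an `A`-module by left multiplication. -/
instance : Module A (Env k A L) := Module.compHom _ (iA k A L).toRingHom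

lemma smul_def (a : A) (D : Env k A L) : a • D = iA k A L a * D := rfl

lemma smul_mul (a : A) (D E : Env k A L) : (a • D) * E = a • (D * E) := by
  simp [smul_def, mul_assoc]

instance : IsScalarTower k A (Env k A L) where
  smul_assoc c a D := by simp [smul_def]

instance : SMulCommClass k A (Env k A L) where
  smul_comm c a D := by simp [smul_def]

instance : SMulCommClass A k (Env k A L) where
  smul_comm c a D := by simp [smul_def]

lemma iL_mul_smul (X : L) (a : A) (D : Env k A L) :
    iL k A L X * (a • D) = a • (iL k A L X * D) + ⁅X, a⁆ • D := by
  simp only [smul_def, ← mul_assoc, iL_mul_iA, add_mul]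

/-- The canonical action of `VL` on `A`, the extension of the anchor: `X` acts by `a ↦ X(a)`, and
`A` acts by multiplication. -/
def act : Env k A L →ₐ[k] Module.End k A :=
  lift (W := Module.End k A) (Algebra.lmul k A)
    (LinearMap.mk₂ k (fun (X : L) (a : A) => ⁅X, a⁆) (by simp) (by simp) (by simp) (by simp))
    (fun X Y => by ext b; simp)
    (fun a X => by ext b; simp)
    (fun X a => by ext b; simp)

@[simp] lemma act_iA (a b : A) : act (iA k A L a) b = a * b := by simp [act]
@[simp] lemma act_iL (X : L) (b : A) : act (iL k A L X) b = ⁅X, b⁆ := by simp [act]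
lemma act_mul (D E : Env k A L) (b : A) : act (D * E) b = act D (act E b) := by
  rw [map_mul]; rfl
lemma act_smul (a : A) (D : Env k A L) (b : A) : act (a • D) b = a * act D b := by
  rw [smul_def, act_mul, act_iA]

/-- The left counit `D ↦ D(1)`. -/
def eps : Env k A L →ₗ[A] A where
  toFun D := act D 1
  map_add' D E := by simp
  map_smul' a D := by simp [act_smul]

lemma eps_apply (D : Env k A L) : eps D = act D 1 := rfl

/-! ### The left coproduct -/

section derivTensor
variable {M N : Type*} [AddCommGroup M] [Module A M] [AddCommGroup N] [Module A N]

/-- If `f` and `g` are additive operators on `A`-modules that satisfy the Leibniz rule over the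
same operator `d` of `A`, then `m ⊗ n ↦ f m ⊗ n + m ⊗ g n` is well defined. -/
def derivTensor (d : A → A) (f : M →+ M) (g : N →+ N) (hf : ∀ (a : A) m, f (a • m) = a • f m + d a • m)
    (hg : ∀ (a : A) n, g (a • n) = a • g n + d a • n) : M ⊗[A] N →+ M ⊗[A] N :=
  TensorProduct.liftAddHom
    (AddMonoidHom.mk' (fun m => AddMonoidHom.mk' (fun n => f m ⊗ₜ[A] n + m ⊗ₜ[A] g n)
      (fun n n' => by simp only [map_add, TensorProduct.tmul_add]; abel))
      (fun m m' => by
        ext n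
        simp only [map_add, TensorProduct.add_tmul, AddMonoidHom.mk'_apply, AddMonoidHom.add_apply]
        abel))
    (fun a m n => by
      simp only [AddMonoidHom.mk'_apply, hf, hg, TensorProduct.add_tmul, TensorProduct.tmul_add,
        TensorProduct.smul_tmul]
      abel)

@[simp] lemma derivTensor_tmul (d : A → A) (f : M →+ M) (g : N →+ N)
    (hf : ∀ (a : A) m, f (a • m) = a • f m + d a • m)
    (hg : ∀ (a : A) n, g (a • n) = a • g n + d a • n) (m : M) (n : N) :
    derivTensor d f g hf hg (m ⊗ₜ[A] n) = f m ⊗ₜ[A] n + m ⊗ₜ[A] g n := rfl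

lemma derivTensor_smul (d : A → A) (f : M →+ M) (g : N →+ N)
    (hf : ∀ (a : A) m, f (a • m) = a • f m + d a • m)
    (hg : ∀ (a : A) n, g (a • n) = a • g n + d a • n) (a : A) (z : M ⊗[A] N) :
    derivTensor d f g hf hg (a • z) = a • derivTensor d f g hf hg z + d a • z := by
  induction z with
  | zero => simp
  | add x y hx hy => rw [smul_add, map_add, hx, hy, map_add, smul_add, smul_add]; abel
  | tmul m n =>
    rw [TensorProduct.smul_tmul', derivTensor_tmul, hf, derivTensor_tmul]
    simp only [TensorProduct.add_tmul, TensorProduct.smul_tmul', smul_add]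
    abel

end derivTensor

/-- Left multiplication by `X` on `VL`. -/
def mulX (X : L) : Env k A L →+ Env k A L := AddMonoidHom.mulLeft (iL k A L X)

@[simp] lemma mulX_apply (X : L) (D : Env k A L) : mulX X D = iL k A L X * D := rfl

/-- The action of `X ∈ L` on `VL ⊗ VL` (tensor product of left `A`-modules), that is
left multiplication by `X ⊗ 1 + 1 ⊗ X`. -/
def tensorX (X : L) : Env k A L ⊗[A] Env k A L →+ Env k A L ⊗[A] Env k A L :=
  derivTensor (fun a => ⁅X, a⁆) (mulX X) (mulX X) (iL_mul_smul X) (iL_mul_smul X)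

@[simp] lemma tensorX_tmul (X : L) (D E : Env k A L) : tensorX X (D ⊗ₜ[A] E) =
    (iL k A L X * D) ⊗ₜ[A] E + D ⊗ₜ[A] (iL k A L X * E) := rfl

lemma tensorX_smul (X : L) (a : A) (z : Env k A L ⊗[A] Env k A L) :
    tensorX X (a • z) = a • tensorX X z + ⁅X, a⁆ • z :=
  derivTensor_smul _ _ _ _ _ a z

lemma tensorX_add_left (X Y : L) (z : Env k A L ⊗[A] Env k A L) :
    tensorX (X + Y) z = tensorX X z + tensorX Y z := by
  induction z with
  | zero => simp
  | add x y hx hy => rw [map_add, hx, hy, map_add, map_add]; abel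
  | tmul D E =>
    simp only [tensorX_tmul, map_add, add_mul, TensorProduct.add_tmul, TensorProduct.tmul_add]
    abel

lemma tensorX_smul_left (a : A) (X : L) (z : Env k A L ⊗[A] Env k A L) :
    tensorX (a • X) z = a • tensorX X z := by
  induction z with
  | zero => simp
  | add x y hx hy => rw [map_add, hx, hy, map_add, smul_add]
  | tmul D E =>
    rw [tensorX_tmul, iL_smul, mul_assoc, mul_assoc, ← smul_def, ← smul_def,
      TensorProduct.tmul_smul, ← TensorProduct.smul_tmul', tensorX_tmul, smul_add]

lemma tensorX_lie (X Y : L) (z : Env k A L ⊗[A] Env k A L) :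
    tensorX ⁅X, Y⁆ z = tensorX X (tensorX Y z) - tensorX Y (tensorX X z) := by
  induction z with
  | zero => simp
  | add x y hx hy => simp only [map_add, hx, hy]; abel
  | tmul D E =>
    simp only [tensorX_tmul, map_add, iL_lie, sub_mul, TensorProduct.sub_tmul,
      TensorProduct.tmul_sub, mul_assoc]
    abel

/-- The operator `tensorX X` is `k`-linear in the vector and in `X`. -/
def tensorXₗ : L →ₗ[k] Module.End k (Env k A L ⊗[A] Env k A L) :=
  LinearMap.mk₂ k (fun X z => tensorX X z) tensorX_add_left
    (fun c X z => by rw [← algebraMap_smul A c X, tensorX_smul_left, algebraMap_smul])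
    (fun X z w => map_add _ z w)
    (fun c X z => by
      have h : ⁅X, algebraMap k A c⁆ = 0 := (LieRinehartAlgebra.anchor k A L X).map_algebraMap c
      rw [← algebraMap_smul A c z, tensorX_smul, h, zero_smul, add_zero, algebraMap_smul])

@[simp] lemma tensorXₗ_apply (X : L) (z : Env k A L ⊗[A] Env k A L) :
    tensorXₗ X z = tensorX X z := rfl

/-- The left `VL`-module structure of the tensor product `VL ⊗ VL` of left `A`-modules, in which
`a` acts as a scalar and `X ∈ L` acts as `X ⊗ 1 + 1 ⊗ X`. -/
def tensorAct : Env k A L →ₐ[k] Module.End k (Env k A L ⊗[A] Env k A L) :=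
  lift (W := Module.End k (Env k A L ⊗[A] Env k A L)) (Algebra.lsmul k k _) tensorXₗ
    (fun X Y => LinearMap.ext fun z => tensorX_lie X Y z)
    (fun a X => LinearMap.ext fun z => tensorX_smul_left a X z)
    (fun X a => LinearMap.ext fun z => by
      change tensorX X (a • z) - a • tensorX X z = ⁅X, a⁆ • z
      rw [tensorX_smul]; abel)

@[simp] lemma tensorAct_iA (a : A) (z : Env k A L ⊗[A] Env k A L) :
    tensorAct (iA k A L a) z = a • z := by simp [tensorAct]
@[simp] lemma tensorAct_iL (X : L) (z : Env k A L ⊗[A] Env k A L) :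
    tensorAct (iL k A L X) z = tensorX X z := by simp [tensorAct]

/-- The canonical left coproduct `Δ : VL → VL ⊗ VL`: the map with `Δ(1) = 1 ⊗ 1`,
`Δ(aD) = a Δ(D)` and `Δ(XD) = (X ⊗ 1 + 1 ⊗ X) Δ(D)`. -/
def cop : Env k A L →ₗ[A] Env k A L ⊗[A] Env k A L where
  toFun D := tensorAct D (1 ⊗ₜ[A] 1)
  map_add' D E := by simp
  map_smul' a D := by simp [smul_def]

lemma cop_one : cop (1 : Env k A L) = 1 ⊗ₜ[A] 1 := by simp [cop]
lemma cop_iA_mul (a : A) (D : Env k A L) : cop (iA k A L a * D) = a • cop D := by simp [cop]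
lemma cop_iL_mul (X : L) (D : Env k A L) : cop (iL k A L X * D) = tensorX X (cop D) := by
  simp [cop]
lemma cop_iA (a : A) : cop (iA k A L a) = iA k A L a ⊗ₜ[A] 1 := by
  have := cop_iA_mul a (1 : Env k A L)
  rwa [mul_one, cop_one, TensorProduct.smul_tmul', smul_def, mul_one] at this
lemma cop_iL (X : L) : cop (iL k A L X) = iL k A L X ⊗ₜ[A] 1 + 1 ⊗ₜ[A] iL k A L X := by
  have := cop_iL_mul X (1 : Env k A L)
  rwa [mul_one, cop_one, tensorX_tmul, mul_one] at this

instance : CoalgebraStruct A (Env k A L) where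
  comul := cop
  counit := eps

/-- The action of `X ∈ L` on the triple tensor product. -/
def tensorX₃ (X : L) : Env k A L ⊗[A] (Env k A L ⊗[A] Env k A L) →+
    Env k A L ⊗[A] (Env k A L ⊗[A] Env k A L) :=
  derivTensor (fun a => ⁅X, a⁆) (mulX X) (tensorX X) (iL_mul_smul X) (tensorX_smul X)

@[simp] lemma tensorX₃_tmul (X : L) (D : Env k A L) (w : Env k A L ⊗[A] Env k A L) :
    tensorX₃ X (D ⊗ₜ[A] w) = (iL k A L X * D) ⊗ₜ[A] w + D ⊗ₜ[A] tensorX X w := rfl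

lemma coassoc_aux₁ (X : L) (E : Env k A L) (w : Env k A L ⊗[A] Env k A L) :
    TensorProduct.assoc A _ _ _ (tensorX X w ⊗ₜ[A] E) +
      TensorProduct.assoc A _ _ _ (w ⊗ₜ[A] (iL k A L X * E)) =
    tensorX₃ X (TensorProduct.assoc A _ _ _ (w ⊗ₜ[A] E)) := by
  induction w with
  | zero => simp
  | add x y hx hy =>
    simp only [map_add, TensorProduct.add_tmul]
    rw [← hx, ← hy]
    abel
  | tmul D D' =>
    simp only [tensorX_tmul, TensorProduct.add_tmul, TensorProduct.tmul_add, map_add,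
      TensorProduct.assoc_tmul, tensorX₃_tmul]
    abel

lemma coassoc_aux₂ (X : L) (z : Env k A L ⊗[A] Env k A L) :
    TensorProduct.assoc A _ _ _ (cop.rTensor _ (tensorX X z)) =
      tensorX₃ X (TensorProduct.assoc A _ _ _ (cop.rTensor _ z)) := by
  induction z with
  | zero => simp
  | add x y hx hy => simp only [map_add, hx, hy]
  | tmul D E => simp [cop_iL_mul, ← coassoc_aux₁]

lemma coassoc_aux₃ (X : L) (z : Env k A L ⊗[A] Env k A L) :
    cop.lTensor _ (tensorX X z) = tensorX₃ X (cop.lTensor _ z) := by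
  induction z with
  | zero => simp
  | add x y hx hy => simp only [map_add, hx, hy]
  | tmul D E => simp [cop_iL_mul]

lemma eps_iL_mul (X : L) (D : Env k A L) : eps (iL k A L X * D) = ⁅X, eps D⁆ := by
  simp [eps_apply]

lemma eps_one : eps (1 : Env k A L) = 1 := by simp [eps_apply]

lemma counit_aux₁ (X : L) (z : Env k A L ⊗[A] Env k A L) :
    TensorProduct.lid A _ (eps.rTensor _ (tensorX X z)) =
      iL k A L X * TensorProduct.lid A _ (eps.rTensor _ z) := by
  induction z with
  | zero => simp
  | add x y hx hy => simp only [map_add, hx, hy, mul_add]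
  | tmul D E => simp [eps_iL_mul, iL_mul_smul, add_comm]

lemma counit_aux₂ (X : L) (z : Env k A L ⊗[A] Env k A L) :
    TensorProduct.rid A _ (eps.lTensor _ (tensorX X z)) =
      iL k A L X * TensorProduct.rid A _ (eps.lTensor _ z) := by
  induction z with
  | zero => simp
  | add x y hx hy => simp only [map_add, hx, hy, mul_add]
  | tmul D E => simp [eps_iL_mul, iL_mul_smul]

lemma comm_aux (X : L) (z : Env k A L ⊗[A] Env k A L) :
    TensorProduct.comm A _ _ (tensorX X z) = tensorX X (TensorProduct.comm A _ _ z) := by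
  induction z with
  | zero => simp
  | add x y hx hy => simp only [map_add, hx, hy]
  | tmul D E => simp [add_comm]

/-- `VL` with the canonical left coproduct and left counit is an `A`-coalgebra. -/
instance : Coalgebra A (Env k A L) where
  coassoc := by
    ext D
    change TensorProduct.assoc A _ _ _ (cop.rTensor _ (cop D)) = cop.lTensor _ (cop D)
    induction D using induction with
    | one => simp [cop_one]
    | add D E hD hE => simp only [map_add, hD, hE]
    | mulA a D hD => simp only [cop_iA_mul, map_smul, hD]
    | mulL X D hD => rw [cop_iL_mul, coassoc_aux₂, coassoc_aux₃, hD]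
  rTensor_counit_comp_comul := by
    ext D
    change eps.rTensor _ (cop D) = 1 ⊗ₜ[A] D
    apply (TensorProduct.lid A (Env k A L)).injective
    rw [TensorProduct.lid_tmul, one_smul]
    induction D using induction with
    | one => simp [cop_one, eps_one]
    | add D E hD hE => simp only [map_add, hD, hE]
    | mulA a D hD => simp only [cop_iA_mul, map_smul, hD, smul_def]
    | mulL X D hD => rw [cop_iL_mul, counit_aux₁, hD]
  lTensor_counit_comp_comul := by
    ext D
    change eps.lTensor _ (cop D) = D ⊗ₜ[A] 1
    apply (TensorProduct.rid A (Env k A L)).injective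
    rw [TensorProduct.rid_tmul, one_smul]
    induction D using induction with
    | one => simp [cop_one, eps_one]
    | add D E hD hE => simp only [map_add, hD, hE]
    | mulA a D hD => simp only [cop_iA_mul, map_smul, hD, smul_def]
    | mulL X D hD => rw [cop_iL_mul, counit_aux₂, hD]

instance : Coalgebra.IsCocomm A (Env k A L) where
  comm_comp_comul := by
    ext D
    change TensorProduct.comm A _ _ (cop D) = cop D
    induction D using induction with
    | one => simp [cop_one]
    | add D E hD hE => simp only [map_add, hD, hE]
    | mulA a D hD => simp only [cop_iA_mul, map_smul, hD]
    | mulL X D hD => rw [cop_iL_mul, comm_aux, hD]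

/-- Right multiplication by `E` on `VL`, as a map of left `A`-modules. -/
def mulRight (E : Env k A L) : Env k A L →ₗ[A] Env k A L where
  toFun D := D * E
  map_add' D D' := add_mul D D' E
  map_smul' a D := smul_mul a D E

@[simp] lemma mulRight_apply (D E : Env k A L) : mulRight E D = D * E := rfl

/-! ### The Hopf-Galois map -/

/-- The Hopf-Galois map before descending to the balanced tensor product:
`D ⊗ E ↦ D₍₁₎ ⊗ D₍₂₎E`. -/
def galoisAux : Env k A L ⊗[k] Env k A L →ₗ[k] Env k A L ⊗[A] Env k A L :=
  TensorProduct.lift (LinearMap.mk₂ k (fun D E => (mulRight E).lTensor _ (cop D))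
    (fun D D' E => by simp)
    (fun c D E => by
      rw [← algebraMap_smul A c D, map_smul, map_smul, algebraMap_smul])
    (fun D E E' => by
      have h : mulRight (E + E') = mulRight E + mulRight E' := by ext x; simp [mul_add]
      rw [h, LinearMap.lTensor_add, LinearMap.add_apply])
    (fun c D E => by
      have h : mulRight (c • E) = (algebraMap k A c) • mulRight E := by ext x; simp
      rw [h, LinearMap.lTensor_smul, LinearMap.smul_apply, algebraMap_smul]))

lemma galoisAux_tmul (D E : Env k A L) :
    galoisAux (D ⊗ₜ[k] E) = (mulRight E).lTensor _ (cop D) := rfl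

lemma lTensor_mulRight_tensorX (E : Env k A L) (X : L) (z : Env k A L ⊗[A] Env k A L) :
    (mulRight E).lTensor _ (tensorX X z) = tensorX X ((mulRight E).lTensor _ z) := by
  induction z with
  | zero => simp
  | add x y hx hy => simp only [map_add, hx, hy]
  | tmul D D' => simp [mul_assoc]

lemma cop_mul_iA (D : Env k A L) (a : A) :
    cop (D * iA k A L a) = (mulRight (iA k A L a)).lTensor _ (cop D) := by
  induction D using induction with
  | one =>
    rw [one_mul, cop_iA, cop_one, LinearMap.lTensor_tmul, mulRight_apply, one_mul,
      ← mul_one (iA k A L a), ← smul_def, TensorProduct.smul_tmul]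
  | add D E hD hE => rw [add_mul, map_add, map_add, map_add, hD, hE]
  | mulA b D hD => rw [mul_assoc, cop_iA_mul, cop_iA_mul, map_smul, hD]
  | mulL X D hD => rw [mul_assoc, cop_iL_mul, cop_iL_mul, lTensor_mulRight_tensorX, hD]

variable (k A L) in
/-- The relations `Da ⊗ E = D ⊗ aE`. -/
def balanced : Submodule k (Env k A L ⊗[k] Env k A L) :=
  Submodule.span k {z | ∃ (D E : Env k A L) (a : A),
    z = (D * iA k A L a) ⊗ₜ[k] E - D ⊗ₜ[k] (iA k A L a * E)}

variable (k A L) in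
/-- The tensor product of `VL` as a right `A`-module (by right multiplication) with `VL` as a
left `A`-module (by left multiplication). -/
abbrev TensorRL : Type _ := (Env k A L ⊗[k] Env k A L) ⧸ balanced k A L

/-- The Hopf-Galois map `D ⊗ E ↦ D₍₁₎ ⊗ D₍₂₎E`, from the tensor product in which
`Da ⊗ E = D ⊗ aE` to the tensor product in which `aD ⊗ E = D ⊗ aE`. -/
def galois : TensorRL k A L →ₗ[k] Env k A L ⊗[A] Env k A L :=
  (balanced k A L).liftQ galoisAux (by
    rw [balanced, Submodule.span_le]
    rintro _ ⟨D, E, a, rfl⟩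
    rw [SetLike.mem_coe, LinearMap.mem_ker, map_sub, galoisAux_tmul, galoisAux_tmul, cop_mul_iA,
      ← LinearMap.comp_apply, ← LinearMap.lTensor_comp, sub_eq_zero]
    congr 2
    ext x
    simp [mul_assoc])

/-! ### The filtration by degree -/

variable (k A L) in
/-- The left `A`-submodule of `VL` generated by the products of at most `p` elements of `L`. -/
def degLE (p : ℕ) : Submodule A (Env k A L) :=
  Submodule.span A {D | ∃ l : List L, l.length ≤ p ∧ D = (l.map (iL k A L)).prod}

lemma degLE_mono {p q : ℕ} (h : p ≤ q) : degLE k A L p ≤ degLE k A L q := by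
  refine Submodule.span_mono ?_
  rintro _ ⟨l, hl, rfl⟩
  exact ⟨l, hl.trans h, rfl⟩

lemma one_mem_degLE (p : ℕ) : (1 : Env k A L) ∈ degLE k A L p :=
  Submodule.subset_span ⟨[], by simp, by simp⟩

lemma iL_mul_mem_degLE (X : L) {p : ℕ} {D : Env k A L} (h : D ∈ degLE k A L p) :
    iL k A L X * D ∈ degLE k A L (p + 1) := by
  induction h using Submodule.span_induction with
  | mem D hD =>
    obtain ⟨l, hl, rfl⟩ := hD
    exact Submodule.subset_span ⟨X :: l, by simpa using hl, by simp⟩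
  | zero => simp
  | add D E _ _ hD hE => rw [mul_add]; exact add_mem hD hE
  | smul a D hmem hD =>
    rw [iL_mul_smul]
    exact add_mem (Submodule.smul_mem _ _ hD)
      (Submodule.smul_mem _ _ (degLE_mono (Nat.le_succ p) hmem))

lemma exists_mem_degLE (D : Env k A L) : ∃ p, D ∈ degLE k A L p := by
  induction D using induction with
  | one => exact ⟨0, one_mem_degLE 0⟩
  | add D E hD hE =>
    obtain ⟨p, hp⟩ := hD
    obtain ⟨q, hq⟩ := hE
    exact ⟨max p q, add_mem (degLE_mono (le_max_left p q) hp) (degLE_mono (le_max_right p q) hq)⟩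
  | mulA a D hD =>
    obtain ⟨p, hp⟩ := hD
    exact ⟨p, Submodule.smul_mem _ a hp⟩
  | mulL X D hD =>
    obtain ⟨p, hp⟩ := hD
    exact ⟨p + 1, iL_mul_mem_degLE X hp⟩

end Env

/-! ### The jet space -/

/-- The infinite jet space: the projective limit over `p` of the spaces of `p`-jets
`Hom_A(VL_{≤ p}, A)` along the restriction maps. -/
@[ext] structure Jet where
  /-- The `p`-jet. -/
  jet : ∀ p : ℕ, Env.degLE k A L p →ₗ[A] A
  compat : ∀ (p q : ℕ) (h : p ≤ q),
    (jet q).comp (Submodule.inclusion (Env.degLE_mono h)) = jet p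

namespace Jet

open Env

variable {k A L}

/-- The value of an infinite jet on an element `D` of `VL`: the value at `D` of its `p`-jet, for
any `p` such that `D` has degree at most `p`. -/
def ev (φ : Jet k A L) (D : Env k A L) : A :=
  φ.jet (exists_mem_degLE D).choose ⟨D, (exists_mem_degLE D).choose_spec⟩

lemma ev_eq (φ : Jet k A L) {p : ℕ} {D : Env k A L} (h : D ∈ degLE k A L p) :
    φ.ev D = φ.jet p ⟨D, h⟩ := by
  have key : ∀ (p q : ℕ) (hp : D ∈ degLE k A L p) (hq : D ∈ degLE k A L q), p ≤ q →
      φ.jet p ⟨D, hp⟩ = φ.jet q ⟨D, hq⟩ := fun p q hp hq hpq => by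
    rw [← φ.compat p q hpq]; rfl
  rcases le_total (exists_mem_degLE D).choose p with h' | h'
  · exact key _ _ _ _ h'
  · exact (key _ _ _ _ h').symm

/-- An infinite jet as an `A`-linear map on `VL`. -/
def toDual (φ : Jet k A L) : Env k A L →ₗ[A] A where
  toFun := φ.ev
  map_add' D E := by
    obtain ⟨p, hp⟩ := exists_mem_degLE D
    obtain ⟨q, hq⟩ := exists_mem_degLE E
    have hp' := degLE_mono (le_max_left p q) hp
    have hq' := degLE_mono (le_max_right p q) hq
    rw [φ.ev_eq hp', φ.ev_eq hq', φ.ev_eq (add_mem hp' hq'), ← map_add]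
    rfl
  map_smul' a D := by
    obtain ⟨p, hp⟩ := exists_mem_degLE D
    rw [φ.ev_eq hp, φ.ev_eq (Submodule.smul_mem _ a hp), RingHom.id_apply, ← map_smul]
    rfl

@[simp] lemma toDual_apply (φ : Jet k A L) (D : Env k A L) : φ.toDual D = φ.ev D := rfl

variable (k A L) in
/-- Infinite jets are the same as `A`-linear maps `VL → A`. The right hand side carries the
convolution product with respect to the left coproduct of `VL`. -/
def equivConv : Jet k A L ≃ WithConv (Env k A L →ₗ[A] A) where
  toFun φ := WithConv.toConv φ.toDual
  invFun f :=
    { jet := fun p => f.ofConv.comp (degLE k A L p).subtype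
      compat := fun p q h => rfl }
  left_inv φ := by
    ext p ⟨D, hD⟩
    exact φ.ev_eq hD
  right_inv f := by
    ext D
    rfl

/-- The commutative ring of infinite jets, with the convolution product
`(φψ)(D) = φ(D₍₁₎) ψ(D₍₂₎)`. -/
instance : CommRing (Jet k A L) := (equivConv k A L).commRing

instance : Algebra k (Jet k A L) := (equivConv k A L).algebra k

lemma ev_ext {φ ψ : Jet k A L} (h : ∀ D, φ.ev D = ψ.ev D) : φ = ψ :=
  (equivConv k A L).injective (congrArg WithConv.toConv (LinearMap.ext h))

lemma equivConv_apply (φ : Jet k A L) (D : Env k A L) :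
    (equivConv k A L φ).ofConv D = φ.ev D := rfl

lemma ev_add (φ ψ : Jet k A L) (D : Env k A L) : (φ + ψ).ev D = φ.ev D + ψ.ev D := by
  rw [← equivConv_apply, Equiv.add_def, Equiv.apply_symm_apply]; rfl

lemma ev_zero (D : Env k A L) : (0 : Jet k A L).ev D = 0 := by
  rw [← equivConv_apply, Equiv.zero_def, Equiv.apply_symm_apply]; rfl

lemma ev_smul (c : k) (φ : Jet k A L) (D : Env k A L) : (c • φ).ev D = c • φ.ev D := by
  rw [← equivConv_apply, Equiv.smul_def, Equiv.apply_symm_apply]; rfl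

lemma ev_one (D : Env k A L) : (1 : Jet k A L).ev D = eps D := by
  rw [← equivConv_apply, Equiv.one_def, Equiv.apply_symm_apply]; rfl

lemma ev_mul (φ ψ : Jet k A L) (D : Env k A L) :
    (φ * ψ).ev D = LinearMap.mul' A A (TensorProduct.map φ.toDual ψ.toDual (cop D)) := by
  rw [← equivConv_apply, Equiv.mul_def, Equiv.apply_symm_apply]; rfl

/-- For jets `φ`, `ψ` and `D, E ∈ VL`, the pairing `(φ ⊗ ψ)(D ⊗ E) = φ(D ψ(E))`. -/
def pair (D E : Env k A L) : Jet k A L ⊗[k] Jet k A L →ₗ[k] A :=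
  TensorProduct.lift (LinearMap.mk₂ k (fun φ ψ => φ.ev (D * iA k A L (ψ.ev E)))
    (fun φ φ' ψ => by rw [ev_add])
    (fun c φ ψ => by rw [ev_smul])
    (fun φ ψ ψ' => by rw [ev_add, map_add, mul_add]; exact map_add φ.toDual _ _)
    (fun c φ ψ => by
      rw [ev_smul, map_smul, mul_smul_comm, ← algebraMap_smul A c (D * _)]
      exact (map_smul φ.toDual _ _).trans (algebraMap_smul A c _)))

lemma pair_tmul (D E : Env k A L) (φ ψ : Jet k A L) :
    pair D E (φ ⊗ₜ[k] ψ) = φ.ev (D * iA k A L (ψ.ev E)) := rfl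

/-- For a jet `φ`, the map `D ⊗ E ↦ D(φ(E))` on the tensor product in which `Da ⊗ E = D ⊗ aE`. -/
def actEv (φ : Jet k A L) : TensorRL k A L →ₗ[k] A :=
  (balanced k A L).liftQ
    (TensorProduct.lift (LinearMap.mk₂ k (fun D E => act D (φ.ev E))
      (fun D D' E => by rw [map_add, LinearMap.add_apply])
      (fun c D E => by rw [map_smul, LinearMap.smul_apply])
      (fun D E E' => by rw [← map_add]; exact congrArg _ (map_add φ.toDual E E'))
      (fun c D E => by
        rw [← map_smul, ← algebraMap_smul A c E, ← algebraMap_smul A c (φ.ev E)]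
        exact congrArg _ (map_smul φ.toDual _ _))))
    (by
      rw [balanced, Submodule.span_le]
      rintro _ ⟨D, E, a, rfl⟩
      rw [SetLike.mem_coe, LinearMap.mem_ker, map_sub, TensorProduct.lift.tmul,
        TensorProduct.lift.tmul, LinearMap.mk₂_apply, LinearMap.mk₂_apply, act_mul, act_iA,
        sub_eq_zero]
      exact congrArg _ (map_smul φ.toDual a E).symm)

lemma actEv_mk_tmul (φ : Jet k A L) (D E : Env k A L) :
    φ.actEv (Submodule.Quotient.mk (D ⊗ₜ[k] E)) = act D (φ.ev E) := rfl

end Jet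

end LieRinehart

/-! ### Filtered modules and completions -/

/-- A decreasing filtration of a `k`-module by submodules. -/
structure Filtration (k M : Type*) [CommRing k] [AddCommGroup M] [Module k M] where
  /-- The submodules of the filtration. -/
  part : ℕ → Submodule k M
  anti : Antitone part

namespace Filtration

variable {k M N : Type*} [CommRing k] [AddCommGroup M] [Module k M] [AddCommGroup N] [Module k N]

/-- The completion: the projective limit of the quotients `M / Fₙ`. -/
def Completion (F : Filtration k M) : Submodule k (∀ n, M ⧸ F.part n) where
  carrier := {x | ∀ m n (h : m ≤ n), Submodule.factor (F.anti h) (x n) = x m}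
  add_mem' hx hy m n h := by rw [Pi.add_apply, map_add, hx m n h, hy m n h, Pi.add_apply]
  zero_mem' m n h := by rw [Pi.zero_apply, map_zero, Pi.zero_apply]
  smul_mem' c x hx m n h := by rw [Pi.smul_apply, map_smul, hx m n h, Pi.smul_apply]

/-- The canonical map from a filtered module to its completion. -/
def of (F : Filtration k M) : M →ₗ[k] F.Completion :=
  LinearMap.codRestrict _ (LinearMap.pi fun n => (F.part n).mkQ) (fun _ _ _ _ => rfl)

/-- The `n`-th component of an element of the completion. -/
def proj (F : Filtration k M) (n : ℕ) : F.Completion →ₗ[k] M ⧸ F.part n :=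
  (LinearMap.proj n).comp F.Completion.subtype

/-- The value at a point `x` of the completion, of the continuous extension of a map `f` from `M`
to a discrete set, exists and is `b`: the map `f` is equal to `b` on all `u ∈ M` that are
sufficiently close to `x`. -/
def ExtendsTo (F : Filtration k M) {B : Type*} (f : M → B) (x : F.Completion) (b : B) : Prop :=
  ∃ n, ∀ u : M, (F.part n).mkQ u = F.proj n x → f u = b

/-- The continuous extension of `f : M → N` to the completions exists at `x` and maps `x` to `y`. -/
def MapsTo (F : Filtration k M) (G : Filtration k N) (f : M →ₗ[k] N) (x : F.Completion)
    (y : G.Completion) : Prop :=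
  ∀ p, F.ExtendsTo (fun u => (G.part p).mkQ (f u)) x (G.proj p y)

end Filtration

/-- The filtration `F` makes the `k`-algebra `H` a complete filtered algebra. -/
structure Filtration.IsCompleteAlgebra {k H : Type*} [CommRing k] [Ring H] [Algebra k H]
    (F : Filtration k H) : Prop where
  part_zero : F.part 0 = ⊤
  mul_mem : ∀ (p q : ℕ) (x y : H), x ∈ F.part p → y ∈ F.part q → x * y ∈ F.part (p + q)
  complete : Function.Bijective F.of

/-! ### Completed tensor products over a noncommutative base -/

section Tensor

variable {k H A A' : Type*} [CommRing k] [AddCommGroup H] [Module k H]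
  [AddCommGroup A] [Module k A] [AddCommGroup A'] [Module k A']

/-- The filtration of `H ⊗[k] H` whose completion is the completed tensor product `H ⊗̂_A H`, where
`lam` and `rho` are the left and the right action of `A` on `H`: the `n`-th submodule is spanned by
the relations `h a ⊗ h' = h ⊗ a h'` and by the `h ⊗ h'` with `h ∈ Fₙ` or `h' ∈ Fₙ`, so that
its quotient is `H / Fₙ ⊗_A H / Fₙ` when the `Fₙ` are stable under `A`. -/
def tensorFil (F : Filtration k H) (lam rho : A →ₗ[k] Module.End k H) :
    Filtration k (H ⊗[k] H) where
  part n := Submodule.span k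
    ({z | ∃ (a : A) (h h' : H), z = rho a h ⊗ₜ[k] h' - h ⊗ₜ[k] lam a h'} ∪
      {z | ∃ h h' : H, (h ∈ F.part n ∨ h' ∈ F.part n) ∧ z = h ⊗ₜ[k] h'})
  anti m n hmn := by
    refine Submodule.span_mono (Set.union_subset_union_right _ ?_)
    rintro _ ⟨h, h', hh, rfl⟩
    exact ⟨h, h', hh.imp (fun H => F.anti hmn H) (fun H => F.anti hmn H), rfl⟩

/-- The filtration of `H ⊗[k] (H ⊗[k] H)` whose completion is the completed tensor product
`H ⊗̂_A H ⊗̂_A' H`, where `lam`, `rho` are the actions of `A` and `lam'`, `rho'` are those of `A'`. -/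
def tensorFil₃ (F : Filtration k H) (lam rho : A →ₗ[k] Module.End k H)
    (lam' rho' : A' →ₗ[k] Module.End k H) : Filtration k (H ⊗[k] (H ⊗[k] H)) where
  part n := Submodule.span k
    ({z | ∃ (a : A) (h h' h'' : H),
        z = rho a h ⊗ₜ[k] (h' ⊗ₜ[k] h'') - h ⊗ₜ[k] (lam a h' ⊗ₜ[k] h'')} ∪
      {z | ∃ (a : A') (h h' h'' : H),
        z = h ⊗ₜ[k] (rho' a h' ⊗ₜ[k] h'') - h ⊗ₜ[k] (h' ⊗ₜ[k] lam' a h'')} ∪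
      {z | ∃ h h' h'' : H, (h ∈ F.part n ∨ h' ∈ F.part n ∨ h'' ∈ F.part n) ∧
        z = h ⊗ₜ[k] (h' ⊗ₜ[k] h'')})
  anti m n hmn := by
    refine Submodule.span_mono (Set.union_subset_union_right _ ?_)
    rintro _ ⟨h, h', h'', hh, rfl⟩
    exact ⟨h, h', h'', hh.imp (fun H => F.anti hmn H)
      (Or.imp (fun H => F.anti hmn H) (fun H => F.anti hmn H)), rfl⟩

variable (F : Filtration k H) (lam rho : A →ₗ[k] Module.End k H)
  (lam' rho' : A' →ₗ[k] Module.End k H)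

/-- The map `(u, h) ↦ u ⊗ h` from `H ⊗_A H` and `H` to `H ⊗_A H ⊗_A' H`, at level `n`. -/
def appendRight (n : ℕ) : ((H ⊗[k] H) ⧸ (tensorFil F lam rho).part n) →ₗ[k] H →ₗ[k]
    (H ⊗[k] (H ⊗[k] H)) ⧸ (tensorFil₃ F lam rho lam' rho').part n :=
  Submodule.liftQ _
    (TensorProduct.curry (((tensorFil₃ F lam rho lam' rho').part n).mkQ.comp
      (TensorProduct.assoc k H H H).toLinearMap))
    (by
      refine Submodule.span_le.2 ?_
      rintro _ (⟨a, h, h', rfl⟩ | ⟨h, h', hh, rfl⟩)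
      · rw [SetLike.mem_coe, LinearMap.mem_ker]
        ext h''
        refine (Submodule.Quotient.mk_eq_zero _).2 (Submodule.subset_span (Or.inl (Or.inl ?_)))
        exact ⟨a, h, h', h'', by simp⟩
      · rw [SetLike.mem_coe, LinearMap.mem_ker]
        ext h''
        refine (Submodule.Quotient.mk_eq_zero _).2 (Submodule.subset_span (Or.inr ?_))
        exact ⟨h, h', h'', hh.imp_right Or.inl, rfl⟩)

/-- The map `(h, u) ↦ h ⊗ u` from `H` and `H ⊗_A' H` to `H ⊗_A H ⊗_A' H`, at level `n`, with the
arguments exchanged. -/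
def appendLeft (n : ℕ) : ((H ⊗[k] H) ⧸ (tensorFil F lam' rho').part n) →ₗ[k] H →ₗ[k]
    (H ⊗[k] (H ⊗[k] H)) ⧸ (tensorFil₃ F lam rho lam' rho').part n :=
  Submodule.liftQ _
    ((TensorProduct.mk k H (H ⊗[k] H)).compr₂
      ((tensorFil₃ F lam rho lam' rho').part n).mkQ).flip
    (by
      refine Submodule.span_le.2 ?_
      rintro _ (⟨a, h', h'', rfl⟩ | ⟨h', h'', hh, rfl⟩)
      · rw [SetLike.mem_coe, LinearMap.mem_ker]
        ext h
        refine (Submodule.Quotient.mk_eq_zero _).2 (Submodule.subset_span (Or.inl (Or.inr ?_)))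
        exact ⟨a, h, h', h'', by simp [TensorProduct.tmul_sub]⟩
      · rw [SetLike.mem_coe, LinearMap.mem_ker]
        ext h
        refine (Submodule.Quotient.mk_eq_zero _).2 (Submodule.subset_span (Or.inr ?_))
        exact ⟨h, h', h'', Or.inr hh, rfl⟩)

/-- For `D : H → H ⊗̂_A H`, the map `D ⊗ id : H ⊗ H → H ⊗_A H ⊗_A' H` at level `n`. -/
def comulId (D : H →ₗ[k] (tensorFil F lam rho).Completion) (n : ℕ) :
    H ⊗[k] H →ₗ[k] (H ⊗[k] (H ⊗[k] H)) ⧸ (tensorFil₃ F lam rho lam' rho').part n :=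
  TensorProduct.lift
    ((appendRight F lam rho lam' rho' n).comp (((tensorFil F lam rho).proj n).comp D))

/-- For `D : H → H ⊗̂_A' H`, the map `id ⊗ D : H ⊗ H → H ⊗_A H ⊗_A' H` at level `n`. -/
def idComul (D : H →ₗ[k] (tensorFil F lam' rho').Completion) (n : ℕ) :
    H ⊗[k] H →ₗ[k] (H ⊗[k] (H ⊗[k] H)) ⧸ (tensorFil₃ F lam rho lam' rho').part n :=
  TensorProduct.lift
    ((appendLeft F lam rho lam' rho' n).comp (((tensorFil F lam' rho').proj n).comp D)).flip

/-- Coassociativity with two coproducts: the identity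
`(D₁ ⊗ id) ∘ D₂ = (id ⊗ D₂) ∘ D₁` of maps from `H` to `H ⊗̂_A H ⊗̂_A' H`, where
`D₁ : H → H ⊗̂_A H` and `D₂ : H → H ⊗̂_A' H`. That `D₁ ⊗ id` and `id ⊗ D₂` extend to the
completed tensor products is part of the statement. -/
def Coassoc (D₁ : H →ₗ[k] (tensorFil F lam rho).Completion)
    (D₂ : H →ₗ[k] (tensorFil F lam' rho').Completion) : Prop :=
  ∀ (h : H) (n : ℕ), ∃ c : (H ⊗[k] (H ⊗[k] H)) ⧸ (tensorFil₃ F lam rho lam' rho').part n,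
    (tensorFil F lam' rho').ExtendsTo (comulId F lam rho lam' rho' D₁ n) (D₂ h) c ∧
    (tensorFil F lam rho).ExtendsTo (idComul F lam rho lam' rho' D₂ n) (D₁ h) c

end Tensor

/-! ### Bialgebroids and Hopf algebroids -/

/-- `D` and `e` make `H`, with the `(A, A)`-bimodule structure given by the left action `lam` and
the right action `rho`, an `A`-coring, with respect to completed tensor products. -/
structure IsCoring {k A H : Type*} [CommRing k] [Ring A] [Algebra k A] [AddCommGroup H]
    [Module k H] (F : Filtration k H) (lam rho : A →ₗ[k] Module.End k H)
    (D : H →ₗ[k] (tensorFil F lam rho).Completion) (e : H →ₗ[k] A) : Prop where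
  comul_continuous : ∀ p, ∃ q, ∀ h ∈ F.part q, (tensorFil F lam rho).proj p (D h) = 0
  counit_continuous : ∃ q, ∀ h ∈ F.part q, e h = 0
  /-- `D(a h) = a D(h)` -/
  comul_lam : ∀ a h, (tensorFil F lam rho).MapsTo (tensorFil F lam rho)
    ((lam a).rTensor H) (D h) (D (lam a h))
  /-- `D(h a) = D(h) a` -/
  comul_rho : ∀ a h, (tensorFil F lam rho).MapsTo (tensorFil F lam rho)
    ((rho a).lTensor H) (D h) (D (rho a h))
  counit_lam : ∀ a h, e (lam a h) = a * e h
  counit_rho : ∀ a h, e (rho a h) = e h * a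
  coassoc : Coassoc F lam rho lam rho D D
  /-- `e(h₍₁₎) h₍₂₎ = h` -/
  counit_comul : ∀ h, (tensorFil F lam rho).MapsTo F
    (TensorProduct.lift (lam.comp e)) (D h) (F.of h)
  /-- `h₍₁₎ e(h₍₂₎) = h` -/
  comul_counit : ∀ h, (tensorFil F lam rho).MapsTo F
    (TensorProduct.lift (rho.comp e).flip) (D h) (F.of h)

/-- `D : H → H ⊗̂_A H` is unital and multiplicative for factorwise multiplication:
`D(1) = 1 ⊗ 1` and `D(hh') = D(h) D(h')`. That the factorwise product of `D(h)` and `D(h')` does not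
depend on representatives is part of the statement. -/
structure IsMultiplicative {k A H : Type*} [CommRing k] [Ring A] [Algebra k A] [Ring H]
    [Algebra k H] (F : Filtration k H) (lam rho : A →ₗ[k] Module.End k H)
    (D : H →ₗ[k] (tensorFil F lam rho).Completion) : Prop where
  map_one : D 1 = (tensorFil F lam rho).of (1 ⊗ₜ[k] 1)
  map_mul : ∀ h h' p, ∃ q, ∀ u v : H ⊗[k] H,
    ((tensorFil F lam rho).part q).mkQ u = (tensorFil F lam rho).proj q (D h) →
    ((tensorFil F lam rho).part q).mkQ v = (tensorFil F lam rho).proj q (D h') →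
    ((tensorFil F lam rho).part p).mkQ (u * v) = (tensorFil F lam rho).proj p (D (h * h'))

section Bialgebroid

variable (k : Type*) {A H : Type*} [CommRing k] [Ring A] [Algebra k A] [Ring H] [Algebra k H]

/-- The action `(a, h) ↦ f(a) h`. -/
def leftMulBy (f : A →ₗ[k] H) : A →ₗ[k] Module.End k H := (LinearMap.mul k H).comp f

/-- The action `(a, h) ↦ h f(a)`. -/
def rightMulBy (f : A →ₗ[k] H) : A →ₗ[k] Module.End k H := (LinearMap.mul k H).flip.comp f

/-- The linear map `a ↦ t(a)` underlying a morphism `t : Aᵒᵖ → H`. -/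
def unopLin (t : Aᵐᵒᵖ →ₐ[k] H) : A →ₗ[k] H :=
  t.toLinearMap.comp (MulOpposite.opLinearEquiv k).toLinearMap

end Bialgebroid

open MulOpposite in
/-- A left bialgebroid structure over the `k`-algebra `A` on the filtered `k`-algebra `H`, with
respect to completed tensor products, for the bimodule structure `a ⬝ h ⬝ b = s(a) t(b) h`. -/
@[ext] structure LeftBialgebroid (k A H : Type*) [CommRing k] [Ring A] [Algebra k A] [Ring H]
    [Algebra k H] (F : Filtration k H) where
  /-- source -/
  s : A →ₐ[k] H
  /-- target -/
  t : Aᵐᵒᵖ →ₐ[k] H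
  commute : ∀ a b, s a * t b = t b * s a
  /-- coproduct -/
  comul : H →ₗ[k]
    (tensorFil F (leftMulBy k s.toLinearMap) (leftMulBy k (unopLin k t))).Completion
  /-- counit -/
  counit : H →ₗ[k] A
  coring : IsCoring F (leftMulBy k s.toLinearMap) (leftMulBy k (unopLin k t)) comul counit
  /-- the coproduct takes values in the Takeuchi product: `h₍₁₎ t(a) ⊗ h₍₂₎ = h₍₁₎ ⊗ h₍₂₎ s(a)` -/
  takeuchi : ∀ h a, ∃ y, Filtration.MapsTo _ _
      (LinearMap.mulRight k (t (op a) ⊗ₜ[k] (1 : H))) (comul h) y ∧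
    Filtration.MapsTo _ (tensorFil F (leftMulBy k s.toLinearMap) (leftMulBy k (unopLin k t)))
      (LinearMap.mulRight k ((1 : H) ⊗ₜ[k] s a)) (comul h) y
  multiplicative :
    IsMultiplicative F (leftMulBy k s.toLinearMap) (leftMulBy k (unopLin k t)) comul
  counit_one : counit 1 = 1
  counit_mul_s : ∀ h h', counit (h * h') = counit (h * s (counit h'))
  counit_mul_t : ∀ h h', counit (h * h') = counit (h * t (op (counit h')))

open MulOpposite in
/-- A right bialgebroid structure over the `k`-algebra `A` on the filtered `k`-algebra `H`, with
respect to completed tensor products, for the bimodule structure `a ⬝ h ⬝ b = h t(a) s(b)`. -/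
@[ext] structure RightBialgebroid (k A H : Type*) [CommRing k] [Ring A] [Algebra k A] [Ring H]
    [Algebra k H] (F : Filtration k H) where
  /-- source -/
  s : A →ₐ[k] H
  /-- target -/
  t : Aᵐᵒᵖ →ₐ[k] H
  commute : ∀ a b, s a * t b = t b * s a
  /-- coproduct -/
  comul : H →ₗ[k]
    (tensorFil F (rightMulBy k (unopLin k t)) (rightMulBy k s.toLinearMap)).Completion
  /-- counit -/
  counit : H →ₗ[k] A
  coring : IsCoring F (rightMulBy k (unopLin k t)) (rightMulBy k s.toLinearMap) comul counit
  /-- the coproduct takes values in the Takeuchi product: `s(a) h⁽¹⁾ ⊗ h⁽²⁾ = h⁽¹⁾ ⊗ t(a) h⁽²⁾` -/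
  takeuchi : ∀ h a, ∃ y, Filtration.MapsTo _ _
      (LinearMap.mulLeft k (s a ⊗ₜ[k] (1 : H))) (comul h) y ∧
    Filtration.MapsTo _ (tensorFil F (rightMulBy k (unopLin k t)) (rightMulBy k s.toLinearMap))
      (LinearMap.mulLeft k ((1 : H) ⊗ₜ[k] t (op a))) (comul h) y
  multiplicative :
    IsMultiplicative F (rightMulBy k (unopLin k t)) (rightMulBy k s.toLinearMap) comul
  counit_one : counit 1 = 1
  counit_s_mul : ∀ h h', counit (h * h') = counit (s (counit h) * h')
  counit_t_mul : ∀ h h', counit (h * h') = counit (t (op (counit h)) * h')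

open MulOpposite in
/-- A Hopf algebroid structure on the filtered `k`-algebra `H`, with respect to completed tensor
products: a left bialgebroid over `Al`, a right bialgebroid over `Ar`, and an antipode. -/
@[ext] structure HopfAlgebroid (k Al Ar H : Type*) [CommRing k] [Ring Al] [Algebra k Al] [Ring Ar]
    [Algebra k Ar] [Ring H] [Algebra k H] (F : Filtration k H) where
  /-- the left bialgebroid -/
  left : LeftBialgebroid k Al H F
  /-- the right bialgebroid -/
  right : RightBialgebroid k Ar H F
  /-- the antipode -/
  S : H →ₗ[k] H
  sl_el_tr : ∀ a, left.s (left.counit (right.t (op a))) = right.t (op a)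
  tl_el_sr : ∀ a, left.t (op (left.counit (right.s a))) = right.s a
  sr_er_tl : ∀ a, right.s (right.counit (left.t (op a))) = left.t (op a)
  tr_er_sl : ∀ a, right.t (op (right.counit (left.s a))) = left.s a
  /-- `(Δₗ ⊗ id) Δᵣ = (id ⊗ Δᵣ) Δₗ` -/
  coassoc_left_right : Coassoc F (leftMulBy k left.s.toLinearMap) (leftMulBy k (unopLin k left.t))
    (rightMulBy k (unopLin k right.t)) (rightMulBy k right.s.toLinearMap) left.comul right.comul
  /-- `(Δᵣ ⊗ id) Δₗ = (id ⊗ Δₗ) Δᵣ` -/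
  coassoc_right_left : Coassoc F (rightMulBy k (unopLin k right.t))
    (rightMulBy k right.s.toLinearMap) (leftMulBy k left.s.toLinearMap)
    (leftMulBy k (unopLin k left.t)) right.comul left.comul
  S_bimodule : ∀ a b h,
    S (left.t (op a) * h * right.t (op b)) = right.s b * S h * left.s a
  S_continuous : ∀ p, ∃ q, ∀ h ∈ F.part q, S h ∈ F.part p
  /-- `S(h₍₁₎) h₍₂₎ = sᵣ(εᵣ(h))` -/
  antipode_left : ∀ h, Filtration.MapsTo _ F
    (TensorProduct.lift ((LinearMap.mul k H).comp S)) (left.comul h) (F.of (right.s (right.counit h)))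
  /-- `h⁽¹⁾ S(h⁽²⁾) = sₗ(εₗ(h))` -/
  antipode_right : ∀ h, Filtration.MapsTo _ F
    (TensorProduct.lift ((LinearMap.mul k H).compl₂ S)) (right.comul h)
    (F.of (left.s (left.counit h)))

namespace LieRinehart

variable (k A L : Type*) [CommRing k] [CommRing A] [Algebra k A] [LieRing L] [LieAlgebra k L]
  [Module A L] [LieRingModule L A] [LieRinehartRing A L] [LieRinehartAlgebra k A L]

/-- The filtration of the space of infinite jets: the `n`-th submodule consists of the infinite
jets whose `m`-jet is zero for all `m < n`. -/
def jetFil : Filtration k (Jet k A L) where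
  part n :=
    { carrier := {φ | ∀ m < n, φ.jet m = 0}
      add_mem' := fun {φ ψ} hφ hψ m hm => by
        ext ⟨D, hD⟩
        have h1 := congrArg (fun f => f ⟨D, hD⟩) (hφ m hm)
        have h2 := congrArg (fun f => f ⟨D, hD⟩) (hψ m hm)
        simp only [← Jet.ev_eq _ hD, LinearMap.zero_apply] at h1 h2 ⊢
        rw [Jet.ev_add, h1, h2, add_zero]
      zero_mem' := fun m _ => by
        ext ⟨D, hD⟩
        rw [← Jet.ev_eq _ hD, Jet.ev_zero, LinearMap.zero_apply]
      smul_mem' := fun c φ hφ m hm => by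
        ext ⟨D, hD⟩
        have h1 := congrArg (fun f => f ⟨D, hD⟩) (hφ m hm)
        simp only [← Jet.ev_eq _ hD, LinearMap.zero_apply] at h1 ⊢
        rw [Jet.ev_smul, h1, smul_zero] }
  anti _ _ h _ hφ m hm := hφ m (hm.trans_le h)

variable {k A L} in
/-- The Hopf algebroid structures on the jet space whose structure maps are those determined by
the canonical left coproduct, left counit, product and Hopf-Galois map of `VL`. -/
structure IsJetHopfAlgebroid (𝓗 : HopfAlgebroid k A A (Jet k A L) (jetFil k A L)) : Prop where
  /-- The left source map is `s(a)(D) = a ε(D)`. -/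
  left_s : ∀ (a : A) (D : Env k A L), (𝓗.left.s a).ev D = a * Env.eps D
  /-- The left target map is `t(a)(D) = D(a)`. -/
  left_t : ∀ (a : A) (D : Env k A L), (𝓗.left.t (MulOpposite.op a)).ev D = Env.act D a
  /-- The right source map is `t`. -/
  right_s : ∀ (a : A) (D : Env k A L), (𝓗.right.s a).ev D = Env.act D a
  /-- The right target map is `s`. -/
  right_t : ∀ (a : A) (D : Env k A L), (𝓗.right.t (MulOpposite.op a)).ev D = a * Env.eps D
  /-- The left coproduct is dual to the product of `VL`: `φ₍₁₎(D φ₍₂₎(E)) = φ(DE)`. -/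
  left_comul : ∀ (φ : Jet k A L) (D E : Env k A L),
    Filtration.ExtendsTo _ (Jet.pair D E) (𝓗.left.comul φ) (φ.ev (D * E))
  /-- The right coproduct is dual to the product of `VL` in the same way. -/
  right_comul : ∀ (φ : Jet k A L) (D E : Env k A L),
    Filtration.ExtendsTo _ (Jet.pair D E) (𝓗.right.comul φ) (φ.ev (D * E))
  left_counit : ∀ φ : Jet k A L, 𝓗.left.counit φ = φ.ev 1
  right_counit : ∀ φ : Jet k A L, 𝓗.right.counit φ = φ.ev 1
  /-- The antipode is `(Sφ)(D) = D₊(φ(D₋))`, where `D₊ ⊗ D₋` is the preimage of `D ⊗ 1` under the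
  Hopf-Galois map. -/
  antipode : ∀ (φ : Jet k A L) (D : Env k A L) (z : Env.TensorRL k A L),
    Env.galois z = D ⊗ₜ[A] 1 → (𝓗.S φ).ev D = φ.actEv z

end LieRinehart

end

noncomputable section

namespace LieRinehart

variable {k A L : Type*} [CommRing k] [CommRing A] [Algebra k A] [LieRing L] [LieAlgebra k L]
  [Module A L] [LieRingModule L A] [LieRinehartRing A L] [LieRinehartAlgebra k A L]

namespace Env

/-! ### The inverse of the Hopf-Galois map -/

/-! Every assertion about jets is dual to an assertion about `VL`, and two facts about `VL` carry
the proof.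

The first is an explicit inverse D ⊗ E ↦ D₊ ⊗ D₋E of β. The translation map has to satisfy 1₊ ⊗ 1₋ =
1 ⊗ 1, (aD)₊ ⊗ (aD)₋ = aD₊ ⊗ D₋ and (XD)₊ ⊗ (XD)₋ = XD₊ ⊗ D₋ - D₊ ⊗ D₋X. The relation (aX)z = a(Xz)
for the operators on the right needs az = za. The tensors with this property are stable under the
operators and contain 1 ⊗ 1, so the universal property of `VL` yields the map (`transAct`, `trans`).

The second is `exists_dualBasis`: the module of operators of degree at most p has a finite dual
basis made of infinite jets. For free L it comes from the Poincaré-Birkhoff-Witt theorem: the free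
module on commutative monomials carries an action of L, built by recursion on the degree, whose
flatness rests on the Jacobi identity (`PBW.flat_mono`). A finitely generated projective L is a
retract, as a Lie-Rinehart algebra, of its semidirect product with a free module, and that product
is itself free by the Eilenberg swindle (`FreeExt.exists_basis`).

The dual basis makes the pairing ⟨φ ⊗ ψ, D ⊗ E⟩ = φ(D ψ(E)) detect the filtration of the tensor
product (`IsDualAction.mem_tensorFil`, `IsDualAction.mem_tensorFil₃`). Hence the coproduct with ⟨Δφ,
D ⊗ E⟩ = φ(DE) exists and is unique, and its axioms become identities in `VL`: coassociativity is
associativity, the counit laws are the unit laws, the Takeuchi condition is (Da)E = D(aE),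
multiplicativity is that of Δₗ. The left and right bimodule structures satisfy the same formulas
(`IsDualAction`), so one argument serves both.

For the antipode, the two axioms reduce to D₍₁₎₊ ⊗ D₍₁₎₋D₍₂₎ = D ⊗ 1 and D₊D₋ = ε(D), and S² = id is
D₊D₋₊ ⊗ D₋₋ = 1 ⊗ D (`transRight_trans`). Uniqueness holds because all structure maps are prescribed
by values or pairings. -/

lemma balanced_map_le {N : Type*} [AddCommGroup N] [Module k N]
    {f : Env k A L ⊗[k] Env k A L →ₗ[k] N}
    (hf : ∀ (D E : Env k A L) (a : A), f ((D * iA k A L a) ⊗ₜ[k] E) = f (D ⊗ₜ[k] (iA k A L a * E))) :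
    balanced k A L ≤ LinearMap.ker f := by
  rw [balanced, Submodule.span_le]
  rintro _ ⟨D, E, a, rfl⟩
  rw [SetLike.mem_coe, LinearMap.mem_ker, map_sub, hf, sub_self]

/-- The class of `D ⊗ E` in the balanced tensor product. -/
def rl (D E : Env k A L) : TensorRL k A L := Submodule.Quotient.mk (D ⊗ₜ[k] E)

lemma rl_mul_iA (D E : Env k A L) (a : A) : rl (D * iA k A L a) E = rl D (iA k A L a * E) :=
  (Submodule.Quotient.eq _).2 (Submodule.subset_span ⟨D, E, a, rfl⟩)

lemma rl_add_left (D D' E : Env k A L) : rl (D + D') E = rl D E + rl D' E := by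
  simp [rl, TensorProduct.add_tmul]

lemma rl_add_right (D E E' : Env k A L) : rl D (E + E') = rl D E + rl D E' := by
  simp [rl, TensorProduct.tmul_add]

lemma rl_sub_left (D D' E : Env k A L) : rl (D - D') E = rl D E - rl D' E := by
  simp [rl, TensorProduct.sub_tmul]

lemma rl_smul_left (c : k) (D E : Env k A L) : rl (c • D) E = c • rl D E := by
  rw [rl, ← TensorProduct.smul_tmul']; rfl

lemma rl_smul_right (c : k) (D E : Env k A L) : rl D (c • E) = c • rl D E := by
  simp [rl, TensorProduct.tmul_smul]

lemma rl_induction {P : TensorRL k A L → Prop} (add : ∀ z w, P z → P w → P (z + w))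
    (tmul : ∀ D E, P (rl D E)) (z : TensorRL k A L) : P z := by
  obtain ⟨u, rfl⟩ := Submodule.Quotient.mk_surjective _ z
  induction u with
  | zero => simpa [rl] using tmul 0 0
  | add x y hx hy => exact add _ _ hx hy
  | tmul D E => exact tmul D E

section lift
variable {N : Type*} [AddCommGroup N] [Module k N] (f : Env k A L →ₗ[k] Env k A L →ₗ[k] N)
  (hf : ∀ (D E : Env k A L) (a : A), f (D * iA k A L a) E = f D (iA k A L a * E))

/-- The map on the balanced tensor product induced by a balanced bilinear map. -/
def rlLift : TensorRL k A L →ₗ[k] N :=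
  (balanced k A L).liftQ (TensorProduct.lift f) (balanced_map_le (by simpa using hf))

@[simp] lemma rlLift_rl (D E : Env k A L) : rlLift f hf (rl D E) = f D E := rfl

end lift

lemma rl_hom_ext {N : Type*} [AddCommGroup N] [Module k N] {f g : TensorRL k A L →ₗ[k] N}
    (h : ∀ D E, f (rl D E) = g (rl D E)) : f = g := by
  refine LinearMap.ext fun z => ?_
  induction z using rl_induction with
  | add z w hz hw => rw [map_add, map_add, hz, hw]
  | tmul D E => exact h D E

variable (k A L) in
/-- The bilinear map `(D, E) ↦ D ⊗ E` to the balanced tensor product. -/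
def rlMk : Env k A L →ₗ[k] Env k A L →ₗ[k] TensorRL k A L :=
  LinearMap.mk₂ k rl rl_add_left rl_smul_left rl_add_right rl_smul_right

@[simp] lemma rlMk_apply (D E : Env k A L) : rlMk k A L D E = rl D E := rfl

/-- Left multiplication `D' ⊗ E' ↦ D D' ⊗ E'` on the balanced tensor product. -/
def rlLeft : Env k A L →ₗ[k] Module.End k (TensorRL k A L) where
  toFun D := rlLift ((rlMk k A L).comp (LinearMap.mulLeft k D))
    (fun D' E a => by simp [← mul_assoc, rl_mul_iA])
  map_add' D D' := rl_hom_ext fun F E => by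
    change rl ((D + D') * F) E = rl (D * F) E + rl (D' * F) E
    rw [add_mul, rl_add_left]
  map_smul' c D := rl_hom_ext fun F E => by
    change rl ((c • D) * F) E = c • rl (D * F) E
    rw [smul_mul_assoc, rl_smul_left]

@[simp] lemma rlLeft_rl (D D' E : Env k A L) : rlLeft D (rl D' E) = rl (D * D') E := rfl

/-- Right multiplication `D' ⊗ E' ↦ D' ⊗ E'E` on the balanced tensor product. -/
def rlRight : Env k A L →ₗ[k] Module.End k (TensorRL k A L) where
  toFun E := rlLift ((rlMk k A L).compl₂ (LinearMap.mulRight k E))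
    (fun D' E a => by simp [mul_assoc, rl_mul_iA])
  map_add' D D' := rl_hom_ext fun F E => by simp [mul_add, rl_add_right]
  map_smul' c D := rl_hom_ext fun F E => by simp

@[simp] lemma rlRight_rl (E D E' : Env k A L) : rlRight E (rl D E') = rl D (E' * E) := rfl

lemma rlLeft_mul (D D' : Env k A L) (z : TensorRL k A L) :
    rlLeft (D * D') z = rlLeft D (rlLeft D' z) := by
  induction z using rl_induction with
  | add z w hz hw => simp only [map_add, hz, hw]
  | tmul F E => simp [mul_assoc]

lemma rlRight_mul (E E' : Env k A L) (z : TensorRL k A L) :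
    rlRight (E * E') z = rlRight E' (rlRight E z) := by
  induction z using rl_induction with
  | add z w hz hw => simp only [map_add, hz, hw]
  | tmul F E => simp [mul_assoc]

lemma rlLeft_rlRight (D E : Env k A L) (z : TensorRL k A L) :
    rlLeft D (rlRight E z) = rlRight E (rlLeft D z) := by
  induction z using rl_induction with
  | add z w hz hw => simp only [map_add, hz, hw]
  | tmul F E => simp

@[simp] lemma rlLeft_one (z : TensorRL k A L) : rlLeft 1 z = z := by
  induction z using rl_induction with
  | add z w hz hw => simp only [map_add, hz, hw]
  | tmul F E => simp

@[simp] lemma rlRight_one (z : TensorRL k A L) : rlRight 1 z = z := by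
  induction z using rl_induction with
  | add z w hz hw => simp only [map_add, hz, hw]
  | tmul F E => simp

variable (k A L) in
/-- The elements of the balanced tensor product on which the outer left and right multiplications
by elements of `A` agree. -/
def centralRL : Submodule k (TensorRL k A L) where
  carrier := {z | ∀ a : A, rlLeft (iA k A L a) z = rlRight (iA k A L a) z}
  add_mem' hz hw a := by rw [map_add, map_add, hz a, hw a]
  zero_mem' a := by rw [map_zero, map_zero]
  smul_mem' c z hz a := by rw [map_smul, map_smul, hz a]

lemma iA_mul_iL (a : A) (X : L) :
    iA k A L a * iL k A L X = iL k A L X * iA k A L a - iA k A L ⁅X, a⁆ := by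
  rw [iL_mul_iA]; abel

lemma centralRL_left (a : A) {z : TensorRL k A L} (hz : z ∈ centralRL k A L) :
    rlLeft (iA k A L a) z ∈ centralRL k A L := fun b => by
  rw [← rlLeft_rlRight, ← hz b, ← rlLeft_mul, ← rlLeft_mul, ← map_mul, ← map_mul, mul_comm]

/-- Commuting a past X produces X(a)z on one side and zX(a) on the other; they cancel because z also
commutes with X(a). -/
lemma centralRL_lie (X : L) {z : TensorRL k A L} (hz : z ∈ centralRL k A L) :
    rlLeft (iL k A L X) z - rlRight (iL k A L X) z ∈ centralRL k A L := fun a => by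
  simp only [map_sub]
  rw [← rlLeft_mul, iA_mul_iL, map_sub, LinearMap.sub_apply, rlLeft_mul, hz a, hz ⁅X, a⁆,
    rlLeft_rlRight, rlLeft_rlRight, hz a, ← rlRight_mul, ← rlRight_mul, iL_mul_iA, map_add,
    LinearMap.add_apply]
  abel

/-- The operator `z ↦ a z` on the central elements. -/
def transA : A →ₐ[k] Module.End k (centralRL k A L) :=
  AlgHom.ofLinearMap
    (LinearMap.mk₂ k (fun a z => (⟨rlLeft (iA k A L a) z, centralRL_left a z.2⟩ : centralRL k A L))
      (fun a b z => by ext1; simp) (fun c a z => by ext1; simp)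
      (fun a z w => by ext1; simp) (fun c a z => by ext1; simp))
    (by ext1 z; ext1; simp)
    (fun a b => by ext1 z; ext1; simp [rlLeft_mul])

lemma transA_coe (a : A) (z : centralRL k A L) :
    (transA a z : TensorRL k A L) = rlLeft (iA k A L a) z := rfl

/-- The operator `z ↦ X z - z X` on the central elements. -/
def transL : L →ₗ[k] Module.End k (centralRL k A L) :=
  LinearMap.mk₂ k (fun X z =>
      (⟨rlLeft (iL k A L X) z - rlRight (iL k A L X) z, centralRL_lie X z.2⟩ : centralRL k A L))
    (fun a b z => by ext1; simp; abel) (fun c a z => by ext1; simp [smul_sub])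
    (fun a z w => by ext1; simp; abel) (fun c a z => by ext1; simp [smul_sub])

lemma transL_coe (X : L) (z : centralRL k A L) :
    (transL X z : TensorRL k A L) = rlLeft (iL k A L X) z - rlRight (iL k A L X) z := rfl

/-- The action of `VL` on the central elements for which `a` acts as left multiplication and `X`
as `z ↦ X z - z X`. -/
def transAct : Env k A L →ₐ[k] Module.End k (centralRL k A L) :=
  lift (W := Module.End k (centralRL k A L)) transA transL
    (fun X Y => by
      ext1 z; ext1
      simp only [LinearMap.sub_apply, Module.End.mul_apply, AddSubgroupClass.coe_sub, transL_coe,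
        iL_lie, map_sub, rlLeft_mul, rlRight_mul, rlLeft_rlRight]
      abel)
    (fun a X => by
      ext1 z; ext1
      simp only [Module.End.mul_apply, transL_coe, transA_coe, iL_smul, map_sub, rlLeft_mul,
        rlRight_mul, rlLeft_rlRight, z.2 a])
    (fun X a => by
      ext1 z; ext1
      simp only [LinearMap.sub_apply, Module.End.mul_apply, AddSubgroupClass.coe_sub, transL_coe,
        transA_coe, map_sub, ← rlLeft_mul, rlLeft_rlRight, iL_mul_iA, map_add, LinearMap.add_apply]
      abel)

lemma rl_one_one_mem : rl 1 1 ∈ centralRL k A L := fun a => by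
  have := rl_mul_iA (1 : Env k A L) 1 a
  simpa using this

/-- The translation map `D ↦ D₊ ⊗ D₋`. -/
def trans : Env k A L →ₗ[k] TensorRL k A L :=
  (centralRL k A L).subtype.comp
    ((LinearMap.applyₗ (R := k) (⟨rl 1 1, rl_one_one_mem⟩ : centralRL k A L)).comp
      (transAct (k := k) (A := A) (L := L)).toLinearMap)

lemma trans_apply (D : Env k A L) :
    trans D = (transAct D (⟨rl 1 1, rl_one_one_mem⟩ : centralRL k A L) : TensorRL k A L) := rfl

lemma trans_one : trans (1 : Env k A L) = rl 1 1 := by simp [trans_apply]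

lemma trans_iA_mul (a : A) (D : Env k A L) :
    trans (iA k A L a * D) = rlLeft (iA k A L a) (trans D) := by
  simp [trans_apply, transAct, transA_coe]

lemma trans_iL_mul (X : L) (D : Env k A L) :
    trans (iL k A L X * D) = rlLeft (iL k A L X) (trans D) - rlRight (iL k A L X) (trans D) := by
  simp [trans_apply, transAct, transL_coe]

/-- This makes D ⊗ E ↦ D₊ ⊗ D₋E balanced over A, and lets a scalar at the right end of D₋ pass to
the left end of D₊. -/
lemma trans_central (D : Env k A L) (a : A) :
    rlRight (iA k A L a) (trans D) = rlLeft (iA k A L a) (trans D) :=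
  ((transAct D (⟨rl 1 1, rl_one_one_mem⟩ : centralRL k A L)).2 a).symm

/-- The inverse of the Hopf-Galois map, `D ⊗ E ↦ D₊ ⊗ D₋E`. -/
def galoisInv : Env k A L ⊗[A] Env k A L →+ TensorRL k A L :=
  TensorProduct.liftAddHom
    (AddMonoidHom.mk' (fun D => AddMonoidHom.mk' (fun E => rlRight E (trans D))
      (fun E E' => by rw [map_add, LinearMap.add_apply]))
      (fun D D' => by ext E; simp))
    (fun a D E => by
      simp only [AddMonoidHom.mk'_apply]
      rw [smul_def, smul_def, trans_iA_mul, rlRight_mul, trans_central])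

@[simp] lemma galoisInv_tmul (D E : Env k A L) :
    galoisInv (D ⊗ₜ[A] E) = rlRight E (trans D) := rfl

lemma galoisInv_smul (a : A) (w : Env k A L ⊗[A] Env k A L) :
    galoisInv (a • w) = rlLeft (iA k A L a) (galoisInv w) := by
  induction w with
  | zero => simp
  | add x y hx hy => simp only [map_add, smul_add, hx, hy]
  | tmul D E =>
    rw [TensorProduct.smul_tmul', galoisInv_tmul, galoisInv_tmul, smul_def, trans_iA_mul,
      rlLeft_rlRight]

lemma galois_rl (D E : Env k A L) : galois (rl D E) = (mulRight E).lTensor _ (cop D) := rfl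

lemma galois_rlLeft_iA (a : A) (z : TensorRL k A L) :
    galois (rlLeft (iA k A L a) z) = a • galois z := by
  induction z using rl_induction with
  | add z w hz hw => simp only [map_add, hz, hw, smul_add]
  | tmul D E => simp [galois_rl, cop_iA_mul]

lemma galois_rlLeft_iL (X : L) (z : TensorRL k A L) :
    galois (rlLeft (iL k A L X) z) = tensorX X (galois z) := by
  induction z using rl_induction with
  | add z w hz hw => simp only [map_add, hz, hw]
  | tmul D E => simp [galois_rl, cop_iL_mul, lTensor_mulRight_tensorX]

lemma galois_rlRight (E : Env k A L) (z : TensorRL k A L) :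
    galois (rlRight E z) = (mulRight E).lTensor _ (galois z) := by
  induction z using rl_induction with
  | add z w hz hw => simp only [map_add, hz, hw]
  | tmul D E' =>
    rw [rlRight_rl, galois_rl, galois_rl, ← LinearMap.lTensor_comp_apply]
    congr 2
    ext x
    simp [mul_assoc]

/-- In the inductive step β(Xz - zX) = (XD ⊗ 1 + D ⊗ X) - D ⊗ X: the term subtracted in the
recursion for `trans` removes the second half of the diagonal action. -/
lemma galois_trans (D : Env k A L) : galois (trans D) = D ⊗ₜ[A] 1 := by
  induction D using induction with
  | one => simp [trans_one, galois_rl, cop_one]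
  | add D E hD hE => rw [map_add, map_add, hD, hE, TensorProduct.add_tmul]
  | mulA a D hD => rw [trans_iA_mul, galois_rlLeft_iA, hD]; rfl
  | mulL X D hD =>
    rw [trans_iL_mul, map_sub, galois_rlLeft_iL, galois_rlRight, hD]
    simp

lemma galois_galoisInv (w : Env k A L ⊗[A] Env k A L) : galois (galoisInv w) = w := by
  induction w with
  | zero => simp
  | add x y hx hy => rw [map_add, map_add, hx, hy]
  | tmul D E => simp [galois_rlRight, galois_trans]

/-- The term -D₊ ⊗ D₋XE contributed by (XD)₊ ⊗ (XD)₋E cancels the contribution of D ⊗ XE. -/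
lemma galoisInv_tensorX (X : L) (w : Env k A L ⊗[A] Env k A L) :
    galoisInv (tensorX X w) = rlLeft (iL k A L X) (galoisInv w) := by
  induction w with
  | zero => simp
  | add x y hx hy => simp only [map_add, hx, hy]
  | tmul D E => simp [trans_iL_mul, rlRight_mul, rlLeft_rlRight]

lemma galoisInv_lTensor (E : Env k A L) (w : Env k A L ⊗[A] Env k A L) :
    galoisInv ((mulRight E).lTensor _ w) = rlRight E (galoisInv w) := by
  induction w with
  | zero => simp
  | add x y hx hy => simp only [map_add, hx, hy]
  | tmul D E => simp [rlRight_mul]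

lemma galoisInv_cop (D : Env k A L) : galoisInv (cop D) = rl D 1 := by
  induction D using induction with
  | one => simp [cop_one, trans_one]
  | add D E hD hE => rw [map_add, map_add, hD, hE, rl_add_left]
  | mulA a D hD => rw [cop_iA_mul, galoisInv_smul, hD, rlLeft_rl]
  | mulL X D hD => rw [cop_iL_mul, galoisInv_tensorX, hD, rlLeft_rl]

lemma galoisInv_galois (z : TensorRL k A L) : galoisInv (galois z) = z := by
  induction z using rl_induction with
  | add z w hz hw => rw [map_add, map_add, hz, hw]
  | tmul D E => rw [galois_rl, galoisInv_lTensor, galoisInv_cop, rlRight_rl, one_mul]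

lemma galois_bijective : Function.Bijective (galois (k := k) (A := A) (L := L)) :=
  Function.bijective_iff_has_inverse.2 ⟨galoisInv, galoisInv_galois, galois_galoisInv⟩

lemma eq_trans_of_galois_eq {z : TensorRL k A L} {D : Env k A L} (h : galois z = D ⊗ₜ[A] 1) :
    z = trans D :=
  galois_bijective.1 (h.trans (galois_trans D).symm)

/-! ### Identities for the translation map -/

/-- The map `D ⊗ E ↦ DE`. -/
def rlMul : TensorRL k A L →ₗ[k] Env k A L :=
  rlLift (LinearMap.mul k _) (fun D E a => by simp [mul_assoc])

@[simp] lemma rlMul_rl (D E : Env k A L) : rlMul (rl D E) = D * E := rfl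

lemma rlMul_rlLeft (D : Env k A L) (z : TensorRL k A L) :
    rlMul (rlLeft D z) = D * rlMul z := by
  induction z using rl_induction with
  | add z w hz hw => simp only [map_add, hz, hw, mul_add]
  | tmul F E => simp [mul_assoc]

lemma rlMul_rlRight (D : Env k A L) (z : TensorRL k A L) :
    rlMul (rlRight D z) = rlMul z * D := by
  induction z using rl_induction with
  | add z w hz hw => simp only [map_add, hz, hw, add_mul]
  | tmul F E => simp [mul_assoc]

/-- `D₊ D₋ = ε(D)` -/
lemma rlMul_trans (D : Env k A L) : rlMul (trans D) = iA k A L (eps D) := by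
  induction D using induction with
  | one => simp [trans_one, eps_one]
  | add D E hD hE => simp only [map_add, hD, hE]
  | mulA a D hD => rw [trans_iA_mul, rlMul_rlLeft, hD, ← smul_def a D, map_smul, smul_eq_mul, map_mul]
  | mulL X D hD =>
    rw [trans_iL_mul, map_sub, rlMul_rlLeft, rlMul_rlRight, hD, eps_iL_mul, iL_mul_iA]
    abel

/-- The map `D ⊗ E ↦ DX ⊗ E - D ⊗ XE`. -/
def rlInner (X : L) : Module.End k (TensorRL k A L) :=
  rlLift (LinearMap.mk₂ k (fun D E => rl (D * iL k A L X) E - rl D (iL k A L X * E))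
      (fun D D' E => by simp only [add_mul, rl_add_left]; abel)
      (fun c D E => by simp [rl_smul_left, smul_sub])
      (fun D E E' => by simp only [mul_add, rl_add_right]; abel)
      (fun c D E => by simp [rl_smul_right, smul_sub]))
    (fun D E a => by
      simp only [LinearMap.mk₂_apply]
      -- Neither summand is balanced on its own. Commuting a with X costs the same term D ⊗ X(a)E in
      -- both, and the difference is balanced.
      rw [mul_assoc, iA_mul_iL, mul_sub, rl_sub_left, ← mul_assoc, rl_mul_iA, rl_mul_iA, rl_mul_iA,
        ← mul_assoc (iL k A L X) (iA k A L a), iL_mul_iA, add_mul, rl_add_right, mul_assoc]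
      abel)

lemma rlInner_rl (X : L) (D E : Env k A L) :
    rlInner X (rl D E) = rl (D * iL k A L X) E - rl D (iL k A L X * E) := rfl

lemma rlInner_rlLeft (X : L) (D : Env k A L) (z : TensorRL k A L) :
    rlInner X (rlLeft D z) = rlLeft D (rlInner X z) := by
  induction z using rl_induction with
  | add z w hz hw => simp only [map_add, hz, hw]
  | tmul F E => simp [rlInner_rl, mul_assoc]

lemma rlInner_rlRight (X : L) (D : Env k A L) (z : TensorRL k A L) :
    rlInner X (rlRight D z) = rlRight D (rlInner X z) := by
  induction z using rl_induction with
  | add z w hz hw => simp only [map_add, hz, hw]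
  | tmul F E => simp [rlInner_rl, mul_assoc]

/-- A case of (DE)₊ ⊗ (DE)₋ = D₊E₊ ⊗ E₋D₋. The recursion for `trans` uses outer multiplications
only, and these commute with the inner operation, so D = 1 decides. -/
lemma trans_mul_iL (D : Env k A L) (X : L) : trans (D * iL k A L X) = rlInner X (trans D) := by
  induction D using induction with
  | one =>
    rw [one_mul, ← mul_one (iL k A L X), trans_iL_mul, trans_one]
    simp [rlInner_rl]
  | add D E hD hE => simp only [add_mul, map_add, hD, hE]
  | mulA a D hD => rw [mul_assoc, trans_iA_mul, hD, trans_iA_mul, rlInner_rlLeft]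
  | mulL Y D hD =>
    rw [mul_assoc, trans_iL_mul, hD, trans_iL_mul, map_sub, rlInner_rlLeft, rlInner_rlRight]

/-- `(Da)₊ ⊗ (Da)₋ = D₊a ⊗ D₋ = D₊ ⊗ aD₋`, for the left action of `A` on the second factor. -/
def rlMid (a : A) : Module.End k (TensorRL k A L) :=
  rlLift ((rlMk k A L).comp (LinearMap.mulRight k (iA k A L a)))
    (fun D E b => by simp [rl_mul_iA, ← map_mul, mul_comm a b, ← mul_assoc])

@[simp] lemma rlMid_rl (a : A) (D E : Env k A L) :
    rlMid a (rl D E) = rl (D * iA k A L a) E := rfl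

lemma rlMid_rlLeft (a : A) (D : Env k A L) (z : TensorRL k A L) :
    rlMid a (rlLeft D z) = rlLeft D (rlMid a z) := by
  induction z using rl_induction with
  | add z w hz hw => simp only [map_add, hz, hw]
  | tmul F E => simp [mul_assoc]

lemma rlMid_rlRight (a : A) (D : Env k A L) (z : TensorRL k A L) :
    rlMid a (rlRight D z) = rlRight D (rlMid a z) := by
  induction z using rl_induction with
  | add z w hz hw => simp only [map_add, hz, hw]
  | tmul F E => simp

lemma trans_mul_iA (D : Env k A L) (a : A) : trans (D * iA k A L a) = rlMid a (trans D) := by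
  induction D using induction with
  | one =>
    rw [one_mul, ← mul_one (iA k A L a), trans_iA_mul, trans_one]
    simp
  | add D E hD hE => simp only [add_mul, map_add, hD, hE]
  | mulA b D hD => rw [mul_assoc, trans_iA_mul, hD, trans_iA_mul, rlMid_rlLeft]
  | mulL Y D hD =>
    rw [mul_assoc, trans_iL_mul, hD, trans_iL_mul, map_sub, rlMid_rlLeft, rlMid_rlRight]

/-- The map `D ⊗ E ↦ D E₊ ⊗ E₋`. -/
def transRight : Module.End k (TensorRL k A L) :=
  rlLift (LinearMap.mk₂ k (fun D E => rlLeft D (trans E))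
      (fun D D' E => by simp) (fun c D E => by simp) (fun D E E' => by simp)
      (fun c D E => by simp))
    (fun D E a => by simp [trans_iA_mul, rlLeft_mul])

lemma transRight_rl (D E : Env k A L) : transRight (rl D E) = rlLeft D (trans E) := rfl

lemma transRight_rlLeft (D : Env k A L) (z : TensorRL k A L) :
    transRight (rlLeft D z) = rlLeft D (transRight z) := by
  induction z using rl_induction with
  | add z w hz hw => simp only [map_add, hz, hw]
  | tmul F E => simp [transRight_rl, rlLeft_mul]

lemma transRight_rlRight (X : L) (z : TensorRL k A L) :
    transRight (rlRight (iL k A L X) z) = rlInner X (transRight z) := by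
  induction z using rl_induction with
  | add z w hz hw => simp only [map_add, hz, hw]
  | tmul F E => simp [transRight_rl, trans_mul_iL, rlInner_rlLeft]

/-- `D₊ D₋₊ ⊗ D₋₋ = 1 ⊗ D` -/
lemma transRight_trans (D : Env k A L) : transRight (trans D) = rl 1 D := by
  induction D using induction with
  | one => simp [trans_one, transRight_rl]
  | add D E hD hE => simp only [map_add, hD, hE, rl_add_right]
  | mulA a D hD =>
    rw [trans_iA_mul, transRight_rlLeft, hD, rlLeft_rl, ← rl_mul_iA, mul_one, one_mul]
  | mulL X D hD =>
    rw [trans_iL_mul, map_sub, transRight_rlLeft, transRight_rlRight, hD, rlInner_rl]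
    simp

end Env

end LieRinehart

/-! ### The Poincaré-Birkhoff-Witt theorem for free modules -/

namespace LieRinehart

namespace PBW

variable {k A L : Type*} [CommRing k] [CommRing A] [Algebra k A] [LieRing L] [LieAlgebra k L]
  [Module A L] [LieRingModule L A] [LieRinehartRing A L] [LieRinehartAlgebra k A L]

lemma lie_one_eq_zero (X : L) : ⁅X, (1 : A)⁆ = 0 := by
  have h := LieRinehartRing.leibniz_mul_right X (1 : A) 1
  rw [mul_one, one_smul, mul_one] at h
  exact left_eq_add.1 h

lemma smul_lie_left (a : A) (X Y : L) : ⁅a • X, Y⁆ = a • ⁅X, Y⁆ - ⁅Y, a⁆ • X := by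
  rw [← lie_skew, LieRinehartRing.leibniz_smul_right, ← lie_skew X Y, smul_neg]
  abel

section coeffLie
variable {S : Type*}

/-- The coefficientwise action of `X ∈ L` on a free `A`-module. -/
def coeffLie (X : L) : (S →₀ A) →+ (S →₀ A) :=
  Finsupp.mapRange.addMonoidHom (AddMonoidHom.mk' (fun a => ⁅X, a⁆) (lie_add X))

@[simp] lemma coeffLie_apply (X : L) (m : S →₀ A) (s : S) : coeffLie X m s = ⁅X, m s⁆ := rfl

lemma coeffLie_smul (X : L) (a : A) (m : S →₀ A) :
    coeffLie X (a • m) = a • coeffLie X m + ⁅X, a⁆ • m := by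
  ext s; simp

lemma coeffLie_single_one (X : L) (s : S) : coeffLie X (Finsupp.single s (1 : A)) = 0 := by
  classical
  ext t
  rw [coeffLie_apply, Finsupp.single_apply]
  split_ifs <;> simp [lie_one_eq_zero]

lemma coeffLie_add_left (X Y : L) (m : S →₀ A) :
    coeffLie (X + Y) m = coeffLie X m + coeffLie Y m := by
  ext s; simp

lemma coeffLie_smul_left (a : A) (X : L) (m : S →₀ A) :
    coeffLie (a • X) m = a • coeffLie X m := by
  ext s; simp

lemma coeffLie_lie (X Y : L) (m : S →₀ A) :
    coeffLie ⁅X, Y⁆ m = coeffLie X (coeffLie Y m) - coeffLie Y (coeffLie X m) := by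
  ext s; simp

end coeffLie

variable {ι : Type*}

/-- The monomial with a given multiset of factors. -/
def mono (A : Type*) [CommRing A] (J : Multiset ι) : Multiset ι →₀ A := Finsupp.single J 1

variable (A ι) in
/-- The linear combinations of monomials of degree at most `n`. -/
def degM (n : ℕ) : Submodule A (Multiset ι →₀ A) := Finsupp.supported A A {J | J.card ≤ n}

lemma mono_mem_degM {J : Multiset ι} {n : ℕ} (h : J.card ≤ n) : mono A J ∈ degM A ι n :=
  Finsupp.single_mem_supported A 1 h

lemma degM_mono {m n : ℕ} (h : m ≤ n) : degM A ι m ≤ degM A ι n :=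
  Finsupp.supported_mono fun _ (hJ : _ ≤ _) => hJ.trans h

lemma degM_induction {n : ℕ} {P : (m : Multiset ι →₀ A) → m ∈ degM A ι n → Prop}
    (mono : ∀ (J : Multiset ι) (hJ : J.card ≤ n), P (mono A J) (mono_mem_degM hJ))
    (zero : P 0 (zero_mem _))
    (add : ∀ x y hx hy, P x hx → P y hy → P (x + y) (add_mem hx hy))
    (smul : ∀ (a : A) x hx, P x hx → P (a • x) (Submodule.smul_mem _ a hx))
    {m : Multiset ι →₀ A} (hm : m ∈ degM A ι n) : P m hm := by
  suffices h : ∃ h, P m h from h.2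
  rw [degM, Finsupp.supported_eq_span_single] at hm
  induction hm using Submodule.span_induction with
  | mem x hx =>
    obtain ⟨J, hJ, rfl⟩ := hx
    exact ⟨_, mono J hJ⟩
  | zero => exact ⟨_, zero⟩
  | add x y _ _ hx hy => exact ⟨_, add x y _ _ hx.2 hy.2⟩
  | smul a x _ hx => exact ⟨_, smul a x _ hx.2⟩

lemma basis_induction (b : Module.Basis ι A L) {P : L → Prop} (zero : P 0)
    (add : ∀ X Y, P X → P Y → P (X + Y)) (smul : ∀ (a : A) X, P X → P (a • X))
    (basis : ∀ i, P (b i)) (X : L) : P X := by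
  induction b.mem_span X using Submodule.span_induction with
  | mem X hX =>
    obtain ⟨i, rfl⟩ := hX
    exact basis i
  | zero => exact zero
  | add X Y _ _ hX hY => exact add X Y hX hY
  | smul a X _ hX => exact smul a X hX

lemma exists_mem_degM (m : Multiset ι →₀ A) : ∃ n, m ∈ degM A ι n :=
  ⟨m.support.sup Multiset.card, fun _ hJ => Finset.le_sup (f := Multiset.card) hJ⟩

lemma coeffLie_mem_degM (X : L) {n : ℕ} {m : Multiset ι →₀ A} (hm : m ∈ degM A ι n) :
    coeffLie X m ∈ degM A ι n := by
  induction hm using degM_induction with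
  | mono J hJ => simp [mono, coeffLie_single_one]
  | zero => simp
  | add x y _ _ hx hy => rw [map_add]; exact add_mem hx hy
  | smul a x hx ih =>
    rw [coeffLie_smul]
    exact add_mem (Submodule.smul_mem _ _ ih) (Submodule.smul_mem _ _ hx)

/-! ### The recursive construction of the action of L on monomials. -/

variable [LinearOrder ι]

/-- `J = j + K` and `j` is a least element of `J`. -/
def IsHead (J : Multiset ι) (j : ι) (K : Multiset ι) : Prop := J = j ::ₘ K ∧ ∀ l ∈ K, j ≤ l

/-- Uniqueness makes the `choose` in `step` harmless: it returns the expected j and K. -/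
lemma IsHead.unique {J K K' : Multiset ι} {j j' : ι} (h : IsHead J j K) (h' : IsHead J j' K') :
    j = j' ∧ K = K' := by
  obtain ⟨rfl, h⟩ := h
  obtain ⟨e, h'⟩ := h'
  have hj : j = j' := by
    rcases Multiset.cons_eq_cons.1 e with ⟨rfl, -⟩ | ⟨-, cs, h1, h2⟩
    · rfl
    · exact le_antisymm (h j' (by simp [h1])) (h' j (by simp [h2]))
  subst hj
  exact ⟨rfl, (Multiset.cons_inj_right j).1 e⟩

lemma exists_isHead {J : Multiset ι} (hJ : J ≠ 0) : ∃ j K, IsHead J j K := by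
  have hne : J.toFinset.Nonempty := Multiset.toFinset_nonempty.2 hJ
  have hm : J.toFinset.min' hne ∈ J := Multiset.mem_toFinset.1 (Finset.min'_mem _ _)
  refine ⟨_, J.erase _, (Multiset.cons_erase hm).symm, fun l hl => ?_⟩
  exact Finset.min'_le _ _ (Multiset.mem_toFinset.2 (Multiset.mem_of_mem_erase hl))

variable (b : Module.Basis ι A L)

/-- The bilinear map `L × A[y] → A[y]` with given values on basis vectors and monomials. -/
def bilin (f : ι → Multiset ι → Multiset ι →₀ A) :
    L →ₗ[A] (Multiset ι →₀ A) →ₗ[A] (Multiset ι →₀ A) :=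
  b.constr A fun i => Finsupp.linearCombination A (f i)

@[simp] lemma bilin_mono (f : ι → Multiset ι → Multiset ι →₀ A) (i : ι) (J : Multiset ι) :
    bilin b f (b i) (mono A J) = f i J := by
  simp [bilin, mono]

open Classical in
/-- The recursion step: the value of the `A`-linear part of the action of the `i`-th basis vector
on the monomial `J`, in terms of the `A`-linear part `β` of the action in lower degree. -/
def step (β : L →ₗ[A] (Multiset ι →₀ A) →ₗ[A] (Multiset ι →₀ A)) (i : ι) (J : Multiset ι) :
    Multiset ι →₀ A :=
  if h : ∃ p : ι × Multiset ι, IsHead J p.1 p.2 ∧ p.1 < i then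
    -- A flat action must satisfy b_i y_J = b_j(b_i y_K) + [b_i, b_j] y_K. Since j is least, b_j(y_i
    -- y_K) is the monomial y_i y_J, and what remains is the action of b_j, the sum of `coeffLie`
    -- and β, on the correction b_i y_K - y_i y_K.
    mono A (i ::ₘ J) +
      (coeffLie (b h.choose.1) (β (b i) (mono A h.choose.2) - mono A (i ::ₘ h.choose.2)) +
        β (b h.choose.1) (β (b i) (mono A h.choose.2) - mono A (i ::ₘ h.choose.2))) +
      β ⁅b i, b h.choose.1⁆ (mono A h.choose.2)
  else mono A (i ::ₘ J)

variable {b} in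
lemma step_of_isHead (β : L →ₗ[A] (Multiset ι →₀ A) →ₗ[A] (Multiset ι →₀ A)) {i j : ι}
    {J K : Multiset ι} (h : IsHead J j K) (hj : j < i) :
    step b β i J = mono A (i ::ₘ J) +
      (coeffLie (b j) (β (b i) (mono A K) - mono A (i ::ₘ K)) +
        β (b j) (β (b i) (mono A K) - mono A (i ::ₘ K))) + β ⁅b i, b j⁆ (mono A K) := by
  have hex : ∃ p : ι × Multiset ι, IsHead J p.1 p.2 ∧ p.1 < i := ⟨(j, K), h, hj⟩
  obtain ⟨h1, h2⟩ := hex.choose_spec.1.unique h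
  rw [step, dif_pos hex, h1, h2]

variable {b} in
lemma step_of_le (β : L →ₗ[A] (Multiset ι →₀ A) →ₗ[A] (Multiset ι →₀ A)) {i : ι}
    {J : Multiset ι} (h : ∀ j ∈ J, i ≤ j) : step b β i J = mono A (i ::ₘ J) := by
  rw [step, dif_neg]
  rintro ⟨⟨j, K⟩, ⟨rfl, -⟩, hj⟩
  exact absurd (h j (by simp)) (not_le.2 hj)

lemma le_or_isHead (i : ι) (J : Multiset ι) :
    (∀ j ∈ J, i ≤ j) ∨ ∃ j K, IsHead J j K ∧ j < i := by
  rcases eq_or_ne J 0 with rfl | hJ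
  · simp
  · obtain ⟨j, K, h⟩ := exists_isHead hJ
    rcases lt_or_ge j i with hj | hj
    · exact Or.inr ⟨j, K, h, hj⟩
    · left
      obtain ⟨rfl, h⟩ := h
      intro l hl
      rcases Multiset.mem_cons.1 hl with rfl | hl
      · exact hj
      · exact hj.trans (h l hl)

/-- The approximations of the `A`-linear part of the action: the `n`-th one is correct in degree at
most `n`. -/
def approx : ℕ → L →ₗ[A] (Multiset ι →₀ A) →ₗ[A] (Multiset ι →₀ A)
  | 0 => bilin b fun i J => mono A (i ::ₘ J)
  | n + 1 => bilin b (step b (approx n))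

/-- `β` is multiplication by basis vectors up to terms of lower degree. -/
def HasSymbol (β : L →ₗ[A] (Multiset ι →₀ A) →ₗ[A] (Multiset ι →₀ A)) : Prop :=
  ∀ i J, β (b i) (mono A J) - mono A (i ::ₘ J) ∈ degM A ι J.card

variable {b} in
lemma HasSymbol.mem_degM {β : L →ₗ[A] (Multiset ι →₀ A) →ₗ[A] (Multiset ι →₀ A)}
    (h : HasSymbol b β) (X : L) {n : ℕ} {m : Multiset ι →₀ A} (hm : m ∈ degM A ι n) :
    β X m ∈ degM A ι (n + 1) := by
  induction hm using degM_induction with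
  | mono J hJ =>
    induction X using basis_induction b with
    | zero => simp
    | add X Y hX hY => rw [map_add]; exact add_mem hX hY
    | smul a X hX => rw [map_smul]; exact Submodule.smul_mem _ _ hX
    | basis i =>
      rw [← sub_add_cancel (β (b i) (mono A J)) (mono A (i ::ₘ J))]
      exact add_mem (degM_mono (by omega) (h i J)) (mono_mem_degM (by simpa using hJ))
  | zero => simp
  | add x y _ _ hx hy => rw [map_add]; exact add_mem hx hy
  | smul a x _ hx => rw [map_smul]; exact Submodule.smul_mem _ _ hx

/-- In the recursive case |J| = |K| + 1. The correction b_i y_K - y_i y_K has degree at most |K|, so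
b_j applied to it and [b_i, b_j] applied to y_K both stay in degree at most |J|. -/
lemma hasSymbol_approx (n : ℕ) : HasSymbol b (approx b n) := by
  induction n with
  | zero => intro i J; simp [approx]
  | succ n ih =>
    intro i J
    rw [approx, bilin_mono]
    rcases le_or_isHead i J with h | ⟨j, K, h, hj⟩
    · rw [step_of_le _ h, sub_self]; exact zero_mem _
    · rw [step_of_isHead _ h hj, add_assoc, add_sub_cancel_left]
      have hc : J.card = K.card + 1 := by rw [h.1, Multiset.card_cons]
      rw [hc]
      exact add_mem (add_mem (degM_mono (Nat.le_succ _) (coeffLie_mem_degM _ (ih i K)))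
        (ih.mem_degM _ (ih i K))) (ih.mem_degM _ (mono_mem_degM le_rfl))

lemma bilin_ext_degM {β β' : L →ₗ[A] (Multiset ι →₀ A) →ₗ[A] (Multiset ι →₀ A)} {n : ℕ}
    (h : ∀ i J, J.card ≤ n → β (b i) (mono A J) = β' (b i) (mono A J)) (X : L)
    {m : Multiset ι →₀ A} (hm : m ∈ degM A ι n) : β X m = β' X m := by
  induction hm using degM_induction with
  | mono J hJ =>
    induction X using basis_induction b with
    | zero => simp
    | add X Y hX hY => simp only [map_add, LinearMap.add_apply, hX, hY]
    | smul a X hX => simp only [map_smul, LinearMap.smul_apply, hX]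
    | basis i => exact h i J hJ
  | zero => simp
  | add x y _ _ hx hy => rw [map_add, map_add, hx, hy]
  | smul a x _ hx => rw [map_smul, map_smul, hx]

/-- At J, `step` reads β only on y_K and on the correction b_i y_K - y_i y_K. Both have degree at
most |K| = |J| - 1, the second by the symbol condition. -/
lemma step_congr {β β' : L →ₗ[A] (Multiset ι →₀ A) →ₗ[A] (Multiset ι →₀ A)}
    (hs : HasSymbol b β) {n : ℕ} (h : ∀ X, ∀ m ∈ degM A ι n, β X m = β' X m) (i : ι)
    {J : Multiset ι} (hJ : J.card ≤ n + 1) : step b β i J = step b β' i J := by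
  rcases le_or_isHead i J with hi | ⟨j, K, hK, hj⟩
  · rw [step_of_le _ hi, step_of_le _ hi]
  · have hc : K.card ≤ n := by rw [hK.1, Multiset.card_cons] at hJ; omega
    rw [step_of_isHead _ hK hj, step_of_isHead _ hK hj, ← h _ _ (mono_mem_degM hc),
      ← h _ _ (mono_mem_degM hc), ← h _ _ (degM_mono hc (hs i K))]

lemma approx_succ (n : ℕ) (X : L) (m : Multiset ι →₀ A) (hm : m ∈ degM A ι n) :
    approx b n X m = approx b (n + 1) X m := by
  induction n generalizing X m with
  | zero =>
    refine bilin_ext_degM b (fun i J hJ => ?_) X hm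
    obtain rfl : J = 0 := Multiset.card_eq_zero.1 (Nat.le_zero.1 hJ)
    rw [approx, bilin_mono, approx, bilin_mono, step_of_le _ (by simp)]
  | succ n ih =>
    refine bilin_ext_degM b (fun i J hJ => ?_) X hm
    rw [approx, bilin_mono, approx, bilin_mono]
    exact step_congr b (hasSymbol_approx b n) ih i hJ

lemma approx_of_le {n n' : ℕ} (h : n ≤ n') (X : L) (m : Multiset ι →₀ A) (hm : m ∈ degM A ι n) :
    approx b n X m = approx b n' X m := by
  induction n', h using Nat.le_induction with
  | base => rfl
  | succ n' hn ih => rw [ih, approx_succ b n' X m (degM_mono hn hm)]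

/-- The `A`-linear part of the action of `L`. -/
def linPart : L →ₗ[A] (Multiset ι →₀ A) →ₗ[A] (Multiset ι →₀ A) :=
  bilin b fun i J => approx b J.card (b i) (mono A J)

lemma linPart_eq {n : ℕ} (X : L) {m : Multiset ι →₀ A} (hm : m ∈ degM A ι n) :
    linPart b X m = approx b n X m :=
  bilin_ext_degM b (fun i J hJ => by
    rw [linPart, bilin_mono]
    exact approx_of_le b hJ _ _ (mono_mem_degM le_rfl)) X hm

lemma hasSymbol_linPart : HasSymbol b (linPart b) := fun i J => by
  rw [linPart_eq b (b i) (mono_mem_degM le_rfl)]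
  exact hasSymbol_approx b _ i J

/-- The approximations stabilize in each degree, so their limit is a fixed point of the recursion.
-/
lemma linPart_mono (i : ι) (J : Multiset ι) :
    linPart b (b i) (mono A J) = step b (linPart b) i J := by
  rw [linPart_eq b (b i) (mono_mem_degM (Nat.le_succ J.card)), approx, bilin_mono]
  exact (step_congr b (hasSymbol_linPart b) (fun X m hm => linPart_eq b X hm) i
    (Nat.le_succ _)).symm

/-- The action of `X ∈ L` on the free module on the monomials. -/
def rho (X : L) (m : Multiset ι →₀ A) : Multiset ι →₀ A := coeffLie X m + linPart b X m

lemma rho_add (X : L) (m m' : Multiset ι →₀ A) : rho b X (m + m') = rho b X m + rho b X m' := by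
  simp only [rho, map_add]; abel

lemma rho_sub (X : L) (m m' : Multiset ι →₀ A) : rho b X (m - m') = rho b X m - rho b X m' := by
  simp only [rho, map_sub]; abel

lemma rho_zero (X : L) : rho b X 0 = 0 := by simp [rho]

lemma rho_smul (X : L) (a : A) (m : Multiset ι →₀ A) :
    rho b X (a • m) = a • rho b X m + ⁅X, a⁆ • m := by
  simp only [rho, map_smul, coeffLie_smul, smul_add]; abel

lemma rho_add_left (X Y : L) (m : Multiset ι →₀ A) :
    rho b (X + Y) m = rho b X m + rho b Y m := by
  simp only [rho, coeffLie_add_left, map_add, LinearMap.add_apply]; abel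

lemma rho_smul_left (a : A) (X : L) (m : Multiset ι →₀ A) :
    rho b (a • X) m = a • rho b X m := by
  simp only [rho, coeffLie_smul_left, map_smul, LinearMap.smul_apply, smul_add]

lemma rho_sub_left (X Y : L) (m : Multiset ι →₀ A) :
    rho b (X - Y) m = rho b X m - rho b Y m := by
  rw [eq_sub_iff_add_eq, ← rho_add_left, sub_add_cancel]

lemma rho_mono (X : L) (J : Multiset ι) : rho b X (mono A J) = linPart b X (mono A J) := by
  rw [rho, mono, coeffLie_single_one, zero_add]

lemma rho_mem_degM (X : L) {n : ℕ} {m : Multiset ι →₀ A} (hm : m ∈ degM A ι n) :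
    rho b X m ∈ degM A ι (n + 1) :=
  add_mem (degM_mono (Nat.le_succ n) (coeffLie_mem_degM X hm))
    ((hasSymbol_linPart b).mem_degM X hm)

variable {b} in
lemma rho_mono_of_le {i : ι} {J : Multiset ι} (h : ∀ j ∈ J, i ≤ j) :
    rho b (b i) (mono A J) = mono A (i ::ₘ J) := by
  rw [rho_mono, linPart_mono, step_of_le _ h]

lemma rho_mono_sub_mem (i : ι) (J : Multiset ι) :
    rho b (b i) (mono A J) - mono A (i ::ₘ J) ∈ degM A ι J.card := by
  rw [rho_mono]
  exact hasSymbol_linPart b i J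

variable {b} in
-- The recursion is made for this identity. The index j is least in y_i y_K too, so y_i y_J =
-- ρ_j(y_i y_K), which together with ρ_j of the correction gives ρ_j ρ_i y_K.
lemma rho_mono_of_isHead {i j : ι} {J K : Multiset ι} (h : IsHead J j K) (hj : j < i) :
    rho b (b i) (mono A J) = rho b (b j) (rho b (b i) (mono A K)) + rho b ⁅b i, b j⁆ (mono A K) := by
  have h1 : rho b (b j) (mono A (i ::ₘ K)) = mono A (i ::ₘ J) := by
    rw [rho_mono_of_le, h.1, Multiset.cons_swap]
    intro l hl
    rcases Multiset.mem_cons.1 hl with rfl | hl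
    · exact hj.le
    · exact h.2 l hl
  rw [rho_mono, linPart_mono, step_of_isHead _ h hj, ← rho_mono, ← rho_mono, ← h1]
  change _ + rho b (b j) _ + _ = _
  rw [rho_sub]
  abel

/-! ### Flatness of the action. -/

/-- The curvature of the action vanishes at `m`. -/
def Flat (m : Multiset ι →₀ A) : Prop :=
  ∀ X Y : L, rho b X (rho b Y m) - rho b Y (rho b X m) = rho b ⁅X, Y⁆ m

variable {b}

lemma Flat.add {m m' : Multiset ι →₀ A} (h : Flat b m) (h' : Flat b m') : Flat b (m + m') :=
  fun X Y => by
    simp only [rho_add]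
    rw [← h X Y, ← h' X Y]
    abel

/-- The curvature is A-linear: the mixed Leibniz terms cancel and the remaining [X, Y](a)m is the
one produced by ρ_[X, Y]. Monomials therefore suffice. -/
lemma Flat.smul {m : Multiset ι →₀ A} (h : Flat b m) (a : A) : Flat b (a • m) :=
  fun X Y => by
    simp only [rho_smul, rho_add]
    rw [← h X Y, lie_lie, smul_sub, sub_smul]
    abel

lemma flat_zero : Flat b (0 : Multiset ι →₀ A) := fun X Y => by simp [rho_zero]

lemma flat_of_mem_degM {n : ℕ} (h : ∀ J : Multiset ι, J.card ≤ n → Flat b (mono A J))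
    {m : Multiset ι →₀ A} (hm : m ∈ degM A ι n) : Flat b m :=
  degM_induction (P := fun m _ => Flat b m) h flat_zero (fun _ _ _ _ hx hy => hx.add hy)
    (fun a _ _ hx => hx.smul a) hm

/-- The curvature is antisymmetric and A-linear in X and Y. -/
lemma flat_of_basis {m : Multiset ι →₀ A}
    (h : ∀ i j, j < i → rho b (b i) (rho b (b j) m) - rho b (b j) (rho b (b i) m) =
      rho b ⁅b i, b j⁆ m) : Flat b m := by
  have h0 : ∀ m, rho b (0 : L) m = 0 := fun m => by simpa using rho_sub_left b (0 : L) 0 m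
  have h' : ∀ i j, rho b (b i) (rho b (b j) m) - rho b (b j) (rho b (b i) m) =
      rho b ⁅b i, b j⁆ m := fun i j => by
    rcases lt_trichotomy i j with hij | rfl | hij
    · rw [← neg_inj, neg_sub, h j i hij, ← lie_skew, ← zero_sub, rho_sub_left, h0, zero_sub]
    · rw [lie_self, h0, sub_self]
    · exact h i j hij
  intro X Y
  induction X using basis_induction b with
  | zero => simp [h0, rho_zero]
  | add X X' hX hX' =>
    rw [add_lie, rho_add_left, rho_add_left, rho_add_left, rho_add, ← hX, ← hX']; abel
  | smul a X hX =>
    rw [smul_lie_left, rho_sub_left, rho_smul_left, rho_smul_left, rho_smul_left, rho_smul_left,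
      rho_smul, ← hX, smul_sub]; abel
  | basis i =>
    induction Y using basis_induction b with
    | zero => simp [h0, rho_zero]
    | add X X' hX hX' =>
      rw [lie_add, rho_add_left, rho_add_left, rho_add_left, rho_add, ← hX, ← hX']; abel
    | smul a X hX =>
      rw [LieRinehartRing.leibniz_smul_right, rho_add_left, rho_smul_left, rho_smul_left,
        rho_smul_left, rho_smul_left, rho_smul, ← hX, smul_sub]; abel
    | basis j => exact h' i j

/-- Here ρ_j y_J is the monomial y_j y_J with head j, and the recursion for ρ_i on it is the
assertion. -/
lemma flat_of_lt {J : Multiset ι} {i j : ι} (hj : j < i) (hle : ∀ l ∈ J, j ≤ l) :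
    rho b (b i) (rho b (b j) (mono A J)) - rho b (b j) (rho b (b i) (mono A J)) =
      rho b ⁅b i, b j⁆ (mono A J) := by
  rw [rho_mono_of_le hle, rho_mono_of_isHead ⟨rfl, hle⟩ hj]
  abel

/-- Induction on the degree. Outside the case of `flat_of_lt`, J has a head l < j < i. Writing y_J =
ρ_l y_K and moving ρ_l to the left in ρ_i ρ_j ρ_l y_K and ρ_j ρ_i ρ_l y_K leaves double brackets,
which the Jacobi identity balances. -/
lemma flat_mono (J : Multiset ι) : Flat b (mono A J) := by
  induction hn : J.card using Nat.strong_induction_on generalizing J with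
  | _ n ih =>
  have ih' : ∀ J : Multiset ι, J.card < n → Flat b (mono A J) := fun J hJ => ih _ hJ J rfl
  refine flat_of_basis fun i j hij => ?_
  rcases le_or_isHead j J with hle | ⟨l, K, hK, hl⟩
  · exact flat_of_lt hij hle
  · have hc : K.card < n := by rw [← hn, hK.1, Multiset.card_cons]; omega
    -- Flatness for b_i and b_l is needed at ρ_j y_K, whose degree n is out of reach of the
    -- induction. Its leading monomial y_j y_K has all factors at least l, so `flat_of_lt` applies
    -- to it, and the rest has degree at most |K| < n.
    have key : ∀ i j : ι, l < i → l < j →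
        rho b (b i) (rho b (b l) (rho b (b j) (mono A K))) =
          rho b (b l) (rho b (b i) (rho b (b j) (mono A K))) +
            rho b ⁅b i, b l⁆ (rho b (b j) (mono A K)) := fun i j hi hj => by
      rw [← sub_eq_iff_eq_add']
      rw [← sub_add_cancel (rho b (b j) (mono A K)) (mono A (j ::ₘ K))]
      have h1 := flat_of_mem_degM (b := b) (n := K.card) (fun J hJ => ih' J (hJ.trans_lt hc))
        (rho_mono_sub_mem b j K) (b i) (b l)
      have h2 := flat_of_lt (b := b) (J := j ::ₘ K) hi
        (fun x hx => by
          rcases Multiset.mem_cons.1 hx with rfl | hx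
          · exact hj.le
          · exact hK.2 x hx)
      simp only [rho_add]
      rw [← h1, ← h2]
      abel
    have fK := ih' K hc
    have hJ : mono A J = rho b (b l) (mono A K) := by rw [rho_mono_of_le hK.2, ← hK.1]
    have e1 : rho b (b i) (rho b (b j) (mono A J)) =
        rho b (b l) (rho b (b i) (rho b (b j) (mono A K))) +
          rho b ⁅b i, b l⁆ (rho b (b j) (mono A K)) +
          (rho b ⁅b j, b l⁆ (rho b (b i) (mono A K)) + rho b ⁅b i, ⁅b j, b l⁆⁆ (mono A K)) := by
      rw [rho_mono_of_isHead hK hl, rho_add, key i j (hl.trans hij) hl, ← fK (b i) ⁅b j, b l⁆]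
      abel
    have e2 : rho b (b j) (rho b (b i) (mono A J)) =
        rho b (b l) (rho b (b j) (rho b (b i) (mono A K))) +
          rho b ⁅b j, b l⁆ (rho b (b i) (mono A K)) +
          (rho b ⁅b i, b l⁆ (rho b (b j) (mono A K)) + rho b ⁅b j, ⁅b i, b l⁆⁆ (mono A K)) := by
      rw [rho_mono_of_isHead hK (hl.trans hij), rho_add, key j i hl (hl.trans hij),
        ← fK (b j) ⁅b i, b l⁆]
      abel
    have e3 : rho b ⁅b i, b j⁆ (mono A J) =
        rho b (b l) (rho b (b i) (rho b (b j) (mono A K))) -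
          rho b (b l) (rho b (b j) (rho b (b i) (mono A K))) +
        (rho b ⁅b i, ⁅b j, b l⁆⁆ (mono A K) - rho b ⁅b j, ⁅b i, b l⁆⁆ (mono A K)) := by
      -- The Jacobi identity enters here, as [b_i, [b_j, b_l]] - [b_j, [b_i, b_l]] = [[b_i, b_j],
      -- b_l].
      rw [hJ, ← rho_sub_left, ← lie_lie, ← fK ⁅b i, b j⁆ (b l), ← rho_sub, fK (b i) (b j)]
      abel
    rw [e1, e2, e3]
    abel

lemma flat (m : Multiset ι →₀ A) : Flat b m :=
  flat_of_mem_degM (fun J _ => flat_mono J) (exists_mem_degM m).choose_spec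

/-! ### Coordinates on VL with respect to ordered monomials. -/

open Env

variable (k b) in
/-- The action of `VL` on the free module on the monomials. -/
def envAct : Env k A L →ₐ[k] Module.End k (Multiset ι →₀ A) :=
  lift (W := Module.End k (Multiset ι →₀ A)) (Algebra.lsmul k k _)
    (LinearMap.mk₂ k (rho b) (rho_add_left b)
      (fun c X m => by rw [← algebraMap_smul A c X, rho_smul_left, algebraMap_smul])
      (rho_add b)
      (fun c X m => by
        have h : ⁅X, algebraMap k A c⁆ = 0 := (LieRinehartAlgebra.anchor k A L X).map_algebraMap c
        rw [← algebraMap_smul A c m, rho_smul, h, zero_smul, add_zero, algebraMap_smul]))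
    (fun X Y => LinearMap.ext fun m => (flat m X Y).symm)
    (fun a X => LinearMap.ext fun m => rho_smul_left b a X m)
    (fun X a => LinearMap.ext fun m => by
      change rho b X (a • m) - a • rho b X m = ⁅X, a⁆ • m
      rw [rho_smul]; abel)

lemma envAct_iA (a : A) (m : Multiset ι →₀ A) : envAct k b (iA k A L a) m = a • m := by
  simp [envAct]

lemma envAct_iL (X : L) (m : Multiset ι →₀ A) : envAct k b (iL k A L X) m = rho b X m := by
  simp [envAct]

variable (k b) in
/-- The coordinates of an element of `VL` with respect to the ordered monomials. -/
def coords : Env k A L →ₗ[A] Multiset ι →₀ A where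
  toFun D := envAct k b D (mono A 0)
  map_add' D E := by simp
  map_smul' a D := by simp [smul_def, envAct_iA]

lemma coords_one : coords k b 1 = mono A 0 := by simp [coords]

lemma coords_iL_mul (X : L) (D : Env k A L) : coords k b (iL k A L X * D) = rho b X (coords k b D) := by
  simp [coords, envAct_iL]

variable (k b) in
/-- The ordered monomial in `VL`. -/
def ordMono (J : Multiset ι) : Env k A L := ((J.sort (· ≤ ·)).map fun i => iL k A L (b i)).prod

lemma ordMono_cons {i : ι} {J : Multiset ι} (h : ∀ j ∈ J, i ≤ j) :
    ordMono k b (i ::ₘ J) = iL k A L (b i) * ordMono k b J := by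
  rw [ordMono, Multiset.sort_cons _ _ _ h, List.map_cons, List.prod_cons, ordMono]

lemma ordMono_mem_degLE (J : Multiset ι) : ordMono k b J ∈ degLE k A L J.card :=
  Submodule.subset_span ⟨(J.sort (· ≤ ·)).map b, by simp, by simp [ordMono, Function.comp_def]⟩

variable (k b) in
/-- The `A`-linear map sending monomials to ordered monomials. -/
def ofCoords : (Multiset ι →₀ A) →ₗ[A] Env k A L := Finsupp.linearCombination A (ordMono k b)

lemma ofCoords_mono (J : Multiset ι) : ofCoords k b (mono A J) = ordMono k b J := by
  simp [ofCoords, mono]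

lemma ofCoords_rho_of_mem {n : ℕ}
    (h : ∀ (i : ι) (J : Multiset ι), J.card ≤ n →
      ofCoords k b (rho b (b i) (mono A J)) = iL k A L (b i) * ordMono k b J) (X : L)
    {m : Multiset ι →₀ A} (hm : m ∈ degM A ι n) :
    ofCoords k b (rho b X m) = iL k A L X * ofCoords k b m := by
  induction hm using degM_induction with
  | mono J hJ =>
    rw [ofCoords_mono]
    induction X using basis_induction b with
    | zero => rw [rho_mono]; simp
    | add X Y hX hY => rw [rho_add_left, map_add, hX, hY, map_add, add_mul]
    | smul a X hX => rw [rho_smul_left, map_smul, hX, iL_smul, smul_def, mul_assoc]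
    | basis i => exact h i J hJ
  | zero => simp [rho_zero]
  | add x y _ _ hx hy => rw [rho_add, map_add, hx, hy, map_add, mul_add]
  | smul a x _ hx => rw [rho_smul, map_add, map_smul, map_smul, map_smul, hx, iL_mul_smul]

/-- Ordered monomials obey the recursion of `rho_mono_of_isHead`, because b_i b_j = b_j b_i + [b_i,
b_j] in VL. -/
lemma ofCoords_rho_mono (i : ι) (J : Multiset ι) :
    ofCoords k b (rho b (b i) (mono A J)) = iL k A L (b i) * ordMono k b J := by
  induction hn : J.card using Nat.strong_induction_on generalizing i J with
  | _ n ih =>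
  rcases le_or_isHead i J with hle | ⟨j, K, hK, hj⟩
  · rw [rho_mono_of_le hle, ofCoords_mono, ordMono_cons hle]
  · have hc : K.card < n := by rw [← hn, hK.1, Multiset.card_cons]; omega
    have ihK : ∀ (X : L) (m : Multiset ι →₀ A), m ∈ degM A ι K.card →
        ofCoords k b (rho b X m) = iL k A L X * ofCoords k b m := fun X m hm =>
      ofCoords_rho_of_mem (fun i J hJ => ih _ (hJ.trans_lt hc) i J rfl) X hm
    have hle : ∀ l ∈ i ::ₘ K, j ≤ l := fun l hl => by
      rcases Multiset.mem_cons.1 hl with rfl | hl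
      · exact hj.le
      · exact hK.2 l hl
    -- The degree of ρ_i y_K may be |K| + 1, beyond the induction hypothesis. Its leading monomial
    -- y_i y_K is treated directly: j is below all its factors, so multiplying by b_j gives an
    -- ordered monomial again.
    have h1 : ofCoords k b (rho b (b j) (rho b (b i) (mono A K))) =
        iL k A L (b j) * ofCoords k b (rho b (b i) (mono A K)) := by
      rw [← sub_add_cancel (rho b (b i) (mono A K)) (mono A (i ::ₘ K)), rho_add, map_add,
        ihK _ _ (rho_mono_sub_mem b i K), rho_mono_of_le hle, ofCoords_mono, ordMono_cons hle,
        map_add, mul_add, ofCoords_mono]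
    rw [rho_mono_of_isHead hK hj, map_add, h1, ihK _ _ (mono_mem_degM le_rfl),
      ihK _ _ (mono_mem_degM le_rfl), ofCoords_mono, iL_lie, hK.1, ordMono_cons hK.2, ← mul_assoc,
      ← mul_assoc, sub_mul]
    abel

lemma ofCoords_rho (X : L) (m : Multiset ι →₀ A) :
    ofCoords k b (rho b X m) = iL k A L X * ofCoords k b m :=
  ofCoords_rho_of_mem (fun i J _ => ofCoords_rho_mono i J) X (exists_mem_degM m).choose_spec

/-- Every element of `VL` is the linear combination of ordered monomials given by its
coordinates. -/
lemma ofCoords_coords (D : Env k A L) : ofCoords k b (coords k b D) = D := by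
  induction D using Env.induction with
  | one => rw [coords_one, ofCoords_mono]; simp [ordMono]
  | add D E hD hE => rw [map_add, map_add, hD, hE]
  | mulA a D hD => rw [← smul_def, map_smul, map_smul, hD]
  | mulL X D hD => rw [coords_iL_mul, ofCoords_rho, hD]

end PBW

end LieRinehart

/-! ### Dual bases of the modules of operators of bounded degree -/

namespace LieRinehart

variable {k A L : Type*} [CommRing k] [CommRing A] [Algebra k A] [LieRing L] [LieAlgebra k L]
  [Module A L] [LieRingModule L A] [LieRinehartRing A L] [LieRinehartAlgebra k A L]

namespace Env

/-- The predicate depends on the degree bound, so it can express that a construction raises degrees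
by at most one for each left factor X. -/
lemma degLE_induction {P : ℕ → Env k A L → Prop} (one : ∀ p, P p 1) (zero : ∀ p, P p 0)
    (add : ∀ p D E, P p D → P p E → P p (D + E)) (smul : ∀ p (a : A) D, P p D → P p (a • D))
    (mono : ∀ p D, P p D → P (p + 1) D)
    (mulL : ∀ p X D, D ∈ degLE k A L p → P p D → P (p + 1) (iL k A L X * D))
    {p : ℕ} {D : Env k A L} (hD : D ∈ degLE k A L p) : P p D := by
  have mono' : ∀ p q D, p ≤ q → P p D → P q D := fun p q D h hp => by
    induction q, h using Nat.le_induction with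
    | base => exact hp
    | succ q _ ih => exact mono q D ih
  induction hD using Submodule.span_induction with
  | mem D hD =>
    obtain ⟨l, hl, rfl⟩ := hD
    refine mono' l.length p _ hl ?_
    clear hl
    induction l with
    | nil => exact one _
    | cons X l ih => exact mulL _ X _ (Submodule.subset_span ⟨l, le_rfl, rfl⟩) ih
  | zero => exact zero p
  | add D E _ _ hD hE => exact add p D E hD hE
  | smul a D _ hD => exact smul p a D hD

/-- If G generates degree at most p and g generates L, then G and the products of g with G generate
degree at most p + 1: the Leibniz terms from moving coefficients past X stay in the span of G. -/
lemma degLE_fg [Module.Finite A L] (p : ℕ) : (degLE k A L p).FG := by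
  classical
  obtain ⟨g, hg⟩ := (Module.Finite.fg_top : (⊤ : Submodule A L).FG)
  induction p with
  | zero =>
    refine ⟨{1}, ?_⟩
    rw [degLE]
    congr 1
    ext D
    simp
  | succ p ih =>
    obtain ⟨G, hG⟩ := ih
    refine ⟨G ∪ Finset.image₂ (fun X D => iL k A L X * D) g G, le_antisymm ?_ ?_⟩
    · rw [Submodule.span_le, Finset.coe_union, Set.union_subset_iff]
      refine ⟨fun D hD => degLE_mono (Nat.le_succ p) (hG ▸ Submodule.subset_span hD), ?_⟩
      rw [Finset.coe_image₂]
      rintro _ ⟨X, -, D, hD, rfl⟩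
      exact iL_mul_mem_degLE X (hG ▸ Submodule.subset_span hD)
    · set N := Submodule.span A
        (↑(G ∪ Finset.image₂ (fun X D => iL k A L X * D) g G) : Set (Env k A L)) with hN
      have h1 : degLE k A L p ≤ N := by
        rw [← hG]
        exact Submodule.span_mono (by simp)
      have h2 : ∀ X, ∀ D ∈ degLE k A L p, iL k A L X * D ∈ N := by
        intro X D hD
        have hX : X ∈ Submodule.span A (g : Set L) := by rw [hg]; trivial
        induction hX using Submodule.span_induction with
        | mem X hX =>
          rw [← hG] at hD
          induction hD using Submodule.span_induction with
          | mem D hD =>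
            refine Submodule.subset_span ?_
            rw [Finset.coe_union, Finset.coe_image₂]
            exact Or.inr ⟨X, hX, D, hD, rfl⟩
          | zero => simp
          | add D E _ _ hD hE => rw [mul_add]; exact add_mem hD hE
          | smul a D h hD =>
            rw [iL_mul_smul]
            exact add_mem (Submodule.smul_mem _ _ hD) (Submodule.smul_mem _ _ (h1 (hG ▸ h)))
        | zero => simp
        | add X Y _ _ hX hY => rw [map_add, add_mul]; exact add_mem hX hY
        | smul a X _ hX =>
          rw [iL_smul, mul_assoc, ← smul_def]
          exact Submodule.smul_mem _ _ hX
      rw [degLE, Submodule.span_le]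
      rintro _ ⟨l, hl, rfl⟩
      rcases l with _ | ⟨X, l⟩
      · exact h1 (one_mem_degLE p)
      · exact h2 X _ (Submodule.subset_span ⟨l, by simpa using hl, rfl⟩)

/-! ### Functoriality of the enveloping algebra. -/

section map
variable {L' : Type*} [LieRing L'] [LieAlgebra k L'] [Module A L'] [LieRingModule L' A]
  [LieRinehartRing A L'] [LieRinehartAlgebra k A L'] (φ : L →ₗ[A] L')
  (hlie : ∀ X Y, φ ⁅X, Y⁆ = ⁅φ X, φ Y⁆) (hanchor : ∀ X (a : A), ⁅φ X, a⁆ = ⁅X, a⁆)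

variable (k) in
/-- The functoriality of the enveloping algebra. -/
def map : Env k A L →ₐ[k] Env k A L' :=
  lift (iA k A L') ((iL k A L').comp (φ.restrictScalars k))
    (fun X Y => by simp [hlie, iL_lie]) (fun a X => by simp [iL_smul])
    (fun X a => by simp [iL_mul_iA, hanchor])

lemma map_iA (a : A) : map k φ hlie hanchor (iA k A L a) = iA k A L' a :=
  lift_iA _ _ _ _ _ a

lemma map_iL (X : L) : map k φ hlie hanchor (iL k A L X) = iL k A L' (φ X) :=
  lift_iL _ _ _ _ _ X

variable (k) in
/-- The functoriality of the enveloping algebra, as an `A`-linear map. -/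
def mapₗ : Env k A L →ₗ[A] Env k A L' where
  toFun := map k φ hlie hanchor
  map_add' := map_add _
  map_smul' a D := by simp [smul_def, map_iA]

lemma mapₗ_apply (D : Env k A L) : mapₗ k φ hlie hanchor D = map k φ hlie hanchor D := rfl

lemma map_mem_degLE {p : ℕ} {D : Env k A L} (hD : D ∈ degLE k A L p) :
    map k φ hlie hanchor D ∈ degLE k A L' p := by
  induction hD using Submodule.span_induction with
  | mem D hD =>
    obtain ⟨l, hl, rfl⟩ := hD
    refine Submodule.subset_span ⟨l.map φ, by simpa using hl, ?_⟩
    rw [map_list_prod, List.map_map, List.map_map]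
    congr 2
    ext X
    exact map_iL φ hlie hanchor X
  | zero => simp
  | add D E _ _ hD hE => rw [map_add]; exact add_mem hD hE
  | smul a D _ hD =>
    rw [← mapₗ_apply, map_smul]
    exact Submodule.smul_mem _ _ hD

end map

end Env

namespace PBW

open Env

variable {ι : Type*} [LinearOrder ι] {b : Module.Basis ι A L}

lemma coords_mem_degM {p : ℕ} {D : Env k A L} (hD : D ∈ degLE k A L p) :
    coords k b D ∈ degM A ι p := by
  refine degLE_induction (P := fun p D => coords k b D ∈ degM A ι p) (fun p => ?_) (fun p => ?_)
    (fun p D E hD hE => ?_) (fun p a D hD => ?_) (fun p D hD => degM_mono (Nat.le_succ p) hD)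
    (fun p X D _ hD => ?_) hD
  · rw [coords_one]; exact mono_mem_degM (by simp)
  · simp
  · rw [map_add]; exact add_mem hD hE
  · rw [map_smul]; exact Submodule.smul_mem _ _ hD
  · rw [coords_iL_mul]; exact rho_mem_degM b X hD

end PBW

/-! ### Embedding a projective Lie-Rinehart algebra into a free one -/

/-- The semidirect product of `L` with a free module with the trivial flat connection. -/
def FreeExt (A L S : Type*) [CommRing A] : Type _ := L × (S →₀ A)

namespace FreeExt

open PBW

variable {S : Type*}

instance : AddCommGroup (FreeExt A L S) := inferInstanceAs (AddCommGroup (L × (S →₀ A)))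
instance : Module A (FreeExt A L S) := inferInstanceAs (Module A (L × (S →₀ A)))
instance : Module k (FreeExt A L S) := inferInstanceAs (Module k (L × (S →₀ A)))
instance : IsScalarTower k A (FreeExt A L S) :=
  inferInstanceAs (IsScalarTower k A (L × (S →₀ A)))

lemma ext' {x y : FreeExt A L S} (h1 : x.1 = y.1) (h2 : x.2 = y.2) : x = y := Prod.ext h1 h2

instance : Bracket (FreeExt A L S) (FreeExt A L S) :=
  ⟨fun x y => (⁅x.1, y.1⁆, coeffLie x.1 y.2 - coeffLie y.1 x.2)⟩

lemma lie_fst (x y : FreeExt A L S) : (⁅x, y⁆ : FreeExt A L S).1 = ⁅x.1, y.1⁆ := rfl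
lemma lie_snd (x y : FreeExt A L S) :
    (⁅x, y⁆ : FreeExt A L S).2 = coeffLie x.1 y.2 - coeffLie y.1 x.2 := rfl
lemma add_fst (x y : FreeExt A L S) : (x + y).1 = x.1 + y.1 := rfl
lemma add_snd (x y : FreeExt A L S) : (x + y).2 = x.2 + y.2 := rfl
lemma smul_fst (a : A) (x : FreeExt A L S) : (a • x).1 = a • x.1 := rfl
lemma smul_snd (a : A) (x : FreeExt A L S) : (a • x).2 = a • x.2 := rfl

/-- The Jacobi identity in the second component is the flatness `coeffLie_lie` of the
coefficientwise action. -/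
instance : LieRing (FreeExt A L S) where
  add_lie x y z := ext' (add_lie _ _ _) (by
    simp only [lie_snd, add_snd, add_fst, coeffLie_add_left, map_add]; abel)
  lie_add x y z := ext' (lie_add _ _ _) (by
    simp only [lie_snd, add_snd, add_fst, coeffLie_add_left, map_add]; abel)
  lie_self x := ext' (lie_self _) (sub_self _)
  leibniz_lie x y z := ext' (leibniz_lie _ _ _) (by
    simp only [lie_snd, add_snd, lie_fst, coeffLie_lie, map_sub]; abel)

instance : LieAlgebra k (FreeExt A L S) where
  lie_smul c x y := by
    rw [← algebraMap_smul A c y, ← algebraMap_smul A c ⁅x, y⁆]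
    have h : ⁅x.1, algebraMap k A c⁆ = 0 :=
      (LieRinehartAlgebra.anchor k A L x.1).map_algebraMap c
    refine ext' ?_ ?_
    · rw [lie_fst, smul_fst, smul_fst, lie_fst, LieRinehartRing.leibniz_smul_right, h, zero_smul,
        add_zero]
    · rw [lie_snd, smul_fst, smul_snd, smul_snd, lie_snd, coeffLie_smul, h, zero_smul, add_zero,
        coeffLie_smul_left, smul_sub]

instance : LieRingModule (FreeExt A L S) A where
  bracket x a := ⁅x.1, a⁆
  add_lie _ _ _ := add_lie _ _ _
  lie_add _ _ _ := lie_add _ _ _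
  leibniz_lie _ _ _ := leibniz_lie _ _ _

lemma lie_apply (x : FreeExt A L S) (a : A) : ⁅x, a⁆ = ⁅x.1, a⁆ := rfl

instance : LieRinehartRing A (FreeExt A L S) where
  lie_smul_eq_mul' a b x := LieRinehartRing.lie_smul_eq_mul a b x.1
  leibniz_mul_right' x a b := LieRinehartRing.leibniz_mul_right x.1 a b
  leibniz_smul_right' x y a := ext' (LieRinehartRing.leibniz_smul_right x.1 y.1 a) (by
    simp only [lie_snd, add_snd, smul_snd, smul_fst, lie_apply, coeffLie_smul, coeffLie_smul_left,
      smul_sub]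
    abel)

instance : LieRinehartAlgebra k A (FreeExt A L S) where
  smul_lie c x a := smul_lie c x.1 a
  lie_smul c x a := lie_smul c x.1 a

/-! ### The Eilenberg swindle. -/

section swindle
variable {R P G : Type*} [Ring R] [AddCommGroup P] [Module R P] [AddCommGroup G] [Module R G]
  (i : P →ₗ[R] G) (r : G →ₗ[R] P)

/-- The map from `P ⊕ (P ⊕ Q) ⊕ (P ⊕ Q) ⊕ ⋯` to `(P ⊕ Q) ⊕ (P ⊕ Q) ⊕ ⋯` shifting the copies of
`P`, for a direct summand `P` of a module `G`. -/
def shiftRight : (P × (ℕ →₀ G)) →ₗ[R] (ℕ →₀ G) :=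
  LinearMap.coprod ((Finsupp.lsingle 0).comp i)
    (Finsupp.mapRange.linearMap (LinearMap.id - i.comp r) +
      (Finsupp.lmapDomain G R Nat.succ).comp (Finsupp.mapRange.linearMap (i.comp r)))

lemma shiftRight_zero (x : P × (ℕ →₀ G)) :
    shiftRight i r x 0 = i x.1 + (x.2 0 - i (r (x.2 0))) := by
  simp only [shiftRight, LinearMap.coprod_apply, LinearMap.comp_apply, LinearMap.add_apply,
    Finsupp.add_apply, Finsupp.lsingle_apply, Finsupp.single_eq_same, Finsupp.lmapDomain_apply]
  rw [Finsupp.mapDomain_of_notMem_range _ _ (by simp), add_zero]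
  rfl

lemma shiftRight_succ (x : P × (ℕ →₀ G)) (j : ℕ) :
    shiftRight i r x (j + 1) = i (r (x.2 j)) + (x.2 (j + 1) - i (r (x.2 (j + 1)))) := by
  simp only [shiftRight, LinearMap.coprod_apply, LinearMap.comp_apply, LinearMap.add_apply,
    Finsupp.add_apply, Finsupp.lsingle_apply, Finsupp.lmapDomain_apply]
  rw [← Nat.succ_eq_add_one, Finsupp.mapDomain_apply Nat.succ_injective,
    Finsupp.single_eq_of_ne (by simp), zero_add, add_comm]
  rfl

/-- The inverse of `shiftRight`. -/
def shiftLeft : (ℕ →₀ G) →ₗ[R] (P × (ℕ →₀ G)) :=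
  LinearMap.prod (r.comp (Finsupp.lapply 0))
    (Finsupp.mapRange.linearMap (LinearMap.id - i.comp r) +
      (Finsupp.mapRange.linearMap (i.comp r)).comp
        (Finsupp.lcomapDomain Nat.succ Nat.succ_injective))

lemma shiftLeft_fst (g : ℕ →₀ G) : (shiftLeft i r g).1 = r (g 0) := rfl

lemma shiftLeft_snd (g : ℕ →₀ G) (j : ℕ) :
    (shiftLeft i r g).2 j = g j - i (r (g j)) + i (r (g (j + 1))) := rfl

/-- The Eilenberg swindle. -/
def swindle (h : ∀ x, r (i x) = x) : (P × (ℕ →₀ G)) ≃ₗ[R] (ℕ →₀ G) :=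
  { shiftRight i r with
    invFun := shiftLeft i r
    left_inv := fun x => by
      change shiftLeft i r (shiftRight i r x) = x
      refine Prod.ext ?_ (Finsupp.ext fun j => ?_)
      · simp [shiftLeft_fst, shiftRight_zero, h]
      · rw [shiftLeft_snd]
        rcases j with _ | j
        · rw [shiftRight_zero, shiftRight_succ]; simp [h]
        · rw [shiftRight_succ, shiftRight_succ]; simp [h]
    right_inv := fun g => by
      change shiftRight i r (shiftLeft i r g) = g
      refine Finsupp.ext fun j => ?_
      rcases j with _ | j
      · rw [shiftRight_zero, shiftLeft_fst, shiftLeft_snd]; simp [h]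
      · rw [shiftRight_succ, shiftLeft_snd, shiftLeft_snd]; simp [h] }

end swindle

/-- As L is a direct summand of Aⁿ, the swindle absorbs it into a direct sum of countably many
copies of Aⁿ; this dictates the index set ℕ × Fin n. -/
lemma exists_basis [Module.Finite A L] [Module.Projective A L] :
    ∃ n : ℕ, Nonempty (Module.Basis (ℕ × Fin n) A (FreeExt A L (ℕ × Fin n))) := by
  obtain ⟨n, r, i, -, -, h⟩ := Module.Finite.exists_comp_eq_id_of_projective A L
  refine ⟨n, ⟨⟨?_⟩⟩⟩
  let e : (Fin n →₀ A) ≃ₗ[A] (Fin n → A) := Finsupp.linearEquivFunOnFinite A A (Fin n)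
  let e' : ((ℕ × Fin n) →₀ A) ≃ₗ[A] (ℕ →₀ Fin n →₀ A) := Finsupp.curryLinearEquiv A
  have hs := swindle (e.symm.toLinearMap.comp i) (r.comp e.toLinearMap)
    (fun x => by simpa using LinearMap.congr_fun h x)
  exact ((LinearEquiv.refl A L).prodCongr e').trans (hs.trans e'.symm)

/-- The inclusion of `L`. -/
def inl : L →ₗ[A] FreeExt A L S := LinearMap.inl A L (S →₀ A)

/-- The projection to `L`. -/
def fst : FreeExt A L S →ₗ[A] L := LinearMap.fst A L (S →₀ A)

lemma inl_lie (X Y : L) :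
    (inl (A := A) ⁅X, Y⁆ : FreeExt A L S) = ⁅inl (A := A) (S := S) X, inl (A := A) (S := S) Y⁆ :=
  ext' rfl (by
    rw [lie_snd]
    change 0 = coeffLie X (0 : S →₀ A) - coeffLie Y 0
    rw [map_zero, map_zero, sub_zero])

lemma inl_anchor (X : L) (a : A) : ⁅(inl X : FreeExt A L S), a⁆ = ⁅X, a⁆ := rfl

lemma fst_lie (x y : FreeExt A L S) : fst ⁅x, y⁆ = ⁅fst x, fst y⁆ := rfl

lemma fst_anchor (x : FreeExt A L S) (a : A) : ⁅fst x, a⁆ = ⁅x, a⁆ := rfl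

lemma fst_inl (X : L) : fst (inl X : FreeExt A L S) = X := rfl

lemma map_fst_map_inl (D : Env k A L) :
    Env.map k fst fst_lie fst_anchor (Env.map k (inl (S := S)) inl_lie inl_anchor D) = D := by
  have : (Env.map k (fst (L := L) (A := A) (S := S)) fst_lie fst_anchor).comp
      (Env.map k inl inl_lie inl_anchor) = AlgHom.id k (Env k A L) :=
    Env.hom_ext (fun a => by rw [AlgHom.comp_apply, Env.map_iA, Env.map_iA, AlgHom.id_apply])
      (fun X => by rw [AlgHom.comp_apply, Env.map_iL, Env.map_iL, AlgHom.id_apply, fst_inl])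
  exact AlgHom.congr_fun this D

end FreeExt

open Env PBW in
/-- The module `VL_{≤ p}` has a finite dual basis consisting of restrictions of infinite jets. -/
theorem exists_dualBasis [Module.Finite A L] [Module.Projective A L] (p : ℕ) :
    ∃ (σ : Type) (T : Finset σ) (d : σ → Env k A L) (f : σ → Jet k A L),
      (∀ i ∈ T, d i ∈ degLE k A L p) ∧
        ∀ D ∈ degLE k A L p, D = ∑ i ∈ T, (f i).ev D • d i := by
  classical
  obtain ⟨n, ⟨b⟩⟩ := FreeExt.exists_basis (A := A) (L := L)
  -- Any linear order serves to define ordered monomials.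
  let _ : LinearOrder (ℕ × Fin n) := IsWellOrder.linearOrder WellOrderingRel
  let incl : Env k A L →ₗ[A] Env k A (FreeExt A L (ℕ × Fin n)) :=
    mapₗ k FreeExt.inl FreeExt.inl_lie FreeExt.inl_anchor
  let retr : Env k A (FreeExt A L (ℕ × Fin n)) →ₗ[A] Env k A L :=
    mapₗ k FreeExt.fst FreeExt.fst_lie FreeExt.fst_anchor
  have hretr : ∀ D, retr (incl D) = D := FreeExt.map_fst_map_inl
  let c : Env k A L →ₗ[A] Multiset (ℕ × Fin n) →₀ A := (coords k b).comp incl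
  obtain ⟨G, hG⟩ := degLE_fg (k := k) (A := A) (L := L) p
  have hGp : ∀ g ∈ G, g ∈ degLE k A L p := fun g hg => hG ▸ Submodule.subset_span hg
  have hc : ∀ D ∈ degLE k A L p, c D ∈ degM A _ p := fun D hD =>
    coords_mem_degM (map_mem_degLE _ _ _ hD)
  -- The basis of the extension may be infinite, so a degree bound alone does not leave finitely
  -- many monomials. Those in the coordinates of a finite generating set suffice.
  refine ⟨Multiset (ℕ × Fin n), G.biUnion fun g => (c g).support, fun J => retr (ordMono k b J),
    fun J => (Jet.equivConv k A L).symm (WithConv.toConv ((Finsupp.lapply J).comp c)), ?_, ?_⟩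
  · intro J hJ
    obtain ⟨g, hg, hJ⟩ := Finset.mem_biUnion.1 hJ
    -- Taking coordinates does not raise the degree, so the monomials that occur have degree at most
    -- p and retract into degree at most p.
    have hJp : J.card ≤ p := hc g (hGp g hg) hJ
    exact map_mem_degLE _ _ _ (degLE_mono hJp (ordMono_mem_degLE J))
  · intro D hD
    have hsupp : c D ∈ Finsupp.supported A A
        (↑(G.biUnion fun g => (c g).support) : Set (Multiset (ℕ × Fin n))) := by
      rw [← hG] at hD
      induction hD using Submodule.span_induction with
      | mem g hg => exact Finset.coe_subset.2 (Finset.subset_biUnion_of_mem (fun g => (c g).support) hg)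
      | zero => simp
      | add x y _ _ hx hy => rw [map_add]; exact add_mem hx hy
      | smul a x _ hx => rw [map_smul]; exact Submodule.smul_mem _ _ hx
    conv_lhs => rw [← hretr D, ← ofCoords_coords (b := b) (incl D)]
    change retr (Finsupp.linearCombination A (ordMono k b) (c D)) = _
    rw [Finsupp.linearCombination_apply, Finsupp.sum_of_support_subset _ (Finset.coe_subset.1 hsupp)
      _ (by simp), map_sum]
    exact Finset.sum_congr rfl fun J _ => map_smul _ _ _

end LieRinehart

/-! ### Infinite jets and their tensor products -/

namespace LieRinehart

variable {k A L : Type*} [CommRing k] [CommRing A] [Algebra k A] [LieRing L] [LieAlgebra k L]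
  [Module A L] [LieRingModule L A] [LieRinehartRing A L] [LieRinehartAlgebra k A L]

/-! ### Degrees in products and coproducts of VL. -/

namespace Env

lemma mul_mem_degLE {p q : ℕ} {D E : Env k A L} (hD : D ∈ degLE k A L p)
    (hE : E ∈ degLE k A L q) : D * E ∈ degLE k A L (p + q) := by
  refine degLE_induction (P := fun p D => D * E ∈ degLE k A L (p + q)) (fun p => ?_) (fun p => ?_)
    (fun p D D' hD hD' => ?_) (fun p a D hD => ?_) (fun p D hD => degLE_mono (by omega) hD)
    (fun p X D _ hD => ?_) hD
  · rw [one_mul]; exact degLE_mono (by omega) hE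
  · simp
  · rw [add_mul]; exact add_mem hD hD'
  · rw [smul_mul]; exact Submodule.smul_mem _ _ hD
  · rw [mul_assoc, add_right_comm]; exact iL_mul_mem_degLE X hD

lemma iA_mem_degLE (a : A) (p : ℕ) : iA k A L a ∈ degLE k A L p := by
  rw [← mul_one (iA k A L a), ← smul_def]
  exact Submodule.smul_mem _ _ (one_mem_degLE p)

lemma mul_iA_mem_degLE {p : ℕ} {D : Env k A L} (hD : D ∈ degLE k A L p) (a : A) :
    D * iA k A L a ∈ degLE k A L p := by
  have h := mul_mem_degLE hD (iA_mem_degLE a 0)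
  rwa [add_zero] at h

variable (k A L) in
/-- The tensors of total degree at most `p`. -/
def tensorLE (p : ℕ) : Submodule A (Env k A L ⊗[A] Env k A L) :=
  Submodule.span A {w | ∃ (i j : ℕ) (D E : Env k A L), i + j ≤ p ∧ D ∈ degLE k A L i ∧
    E ∈ degLE k A L j ∧ w = D ⊗ₜ[A] E}

lemma tensorLE_mono {p q : ℕ} (h : p ≤ q) : tensorLE k A L p ≤ tensorLE k A L q := by
  refine Submodule.span_mono ?_
  rintro _ ⟨i, j, D, E, hij, hD, hE, rfl⟩
  exact ⟨i, j, D, E, hij.trans h, hD, hE, rfl⟩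

lemma tensorX_mem_tensorLE (X : L) {p : ℕ} {w : Env k A L ⊗[A] Env k A L}
    (hw : w ∈ tensorLE k A L p) : tensorX X w ∈ tensorLE k A L (p + 1) := by
  induction hw using Submodule.span_induction with
  | mem w hw =>
    obtain ⟨i, j, D, E, hij, hD, hE, rfl⟩ := hw
    rw [tensorX_tmul]
    exact add_mem
      (Submodule.subset_span ⟨i + 1, j, _, _, by omega, iL_mul_mem_degLE X hD, hE, rfl⟩)
      (Submodule.subset_span ⟨i, j + 1, _, _, by omega, hD, iL_mul_mem_degLE X hE, rfl⟩)
  | zero => simp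
  | add x y _ _ hx hy => rw [map_add]; exact add_mem hx hy
  | smul a x h hx =>
    rw [tensorX_smul]
    exact add_mem (Submodule.smul_mem _ _ hx)
      (Submodule.smul_mem _ _ (tensorLE_mono (Nat.le_succ p) h))

lemma cop_mem_tensorLE {p : ℕ} {D : Env k A L} (hD : D ∈ degLE k A L p) :
    cop D ∈ tensorLE k A L p := by
  refine degLE_induction (P := fun p D => cop D ∈ tensorLE k A L p) (fun p => ?_) (fun p => ?_)
    (fun p D D' hD hD' => ?_) (fun p a D hD => ?_)
    (fun p D hD => tensorLE_mono (Nat.le_succ p) hD) (fun p X D _ hD => ?_) hD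
  · rw [cop_one]
    exact Submodule.subset_span ⟨0, 0, 1, 1, by omega, one_mem_degLE 0, one_mem_degLE 0, rfl⟩
  · simp
  · rw [map_add]; exact add_mem hD hD'
  · rw [map_smul]; exact Submodule.smul_mem _ _ hD
  · rw [cop_iL_mul]; exact tensorX_mem_tensorLE X hD

/-- Weaker than `cop_mem_tensorLE`, but a bound on each factor is all that is needed to use
representatives of coproducts at a finite level. -/
lemma cop_eq_sum {p : ℕ} {D : Env k A L} (hD : D ∈ degLE k A L p) :
    ∃ (n : ℕ) (x y : Fin n → Env k A L), (∀ i, x i ∈ degLE k A L p) ∧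
      (∀ i, y i ∈ degLE k A L p) ∧ cop D = ∑ i, x i ⊗ₜ[A] y i := by
  have h := cop_mem_tensorLE hD
  generalize cop D = w at h
  induction h using Submodule.span_induction with
  | mem w hw =>
    obtain ⟨i, j, D, E, hij, hD, hE, rfl⟩ := hw
    exact ⟨1, fun _ => D, fun _ => E, fun _ => degLE_mono (by omega) hD,
      fun _ => degLE_mono (by omega) hE, by simp⟩
  | zero => exact ⟨0, Fin.elim0, Fin.elim0, fun i => i.elim0, fun i => i.elim0, by simp⟩
  | add u v _ _ hu hv =>
    obtain ⟨m, x, y, hx, hy, rfl⟩ := hu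
    obtain ⟨n, x', y', hx', hy', rfl⟩ := hv
    refine ⟨m + n, Fin.append x x', Fin.append y y', fun i => ?_, fun i => ?_, ?_⟩
    · refine Fin.addCases (fun i => ?_) (fun i => ?_) i
      · rw [Fin.append_left]; exact hx i
      · rw [Fin.append_right]; exact hx' i
    · refine Fin.addCases (fun i => ?_) (fun i => ?_) i
      · rw [Fin.append_left]; exact hy i
      · rw [Fin.append_right]; exact hy' i
    · rw [Fin.sum_univ_add]
      simp
  | smul a u _ hu =>
    obtain ⟨m, x, y, hx, hy, rfl⟩ := hu
    refine ⟨m, fun i => a • x i, y, fun i => Submodule.smul_mem _ _ (hx i), hy, ?_⟩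
    rw [Finset.smul_sum]
    rfl

lemma map_mulRight_tensorX (E E' : Env k A L) (X : L) (z : Env k A L ⊗[A] Env k A L) :
    TensorProduct.map (mulRight E) (mulRight E') (tensorX X z) =
      tensorX X (TensorProduct.map (mulRight E) (mulRight E') z) := by
  induction z with
  | zero => simp
  | add x y hx hy => simp only [map_add, hx, hy]
  | tmul D D' => simp [mul_assoc]

/-- Factorwise right multiplication of an arbitrary tensor by x ⊗ y is not balanced in x and y,
hence the fixed decomposition of Δ(E). The induction on D uses left multiplications only, and these
commute with the right ones. -/
lemma cop_mul {n : ℕ} {x y : Fin n → Env k A L} {E : Env k A L}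
    (h : cop E = ∑ i, x i ⊗ₜ[A] y i) (D : Env k A L) :
    cop (D * E) = ∑ i, TensorProduct.map (mulRight (x i)) (mulRight (y i)) (cop D) := by
  induction D using induction with
  | one => simp [cop_one, h]
  | add D D' hD hD' => simp only [add_mul, map_add, hD, hD', Finset.sum_add_distrib]
  | mulA a D hD => simp only [mul_assoc, cop_iA_mul, hD, map_smul, Finset.smul_sum]
  | mulL X D hD => simp only [mul_assoc, cop_iL_mul, hD, map_sum, map_mulRight_tensorX]

lemma cop_mul_iA_mul (D : Env k A L) (a b : A) : cop (D * iA k A L (a * b)) =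
    TensorProduct.map (mulRight (iA k A L a)) (mulRight (iA k A L b)) (cop D) := by
  have h : cop (iA k A L (a * b)) = ∑ _i : Fin 1, iA k A L a ⊗ₜ[A] iA k A L b := by
    rw [cop_iA, mul_comm, map_mul, ← smul_def, TensorProduct.smul_tmul, smul_def, mul_one]
    simp
  rw [cop_mul h]
  simp

end Env

/-- `D` has degree less than `n`. -/
def DegLT (n : ℕ) (D : Env k A L) : Prop := ∃ m < n, D ∈ Env.degLE k A L m

lemma DegLT.mono {m n : ℕ} (h : m ≤ n) {D : Env k A L} (hD : DegLT m D) : DegLT n D :=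
  hD.imp fun _ hp => ⟨hp.1.trans_le h, hp.2⟩

lemma DegLT.mul_iA {n : ℕ} {D : Env k A L} (hD : DegLT n D) (a : A) :
    DegLT n (D * Env.iA k A L a) :=
  hD.imp fun _ hp => ⟨hp.1, Env.mul_iA_mem_degLE hp.2 a⟩

lemma DegLT.mul {m n : ℕ} {D E : Env k A L} (hD : DegLT m D) (hE : DegLT n E) :
    DegLT (m + n) (D * E) := by
  obtain ⟨p, hp, hD⟩ := hD
  obtain ⟨q, hq, hE⟩ := hE
  exact ⟨p + q, by omega, Env.mul_mem_degLE hD hE⟩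

lemma degLT_one (n : ℕ) : DegLT (n + 1) (1 : Env k A L) :=
  ⟨0, by omega, Env.one_mem_degLE 0⟩

lemma exists_degLT (D : Env k A L) : ∃ n, DegLT n D :=
  (Env.exists_mem_degLE D).imp' (· + 1) fun p hp => ⟨p, Nat.lt_succ_self p, hp⟩

namespace Jet

open Env

/-- The infinite jet given by an `A`-linear map on `VL`. -/
def ofDual (f : Env k A L →ₗ[A] A) : Jet k A L := (equivConv k A L).symm (WithConv.toConv f)

@[simp] lemma ev_ofDual (f : Env k A L →ₗ[A] A) (D : Env k A L) : (ofDual f).ev D = f D := rfl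

lemma ev_map_add (φ : Jet k A L) (D E : Env k A L) : φ.ev (D + E) = φ.ev D + φ.ev E :=
  map_add φ.toDual D E

lemma ev_map_smul (φ : Jet k A L) (a : A) (D : Env k A L) : φ.ev (a • D) = a * φ.ev D :=
  map_smul φ.toDual a D

lemma ev_map_sum (φ : Jet k A L) {σ : Type*} (T : Finset σ) (D : σ → Env k A L) :
    φ.ev (∑ i ∈ T, D i) = ∑ i ∈ T, φ.ev (D i) :=
  map_sum φ.toDual D T

/-- The value at `D` is `k`-linear in the jet. -/
def evₗ (D : Env k A L) : Jet k A L →ₗ[k] A where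
  toFun φ := φ.ev D
  map_add' φ ψ := ev_add φ ψ D
  map_smul' c φ := ev_smul c φ D

@[simp] lemma evₗ_apply (D : Env k A L) (φ : Jet k A L) : evₗ D φ = φ.ev D := rfl

lemma ev_sum {σ : Type*} (T : Finset σ) (φ : σ → Jet k A L) (D : Env k A L) :
    (∑ i ∈ T, φ i).ev D = ∑ i ∈ T, (φ i).ev D :=
  map_sum (evₗ D) φ T

lemma ev_sub (φ ψ : Jet k A L) (D : Env k A L) : (φ - ψ).ev D = φ.ev D - ψ.ev D :=
  map_sub (evₗ D) φ ψ

lemma ev_mul_eq_sum {n : ℕ} {x y : Fin n → Env k A L} {D : Env k A L}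
    (h : cop D = ∑ i, x i ⊗ₜ[A] y i) (φ ψ : Jet k A L) :
    (φ * ψ).ev D = ∑ i, φ.ev (x i) * ψ.ev (y i) := by
  rw [ev_mul, h]
  simp

lemma ev_mul_one (φ ψ : Jet k A L) : (φ * ψ).ev 1 = φ.ev 1 * ψ.ev 1 := by
  rw [ev_mul, cop_one]
  simp

/-- The working form of the filtration. The inequality is strict: no element has degree less than 0,
so F₀ is everything. -/
lemma mem_jetFil {n : ℕ} {φ : Jet k A L} :
    φ ∈ (jetFil k A L).part n ↔ ∀ D, DegLT n D → φ.ev D = 0 := by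
  constructor
  · rintro h D ⟨m, hm, hD⟩
    rw [ev_eq _ hD, h m hm, LinearMap.zero_apply]
  · intro h m hm
    ext ⟨D, hD⟩
    rw [← ev_eq _ hD, h D ⟨m, hm, hD⟩, LinearMap.zero_apply]

lemma jetFil_zero : (jetFil k A L).part 0 = ⊤ :=
  eq_top_iff.2 fun _ _ => mem_jetFil.2 (by rintro D ⟨m, hm, -⟩; omega)

/-- Δ respects the total degree, so for D of degree less than p + q every term of Δ(D) has its first
factor in degree less than p or its second in degree less than q. -/
lemma jetFil_mul_mem {p q : ℕ} {φ ψ : Jet k A L} (hφ : φ ∈ (jetFil k A L).part p)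
    (hψ : ψ ∈ (jetFil k A L).part q) : φ * ψ ∈ (jetFil k A L).part (p + q) := by
  rw [mem_jetFil] at hφ hψ ⊢
  rintro D ⟨m, hm, hD⟩
  rw [ev_mul]
  have h := cop_mem_tensorLE hD
  generalize cop D = w at h
  induction h using Submodule.span_induction with
  | mem w hw =>
    obtain ⟨i, j, D, E, hij, hD, hE, rfl⟩ := hw
    rw [TensorProduct.map_tmul, LinearMap.mul'_apply, toDual_apply, toDual_apply]
    rcases lt_or_ge i p with hi | hi
    · rw [hφ D ⟨i, hi, hD⟩, zero_mul]
    · rw [hψ E ⟨j, by omega, hE⟩, mul_zero]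
  | zero => simp
  | add x y _ _ hx hy => rw [map_add, map_add, hx, hy, add_zero]
  | smul a x _ hx => rw [map_smul, map_smul, hx, smul_zero]

lemma jetFil_complete : Function.Bijective (jetFil k A L).of := by
  constructor
  · intro φ ψ h
    refine ev_ext fun D => ?_
    obtain ⟨n, hn⟩ := exists_degLT D
    have h1 : ((jetFil k A L).part n).mkQ φ = ((jetFil k A L).part n).mkQ ψ :=
      congrFun (congrArg Subtype.val h) n
    have h2 := mem_jetFil.1 ((Submodule.Quotient.eq _).1 h1) D hn
    rwa [ev_sub, sub_eq_zero] at h2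
  · intro x
    choose φ hφ using fun n => Submodule.mkQ_surjective ((jetFil k A L).part n) (x.1 n)
    have key : ∀ m n, m ≤ n → ∀ D, DegLT m D → (φ n).ev D = (φ m).ev D := fun m n h D hD => by
      have h1 := x.2 m n h
      rw [← hφ n, ← hφ m] at h1
      have h2 := mem_jetFil.1 ((Submodule.Quotient.eq _).1 h1) D hD
      rwa [ev_sub, sub_eq_zero] at h2
    -- The p-jet is read off at level p + 1, the first level whose filtration submodule kills all
    -- p-jets.
    let Φ : Jet k A L :=
      { jet := fun p => (φ (p + 1)).jet p
        compat := fun p q h => by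
          ext ⟨D, hD⟩
          rw [LinearMap.comp_apply, ← ev_eq _ hD]
          exact (ev_eq _ (degLE_mono h hD)).symm.trans (key _ _ (by omega) D ⟨p, by omega, hD⟩) }
    refine ⟨Φ, Subtype.ext (funext fun n => ?_)⟩
    rw [← hφ n]
    refine (Submodule.Quotient.eq _).2 (mem_jetFil.2 ?_)
    rintro D ⟨m, hm, hD⟩
    rw [ev_sub, ev_eq Φ hD, sub_eq_zero]
    exact (ev_eq (φ (m + 1)) hD).symm.trans (key (m + 1) n hm D ⟨m, by omega, hD⟩).symm

lemma jetFil_isCompleteAlgebra : (jetFil k A L).IsCompleteAlgebra :=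
  ⟨jetFil_zero, fun _ _ _ _ => jetFil_mul_mem, jetFil_complete⟩

/-! ### Source and target -/

lemma eps_mul_iA (D : Env k A L) (a : A) : eps (D * iA k A L a) = act D a := by
  rw [eps_apply, act_mul, act_iA, mul_one]

lemma comm_cop (D : Env k A L) : TensorProduct.comm A _ _ (cop D) = cop D :=
  Coalgebra.comm_comul A D

lemma lid_eps_cop (D : Env k A L) : TensorProduct.lid A _ (eps.rTensor _ (cop D)) = D := by
  have h : eps.rTensor _ (cop D) = 1 ⊗ₜ[A] D := Coalgebra.rTensor_counit_comul D
  rw [h, TensorProduct.lid_tmul, one_smul]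

/-- Both s(a) and t(a) have the form ε ∘ g with g an A-linear endomorphism of VL. Multiplying by
such a jet inserts g into the counit law. -/
lemma ev_ofDual_mul (D : Env k A L) (f : Env k A L →ₗ[A] A) (g : Env k A L →ₗ[A] Env k A L)
    (h : ∀ D, f D = eps (g D)) (φ : Jet k A L) :
    (ofDual f * φ).ev D = φ.ev (TensorProduct.lid A _ (eps.rTensor _ (g.rTensor _ (cop D)))) := by
  rw [ev_mul]
  generalize cop D = w
  induction w with
  | zero => simp [← toDual_apply]
  | add x y hx hy => simp only [map_add, hx, hy, ev_map_add]
  | tmul D E => simp [h, ev_map_smul]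

variable (k A L) in
/-- The left source map `s(a)(D) = a ε(D)`. -/
def source : A →ₐ[k] Jet k A L :=
  AlgHom.ofLinearMap
    { toFun := fun a => ofDual (a • eps)
      map_add' := fun a b => ev_ext fun D => by simp [ev_add, add_mul]
      map_smul' := fun c a => ev_ext fun D => by simp [ev_smul] }
    (ev_ext fun D => by simp [ev_one])
    (fun a b => ev_ext fun D => by
      change _ = (ofDual (a • eps) * ofDual (b • eps)).ev D
      rw [ev_ofDual_mul D _ (a • LinearMap.id) (by simp), LinearMap.rTensor_smul,
        LinearMap.rTensor_id, LinearMap.smul_apply, LinearMap.id_apply, map_smul, map_smul,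
        lid_eps_cop]
      simp [mul_assoc])

@[simp] lemma ev_source (a : A) (D : Env k A L) : (source k A L a).ev D = a * eps D := rfl

lemma ev_source_mul (a : A) (φ : Jet k A L) (D : Env k A L) :
    (source k A L a * φ).ev D = a * φ.ev D := by
  change (ofDual (a • eps) * φ).ev D = _
  rw [ev_ofDual_mul D _ (a • LinearMap.id) (by simp), LinearMap.rTensor_smul,
    LinearMap.rTensor_id, LinearMap.smul_apply, LinearMap.id_apply, map_smul, map_smul,
    lid_eps_cop, ev_map_smul]

lemma ev_evalAct_mul (a : A) (f : Env k A L →ₗ[A] A) (h : ∀ D, f D = act D a) (φ : Jet k A L)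
    (D : Env k A L) : (ofDual f * φ).ev D = φ.ev (D * iA k A L a) := by
  rw [ev_ofDual_mul D _ (mulRight (iA k A L a)) (by simp [h, eps_mul_iA])]
  -- `cop_mul_iA` puts the right factor a on the second leg of Δ(D); cocommutativity moves it to the
  -- first.
  have h2 : cop (D * iA k A L a) = (mulRight (iA k A L a)).rTensor _ (cop D) := by
    rw [← comm_cop (D * iA k A L a), cop_mul_iA]
    conv_rhs => rw [← comm_cop D]
    generalize cop D = w
    induction w with
    | zero => simp
    | add x y hx hy => simp only [map_add, hx, hy]
    | tmul D E => simp
  rw [← h2, lid_eps_cop]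

variable (k A L) in
/-- The left target map `t(a)(D) = D(a)`. -/
def target : A →ₐ[k] Jet k A L :=
  AlgHom.ofLinearMap
    { toFun := fun a => ofDual
        { toFun := fun D => act D a
          map_add' := fun D E => by simp
          map_smul' := fun b D => by simp [act_smul] }
      map_add' := fun a b => ev_ext fun D => by simp [ev_add]
      map_smul' := fun c a => ev_ext fun D => by simp [ev_smul] }
    (ev_ext fun D => by simp [ev_one, eps_apply])
    (fun a b => ev_ext fun D => by
      -- Multiplication by t(a) is precomposition with right multiplication by a, and D(ab) =
      -- (Da)(b).
      refine Eq.trans ?_ (ev_evalAct_mul a _ (fun _ => rfl) _ D).symm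
      change act D (a * b) = act (D * iA k A L a) b
      rw [act_mul, act_iA])

@[simp] lemma ev_target (a : A) (D : Env k A L) : (target k A L a).ev D = act D a := rfl

lemma ev_target_mul (a : A) (φ : Jet k A L) (D : Env k A L) :
    (target k A L a * φ).ev D = φ.ev (D * iA k A L a) :=
  ev_evalAct_mul a _ (fun _ => rfl) φ D

/-! ### The pairing and the filtration of the tensor product -/

/-- The actions `lam` and `rho` of `A` on the jet space are the ones dual to left and right
multiplication by `A` on `VL`. -/
structure IsDualAction (lam rho : A →ₗ[k] Module.End k (Jet k A L)) : Prop where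
  ev_lam : ∀ a φ D, (lam a φ).ev D = a * φ.ev D
  ev_rho : ∀ a φ D, (rho a φ).ev D = φ.ev (D * iA k A L a)

lemma ext_pair {f g : Jet k A L ⊗[k] Jet k A L →ₗ[k] A}
    (h : ∀ φ ψ, f (φ ⊗ₜ[k] ψ) = g (φ ⊗ₜ[k] ψ)) (u : Jet k A L ⊗[k] Jet k A L) : f u = g u :=
  LinearMap.congr_fun (TensorProduct.ext' h) u

section Pairing

variable {lam rho lam' rho' : A →ₗ[k] Module.End k (Jet k A L)}

lemma IsDualAction.pair_eq_zero (H : IsDualAction lam rho) {n : ℕ} {u : Jet k A L ⊗[k] Jet k A L}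
    (hu : u ∈ (tensorFil (jetFil k A L) lam rho).part n) {D E : Env k A L} (hD : DegLT n D)
    (hE : DegLT n E) : pair D E u = 0 := by
  induction hu using Submodule.span_induction with
  | mem u hu =>
    rcases hu with ⟨a, h, h', rfl⟩ | ⟨h, h', hh | hh, rfl⟩
    · rw [map_sub, pair_tmul, pair_tmul, H.ev_rho, H.ev_lam, mul_assoc, ← map_mul, mul_comm a,
        sub_self]
    · rw [pair_tmul]
      exact mem_jetFil.1 hh _ (hD.mul_iA _)
    · rw [pair_tmul, mem_jetFil.1 hh _ hE, map_zero, mul_zero]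
      exact map_zero h.toDual
  | zero => simp
  | add x y _ _ hx hy => rw [map_add, hx, hy, add_zero]
  | smul c x _ hx => rw [map_smul, hx, smul_zero]

/-- The map `φ ⊗ ψ ↦ φ ⬝ ψ(d)`. -/
def row (rho : A →ₗ[k] Module.End k (Jet k A L)) (d : Env k A L) :
    Jet k A L ⊗[k] Jet k A L →ₗ[k] Jet k A L :=
  TensorProduct.lift (rho.comp (evₗ d)).flip

lemma row_tmul (d : Env k A L) (φ ψ : Jet k A L) : row rho d (φ ⊗ₜ[k] ψ) = rho (ψ.ev d) φ := rfl

lemma IsDualAction.ev_row (H : IsDualAction lam rho) (d D : Env k A L)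
    (u : Jet k A L ⊗[k] Jet k A L) : (row rho d u).ev D = pair D d u :=
  ext_pair (f := (evₗ D).comp (row rho d)) (g := pair D d) (fun _ _ => H.ev_rho _ _ _) u

/-- A finite dual basis of the elements of degree less than `n`. -/
structure IsDualBasis (n : ℕ) {σ : Type} (T : Finset σ) (d : σ → Env k A L) (f : σ → Jet k A L) :
    Prop where
  degLT : ∀ i ∈ T, DegLT n (d i)
  eq_sum : ∀ D, DegLT n D → D = ∑ i ∈ T, (f i).ev D • d i

lemma exists_isDualBasis [Module.Finite A L] [Module.Projective A L] (n : ℕ) :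
    ∃ (σ : Type) (T : Finset σ) (d : σ → Env k A L) (f : σ → Jet k A L), IsDualBasis n T d f := by
  rcases n with _ | n
  · refine ⟨Empty, ∅, Empty.elim, Empty.elim, by simp, ?_⟩
    rintro D ⟨m, hm, -⟩
    omega
  · obtain ⟨σ, T, d, f, hd, h⟩ := exists_dualBasis (k := k) (A := A) (L := L) n
    refine ⟨σ, T, d, f, fun i hi => ⟨n, by omega, hd i hi⟩, ?_⟩
    rintro D ⟨m, hm, hD⟩
    exact h D (degLE_mono (by omega) hD)

variable {n : ℕ} {σ : Type} {T : Finset σ} {d : σ → Env k A L} {f : σ → Jet k A L}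

lemma IsDualBasis.ev_eq (hT : IsDualBasis n T d f) (ψ : Jet k A L) {D : Env k A L}
    (hD : DegLT n D) : ψ.ev D = ∑ i ∈ T, (f i).ev D * ψ.ev (d i) := by
  conv_lhs => rw [hT.eq_sum D hD]
  rw [ev_map_sum]
  exact Finset.sum_congr rfl fun i _ => ev_map_smul _ _ _

/-- Modulo Fₙ each ψ is ∑ ψ(dᵢ)fᵢ, and the balancing relation moves the coefficient ψ(dᵢ) to the
first factor. -/
lemma IsDualBasis.sub_sum_mem (hT : IsDualBasis n T d f) (H : IsDualAction lam rho)
    (u : Jet k A L ⊗[k] Jet k A L) :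
    u - ∑ i ∈ T, row rho (d i) u ⊗ₜ[k] f i ∈ (tensorFil (jetFil k A L) lam rho).part n := by
  induction u with
  | zero => simp
  | add x y hx hy =>
    have h := add_mem hx hy
    simp only [map_add, TensorProduct.add_tmul, Finset.sum_add_distrib]
    convert h using 1
    abel
  | tmul φ ψ =>
    have h1 : φ ⊗ₜ[k] ψ - ∑ i ∈ T, row rho (d i) (φ ⊗ₜ[k] ψ) ⊗ₜ[k] f i =
        φ ⊗ₜ[k] (ψ - ∑ i ∈ T, lam (ψ.ev (d i)) (f i)) -
          ∑ i ∈ T, (rho (ψ.ev (d i)) φ ⊗ₜ[k] f i - φ ⊗ₜ[k] lam (ψ.ev (d i)) (f i)) := by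
      rw [TensorProduct.tmul_sub, TensorProduct.tmul_sum, Finset.sum_sub_distrib]
      simp only [row_tmul]
      abel
    rw [h1]
    refine sub_mem (Submodule.subset_span (Or.inr ⟨_, _, Or.inr (mem_jetFil.2 fun D hD => ?_), rfl⟩))
      (sum_mem fun i _ => Submodule.subset_span (Or.inl ⟨_, _, _, rfl⟩))
    rw [ev_sub, ev_sum, hT.ev_eq ψ hD, sub_eq_zero]
    exact Finset.sum_congr rfl fun i _ => by rw [H.ev_lam, mul_comm]

variable [Module.Finite A L] [Module.Projective A L]

/-- Nondegeneracy of the pairing, the point where finite projectivity enters. By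
`IsDualBasis.sub_sum_mem` only ∑ uᵢ ⊗ fᵢ has to be treated, and uᵢ(D) = ⟨u, D ⊗ dᵢ⟩ = 0 in degree
less than n puts uᵢ in Fₙ. -/
lemma IsDualAction.mem_tensorFil (H : IsDualAction lam rho) {u : Jet k A L ⊗[k] Jet k A L} :
    u ∈ (tensorFil (jetFil k A L) lam rho).part n ↔
      ∀ D E, DegLT n D → DegLT n E → pair D E u = 0 := by
  refine ⟨fun hu D E hD hE => H.pair_eq_zero hu hD hE, fun hu => ?_⟩
  obtain ⟨σ, T, d, f, hT⟩ := exists_isDualBasis (k := k) (A := A) (L := L) n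
  rw [← sub_add_cancel u (∑ i ∈ T, row rho (d i) u ⊗ₜ[k] f i)]
  refine add_mem (hT.sub_sum_mem H u) (sum_mem fun i hi => ?_)
  refine Submodule.subset_span (Or.inr ⟨_, _, Or.inl (mem_jetFil.2 fun D hD => ?_), rfl⟩)
  rw [H.ev_row]
  exact hu D _ hD (hT.degLT i hi)

lemma IsDualAction.mkQ_eq_iff (H : IsDualAction lam rho) {u v : Jet k A L ⊗[k] Jet k A L} :
    ((tensorFil (jetFil k A L) lam rho).part n).mkQ u =
        ((tensorFil (jetFil k A L) lam rho).part n).mkQ v ↔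
      ∀ D E, DegLT n D → DegLT n E → pair D E u = pair D E v := by
  rw [Submodule.mkQ_apply, Submodule.mkQ_apply, Submodule.Quotient.eq, H.mem_tensorFil]
  simp only [map_sub, sub_eq_zero]

/-- The pairing `(φ ⊗ ψ ⊗ χ)(D ⊗ E ⊗ G) = φ(D ψ(E χ(G)))`. -/
def pair₃ (D E G : Env k A L) : Jet k A L ⊗[k] (Jet k A L ⊗[k] Jet k A L) →ₗ[k] A :=
  TensorProduct.lift (LinearMap.mk₂ k (fun φ w => φ.ev (D * iA k A L (pair E G w)))
    (fun φ φ' w => by rw [ev_add])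
    (fun c φ w => by rw [ev_smul])
    (fun φ w w' => by rw [map_add, map_add, mul_add, ev_map_add])
    (fun c φ w => by
      rw [map_smul, map_smul, mul_smul_comm, ← algebraMap_smul A c (D * _), ev_map_smul,
        Algebra.smul_def]))

lemma pair₃_tmul (D E G : Env k A L) (φ : Jet k A L) (w : Jet k A L ⊗[k] Jet k A L) :
    pair₃ D E G (φ ⊗ₜ[k] w) = φ.ev (D * iA k A L (pair E G w)) := rfl

lemma assoc_tmul_mem {v : Jet k A L ⊗[k] Jet k A L}
    (hv : v ∈ (tensorFil (jetFil k A L) lam rho).part n) (χ : Jet k A L) :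
    TensorProduct.assoc k _ _ _ (v ⊗ₜ[k] χ) ∈
      (tensorFil₃ (jetFil k A L) lam rho lam' rho').part n := by
  have h := LinearMap.congr_fun (congrArg (appendRight (jetFil k A L) lam rho lam' rho' n)
    ((Submodule.Quotient.mk_eq_zero _).2 hv)) χ
  rw [map_zero] at h
  exact (Submodule.Quotient.mk_eq_zero _).1 h

lemma tmul_mem {v : Jet k A L ⊗[k] Jet k A L}
    (hv : v ∈ (tensorFil (jetFil k A L) lam' rho').part n) (χ : Jet k A L) :
    χ ⊗ₜ[k] v ∈ (tensorFil₃ (jetFil k A L) lam rho lam' rho').part n := by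
  have h := LinearMap.congr_fun (congrArg (appendLeft (jetFil k A L) lam rho lam' rho' n)
    ((Submodule.Quotient.mk_eq_zero _).2 hv)) χ
  rw [map_zero] at h
  exact (Submodule.Quotient.mk_eq_zero _).1 h

lemma IsDualBasis.sub_sum_mem₃ (hT : IsDualBasis n T d f) (H' : IsDualAction lam' rho')
    (u : Jet k A L ⊗[k] (Jet k A L ⊗[k] Jet k A L)) :
    u - ∑ i ∈ T, TensorProduct.assoc k _ _ _ ((row rho' (d i)).lTensor _ u ⊗ₜ[k] f i) ∈
      (tensorFil₃ (jetFil k A L) lam rho lam' rho').part n := by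
  induction u with
  | zero => simp
  | add x y hx hy =>
    have h := add_mem hx hy
    simp only [map_add, TensorProduct.add_tmul, Finset.sum_add_distrib]
    convert h using 1
    abel
  | tmul φ w =>
    have h := tmul_mem (lam := lam) (rho := rho) (hT.sub_sum_mem H' w) φ
    rw [TensorProduct.tmul_sub, TensorProduct.tmul_sum] at h
    exact h

/-- Contracting the last factor with the dᵢ reduces to the twofold case: pairing the contraction
with D ⊗ E is the triple pairing with D ⊗ E ⊗ dᵢ. -/
lemma IsDualAction.mem_tensorFil₃ (H : IsDualAction lam rho) (H' : IsDualAction lam' rho')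
    {u : Jet k A L ⊗[k] (Jet k A L ⊗[k] Jet k A L)}
    (hu : ∀ D E G, DegLT n D → DegLT n E → DegLT n G → pair₃ D E G u = 0) :
    u ∈ (tensorFil₃ (jetFil k A L) lam rho lam' rho').part n := by
  obtain ⟨σ, T, d, f, hT⟩ := exists_isDualBasis (k := k) (A := A) (L := L) n
  rw [← sub_add_cancel u
    (∑ i ∈ T, TensorProduct.assoc k _ _ _ ((row rho' (d i)).lTensor _ u ⊗ₜ[k] f i))]
  refine add_mem (hT.sub_sum_mem₃ H' u) (sum_mem fun i hi => assoc_tmul_mem ?_ _)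
  refine H.mem_tensorFil.2 fun D E hD hE => ?_
  have key : (pair D E).comp ((row rho' (d i)).lTensor _) = pair₃ D E (d i) := by
    refine TensorProduct.ext' fun φ w => ?_
    rw [LinearMap.comp_apply, LinearMap.lTensor_tmul, pair_tmul, pair₃_tmul, H'.ev_row]
  exact (LinearMap.congr_fun key u).trans (hu D E _ hD hE (hT.degLT i hi))

end Pairing

end Jet

end LieRinehart

/-! ### Representatives of elements of a completion -/

namespace Filtration

variable {k M : Type*} [CommRing k] [AddCommGroup M] [Module k M] {F : Filtration k M}

lemma exists_mkQ_eq (x : F.Completion) (n : ℕ) : ∃ u, (F.part n).mkQ u = F.proj n x :=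
  Submodule.mkQ_surjective _ _

lemma mkQ_eq_of_le {x : F.Completion} {m n : ℕ} (h : m ≤ n) {u : M}
    (hu : (F.part n).mkQ u = F.proj n x) : (F.part m).mkQ u = F.proj m x :=
  (congrArg (Submodule.factor (F.anti h)) hu).trans (x.2 m n h)

lemma completion_ext {x y : F.Completion} (h : ∀ n, F.proj n x = F.proj n y) : x = y :=
  Subtype.ext (funext h)

end Filtration

namespace LieRinehart

variable {k A L : Type*} [CommRing k] [CommRing A] [Algebra k A] [LieRing L] [LieAlgebra k L]
  [Module A L] [LieRingModule L A] [LieRinehartRing A L] [LieRinehartAlgebra k A L]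

namespace Jet

open Env Filtration

lemma ev_iA (φ : Jet k A L) (a : A) : φ.ev (iA k A L a) = a * φ.ev 1 := by
  rw [← mul_one (iA k A L a), ← smul_def, ev_map_smul]

/-! ### The coproduct -/

section Coproduct

variable {lam rho lam' rho' : A →ₗ[k] Module.End k (Jet k A L)}

/-- The pairings of `y` with elements of `VL` are given by `g`. -/
def Represents (g : Env k A L → Env k A L → A)
    (y : (tensorFil (jetFil k A L) lam rho).Completion) : Prop :=
  ∀ (n : ℕ) (u : Jet k A L ⊗[k] Jet k A L),
    ((tensorFil (jetFil k A L) lam rho).part n).mkQ u = (tensorFil (jetFil k A L) lam rho).proj n y ↔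
      ∀ D E, DegLT n D → DegLT n E → pair D E u = g D E

lemma Represents.unique {g : Env k A L → Env k A L → A}
    {x y : (tensorFil (jetFil k A L) lam rho).Completion} (hx : Represents g x)
    (hy : Represents g y) : x = y :=
  completion_ext fun n => by
    obtain ⟨u, hu⟩ := exists_mkQ_eq x n
    rw [← hu, (hy n u).2 ((hx n u).1 hu)]

lemma Represents.extendsTo {g : Env k A L → Env k A L → A}
    {y : (tensorFil (jetFil k A L) lam rho).Completion} (h : Represents g y) (D E : Env k A L) :
    Filtration.ExtendsTo _ (pair D E) y (g D E) := by
  obtain ⟨m, hm⟩ := exists_degLT D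
  obtain ⟨n, hn⟩ := exists_degLT E
  exact ⟨max m n, fun u hu =>
    (h _ u).1 hu D E (hm.mono (le_max_left m n)) (hn.mono (le_max_right m n))⟩

/-- The coproduct `Δ` is dual to the product of `VL`. -/
def IsDualCoproduct (Δ : Jet k A L →ₗ[k] (tensorFil (jetFil k A L) lam rho).Completion) : Prop :=
  ∀ φ, Represents (fun D E => φ.ev (D * E)) (Δ φ)

lemma IsDualCoproduct.unique {Δ Δ' : Jet k A L →ₗ[k] (tensorFil (jetFil k A L) lam rho).Completion}
    (h : IsDualCoproduct Δ) (h' : IsDualCoproduct Δ') : Δ = Δ' :=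
  LinearMap.ext fun φ => (h φ).unique (h' φ)

lemma IsDualCoproduct.mkQ_eq_iff
    {Δ : Jet k A L →ₗ[k] (tensorFil (jetFil k A L) lam rho).Completion} (hΔ : IsDualCoproduct Δ)
    (h : Jet k A L) (n : ℕ) (u : Jet k A L ⊗[k] Jet k A L) :
    ((tensorFil (jetFil k A L) lam rho).part n).mkQ u = proj _ n (Δ h) ↔
      ∀ D E, DegLT n D → DegLT n E → pair D E u = h.ev (D * E) :=
  hΔ h n u

variable [Module.Finite A L] [Module.Projective A L]

/-- `ExtendsTo` only provides a level depending on D and E. Representatives at level n agree in all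
pairings of degree less than n, so comparison with a finer one shows that level n suffices. -/
lemma IsDualAction.represents_of_extendsTo (H : IsDualAction lam rho)
    {g : Env k A L → Env k A L → A} {y : (tensorFil (jetFil k A L) lam rho).Completion}
    (h : ∀ D E, Filtration.ExtendsTo _ (pair D E) y (g D E)) : Represents g y := by
  have key : ∀ (n : ℕ) (u : Jet k A L ⊗[k] Jet k A L),
      ((tensorFil (jetFil k A L) lam rho).part n).mkQ u = proj _ n y →
      ∀ D E, DegLT n D → DegLT n E → pair D E u = g D E := fun n u hu D E hD hE => by
    obtain ⟨m, hm⟩ := h D E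
    obtain ⟨v, hv⟩ := exists_mkQ_eq y (max m n)
    rw [← hm v (mkQ_eq_of_le (le_max_left m n) hv)]
    exact H.mkQ_eq_iff.1 (hu.trans (mkQ_eq_of_le (le_max_right m n) hv).symm) D E hD hE
  refine fun n u => ⟨key n u, fun hu => ?_⟩
  obtain ⟨v, hv⟩ := exists_mkQ_eq y n
  rw [← hv]
  exact H.mkQ_eq_iff.2 fun D E hD hE => (hu D E hD hE).trans (key n v hv D E hD hE).symm

/-- Truncated solutions are automatically compatible: modulo the m-th part they are determined by
their pairings in degree less than m. -/
lemma IsDualAction.exists_represents (H : IsDualAction lam rho) (g : Env k A L → Env k A L → A)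
    (hg : ∀ n, ∃ u, ∀ D E, DegLT n D → DegLT n E → pair D E u = g D E) :
    ∃ y : (tensorFil (jetFil k A L) lam rho).Completion, Represents g y := by
  choose u hu using hg
  refine ⟨⟨fun n => ((tensorFil (jetFil k A L) lam rho).part n).mkQ (u n), fun m n h => ?_⟩,
    fun n v => ?_⟩
  · change ((tensorFil (jetFil k A L) lam rho).part m).mkQ (u n) =
      ((tensorFil (jetFil k A L) lam rho).part m).mkQ (u m)
    exact H.mkQ_eq_iff.2 fun D E hD hE =>
      (hu n D E (hD.mono h) (hE.mono h)).trans (hu m D E hD hE).symm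
  · change _ = ((tensorFil (jetFil k A L) lam rho).part n).mkQ (u n) ↔ _
    rw [H.mkQ_eq_iff]
    exact forall₄_congr fun D E hD hE => by rw [hu n D E hD hE]

lemma IsDualAction.exists_comul (H : IsDualAction lam rho) (φ : Jet k A L) :
    ∃ y : (tensorFil (jetFil k A L) lam rho).Completion,
      Represents (fun D E => φ.ev (D * E)) y := by
  refine H.exists_represents _ fun n => ?_
  obtain ⟨σ, T, d, f, hT⟩ := exists_isDualBasis (k := k) (A := A) (L := L) n
  -- Substituting E = ∑ fᵢ(E)dᵢ in φ(DE) gives ∑ φ(D fᵢ(E) dᵢ), the pairing of ∑ φ(· dᵢ) ⊗ fᵢ with D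
  -- ⊗ E.
  refine ⟨∑ i ∈ T, ofDual (φ.toDual.comp (mulRight (d i))) ⊗ₜ[k] f i, fun D E _ hE => ?_⟩
  conv_rhs => rw [hT.eq_sum E hE, Finset.mul_sum, ev_map_sum]
  rw [map_sum]
  refine Finset.sum_congr rfl fun i _ => ?_
  rw [pair_tmul, ev_ofDual, LinearMap.comp_apply, mulRight_apply, toDual_apply, mul_assoc,
    ← smul_def]

/-- The coproduct dual to the product of `VL`. -/
def comul (H : IsDualAction lam rho) :
    Jet k A L →ₗ[k] (tensorFil (jetFil k A L) lam rho).Completion where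
  toFun φ := (H.exists_comul φ).choose
  map_add' φ ψ := by
    refine (H.exists_comul (φ + ψ)).choose_spec.unique (H.represents_of_extendsTo fun D E => ?_)
    obtain ⟨m, hm⟩ := (H.exists_comul φ).choose_spec.extendsTo D E
    obtain ⟨n, hn⟩ := (H.exists_comul ψ).choose_spec.extendsTo D E
    refine ⟨max m n, fun u hu => ?_⟩
    obtain ⟨v, hv⟩ := exists_mkQ_eq (H.exists_comul φ).choose (max m n)
    have hw : ((tensorFil (jetFil k A L) lam rho).part (max m n)).mkQ (u - v) =
        proj _ (max m n) (H.exists_comul ψ).choose := by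
      rw [map_sub, hu, hv, map_add, add_sub_cancel_left]
    rw [← add_sub_cancel v u, map_add, hm v (mkQ_eq_of_le (le_max_left m n) hv),
      hn _ (mkQ_eq_of_le (le_max_right m n) hw), ev_add]
  map_smul' c φ := by
    rw [RingHom.id_apply]
    have h := (H.exists_comul φ).choose_spec
    refine (H.exists_comul (c • φ)).choose_spec.unique fun n u => ?_
    obtain ⟨v, hv⟩ := exists_mkQ_eq (H.exists_comul φ).choose n
    rw [map_smul, ← hv, ← map_smul, H.mkQ_eq_iff]
    refine forall₄_congr fun D E hD hE => ?_
    have h' : pair D E v = φ.ev (D * E) := (h n v).1 hv D E hD hE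
    rw [map_smul, h', ← ev_smul]

lemma isDualCoproduct_comul (H : IsDualAction lam rho) : IsDualCoproduct (comul H) :=
  fun φ => (H.exists_comul φ).choose_spec

variable {Δ : Jet k A L →ₗ[k] (tensorFil (jetFil k A L) lam rho).Completion}
  {Δ' : Jet k A L →ₗ[k] (tensorFil (jetFil k A L) lam' rho').Completion}

/-- For v = φ ⊗ ψ the triple pairing is ⟨Δφ, D ⊗ Eψ(G)⟩ = φ(DEψ(G)); this turns coassociativity into
a statement about values. -/
lemma exists_comulId (hΔ : IsDualCoproduct Δ) (n : ℕ) (v : Jet k A L ⊗[k] Jet k A L) :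
    ∃ w, ((tensorFil₃ (jetFil k A L) lam rho lam' rho').part n).mkQ w =
        comulId (jetFil k A L) lam rho lam' rho' Δ n v ∧
      ∀ D E G, DegLT n D → DegLT n E → DegLT n G → pair₃ D E G w = pair (D * E) G v := by
  induction v with
  | zero => exact ⟨0, by simp, by simp⟩
  | add x y hx hy =>
    obtain ⟨w, h1, h2⟩ := hx
    obtain ⟨w', h1', h2'⟩ := hy
    refine ⟨w + w', by rw [map_add, map_add, h1, h1'], fun D E G hD hE hG => ?_⟩
    rw [map_add, map_add, h2 D E G hD hE hG, h2' D E G hD hE hG]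
  | tmul φ ψ =>
    obtain ⟨u, hu⟩ := exists_mkQ_eq (Δ φ) n
    refine ⟨TensorProduct.assoc k _ _ _ (u ⊗ₜ[k] ψ), ?_, fun D E G hD hE _ => ?_⟩
    · exact LinearMap.congr_fun
        (congrArg (appendRight (jetFil k A L) lam rho lam' rho' n) hu) ψ
    · have h1 : pair₃ D E G (TensorProduct.assoc k _ _ _ (u ⊗ₜ[k] ψ)) =
          pair D (E * iA k A L (ψ.ev G)) u := by
        clear hu
        induction u with
        | zero => simp
        | add x y hx hy => rw [TensorProduct.add_tmul, map_add, map_add, hx, hy, map_add]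
        | tmul φ₁ φ₂ => rfl
      rw [h1, (hΔ.mkQ_eq_iff φ n u).1 hu _ _ hD (hE.mul_iA _), pair_tmul, mul_assoc]

lemma exists_idComul (hΔ : IsDualCoproduct Δ') (n : ℕ) (v : Jet k A L ⊗[k] Jet k A L) :
    ∃ w, ((tensorFil₃ (jetFil k A L) lam rho lam' rho').part n).mkQ w =
        idComul (jetFil k A L) lam rho lam' rho' Δ' n v ∧
      ∀ D E G, DegLT n D → DegLT n E → DegLT n G → pair₃ D E G w = pair D (E * G) v := by
  induction v with
  | zero => exact ⟨0, by simp, by simp⟩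
  | add x y hx hy =>
    obtain ⟨w, h1, h2⟩ := hx
    obtain ⟨w', h1', h2'⟩ := hy
    refine ⟨w + w', by rw [map_add, map_add, h1, h1'], fun D E G hD hE hG => ?_⟩
    rw [map_add, map_add, h2 D E G hD hE hG, h2' D E G hD hE hG]
  | tmul φ ψ =>
    obtain ⟨u, hu⟩ := exists_mkQ_eq (Δ' ψ) n
    refine ⟨φ ⊗ₜ[k] u, ?_, fun D E G _ hE hG => ?_⟩
    · exact LinearMap.congr_fun
        (congrArg (appendLeft (jetFil k A L) lam rho lam' rho' n) hu) φ
    · rw [pair₃_tmul, (hΔ.mkQ_eq_iff ψ n u).1 hu E G hE hG, pair_tmul]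

/-- Both composites pair with D ⊗ E ⊗ G to h(DEG). The two coproducts may belong to different
bimodule structures, so this covers the mixed axioms as well. -/
lemma coassoc (H : IsDualAction lam rho) (H' : IsDualAction lam' rho') (hΔ : IsDualCoproduct Δ)
    (hΔ' : IsDualCoproduct Δ') : Coassoc (jetFil k A L) lam rho lam' rho' Δ Δ' := by
  intro h n
  -- Level n + n, because DE and EG have degree less than 2n when the factors have degree less than
  -- n.
  obtain ⟨u₀, hu₀⟩ := exists_mkQ_eq (Δ' h) (n + n)
  have eq : ∀ w w' : Jet k A L ⊗[k] (Jet k A L ⊗[k] Jet k A L),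
      (∀ D E G, DegLT n D → DegLT n E → DegLT n G → pair₃ D E G w = pair₃ D E G w') →
      ((tensorFil₃ (jetFil k A L) lam rho lam' rho').part n).mkQ w =
        ((tensorFil₃ (jetFil k A L) lam rho lam' rho').part n).mkQ w' := fun w w' hw =>
    (Submodule.Quotient.eq _).2 (H.mem_tensorFil₃ H' fun D E G hD hE hG => by
      rw [map_sub, hw D E G hD hE hG, sub_self])
  obtain ⟨w₀, h₀, h₀'⟩ := exists_comulId (lam' := lam') (rho' := rho') hΔ n u₀
  refine ⟨comulId (jetFil k A L) lam rho lam' rho' Δ n u₀, ⟨n + n, fun u hu => ?_⟩,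
    ⟨n + n, fun u hu => ?_⟩⟩
  · obtain ⟨w, h1, h1'⟩ := exists_comulId (lam' := lam') (rho' := rho') hΔ n u
    rw [← h₀, ← h1]
    refine eq _ _ fun D E G hD hE hG => ?_
    rw [h1' D E G hD hE hG, h₀' D E G hD hE hG,
      (hΔ'.mkQ_eq_iff h _ u).1 hu _ _ (hD.mul hE) (hG.mono (Nat.le_add_left _ _)),
      (hΔ'.mkQ_eq_iff h _ u₀).1 hu₀ _ _ (hD.mul hE) (hG.mono (Nat.le_add_left _ _))]
  · obtain ⟨w, h1, h1'⟩ := exists_idComul (lam := lam) (rho := rho) hΔ' n u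
    rw [← h₀, ← h1]
    refine eq _ _ fun D E G hD hE hG => ?_
    rw [h1' D E G hD hE hG, h₀' D E G hD hE hG,
      (hΔ.mkQ_eq_iff h _ u).1 hu _ _ (hD.mono (Nat.le_add_left _ _)) (hE.mul hG),
      (hΔ'.mkQ_eq_iff h _ u₀).1 hu₀ _ _ (hD.mul hE) (hG.mono (Nat.le_add_left _ _)), mul_assoc]

lemma isCoring (H : IsDualAction lam rho) (hΔ : IsDualCoproduct Δ) :
    IsCoring (jetFil k A L) lam rho Δ (evₗ 1) where
  comul_continuous p := ⟨p + p, fun h hh => by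
    rw [← ((hΔ.mkQ_eq_iff h p 0).2 fun D E hD hE => ?_), map_zero]
    rw [map_zero, mem_jetFil.1 hh _ (hD.mul hE)]⟩
  counit_continuous := ⟨1, fun h hh => mem_jetFil.1 hh 1 (degLT_one 0)⟩
  comul_lam a h p := ⟨p, fun u hu => (hΔ.mkQ_eq_iff _ p _).2 fun D E hD hE => by
    have e : pair D E ((lam a).rTensor _ u) = a * pair D E u :=
      ext_pair (f := (pair D E).comp ((lam a).rTensor _)) (g := (LinearMap.mulLeft k a).comp (pair D E))
        (fun φ ψ => H.ev_lam a φ _) u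
    rw [e, (hΔ.mkQ_eq_iff h p u).1 hu D E hD hE, H.ev_lam]⟩
  comul_rho a h p := ⟨p, fun u hu => (hΔ.mkQ_eq_iff _ p _).2 fun D E hD hE => by
    have e : pair D E ((rho a).lTensor _ u) = pair D (E * iA k A L a) u :=
      ext_pair (f := (pair D E).comp ((rho a).lTensor _)) (g := pair D (E * iA k A L a))
        (fun φ ψ => by
          rw [LinearMap.comp_apply, LinearMap.lTensor_tmul, pair_tmul, pair_tmul, H.ev_rho]) u
    rw [e, (hΔ.mkQ_eq_iff h p u).1 hu D _ hD (hE.mul_iA a), H.ev_rho, mul_assoc]⟩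
  counit_lam a h := H.ev_lam a h 1
  counit_rho a h := by rw [evₗ_apply, evₗ_apply, H.ev_rho, one_mul, ev_iA, mul_comm]
  coassoc := coassoc H H hΔ hΔ
  -- Level p + 1 keeps 1 among the elements of smaller degree even for p = 0.
  counit_comul h p := ⟨p + 1, fun u hu => by
    refine (Submodule.Quotient.eq _).2 (mem_jetFil.2 fun E hE => ?_)
    have e : (TensorProduct.lift (lam.comp (evₗ 1)) u).ev E = pair 1 E u :=
      ext_pair (f := (evₗ E).comp (TensorProduct.lift (lam.comp (evₗ 1)))) (g := pair 1 E)
        (fun φ ψ => by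
          rw [pair_tmul, one_mul, ev_iA, mul_comm]
          exact H.ev_lam _ _ _) u
    rw [ev_sub, e, (hΔ.mkQ_eq_iff h _ u).1 hu _ _ (degLT_one p) (hE.mono (Nat.le_succ p)), one_mul, sub_self]⟩
  comul_counit h p := ⟨p + 1, fun u hu => by
    refine (Submodule.Quotient.eq _).2 (mem_jetFil.2 fun D hD => ?_)
    have e : (TensorProduct.lift (rho.comp (evₗ 1)).flip u).ev D = pair D 1 u :=
      H.ev_row 1 D u
    rw [ev_sub, e, (hΔ.mkQ_eq_iff h _ u).1 hu _ _ (hD.mono (Nat.le_succ p)) (degLT_one p), mul_one, sub_self]⟩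

/-- Both sides are represented by (D, E) ↦ h(DaE). -/
lemma exists_takeuchi (H : IsDualAction lam rho) (hΔ : IsDualCoproduct Δ) (h : Jet k A L) (a : A)
    {R₁ R₂ : Jet k A L ⊗[k] Jet k A L →ₗ[k] Jet k A L ⊗[k] Jet k A L}
    (h₁ : ∀ D E u, pair D E (R₁ u) = pair (D * iA k A L a) E u)
    (h₂ : ∀ D E u, pair D E (R₂ u) = pair D (iA k A L a * E) u) :
    ∃ y : (tensorFil (jetFil k A L) lam rho).Completion,
      Filtration.MapsTo _ _ R₁ (Δ h) y ∧ Filtration.MapsTo _ _ R₂ (Δ h) y := by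
  obtain ⟨y, hy⟩ := H.exists_represents (fun D E => h.ev (D * iA k A L a * E)) fun n => by
    obtain ⟨u, hu⟩ := exists_mkQ_eq (Δ h) n
    exact ⟨R₁ u, fun D E hD hE => by rw [h₁, (hΔ.mkQ_eq_iff h n u).1 hu _ _ (hD.mul_iA a) hE]⟩
  refine ⟨y, fun p => ⟨p, fun u hu => (hy p _).2 fun D E hD hE => ?_⟩,
    fun p => ⟨p, fun u hu => (hy p _).2 fun D E hD hE => ?_⟩⟩
  · rw [h₁, (hΔ.mkQ_eq_iff h p u).1 hu _ _ (hD.mul_iA a) hE]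
  · have hE' : DegLT p (iA k A L a * E) :=
      hE.imp fun _ hp => ⟨hp.1, Submodule.smul_mem _ a hp.2⟩
    rw [h₂, (hΔ.mkQ_eq_iff h p u).1 hu _ _ hD hE', ← mul_assoc]

/-- For pure tensors, the value (ψψ')(E) expands along Δ(E) into products ab of scalars, and Δ(Dab)
= D₍₁₎a ⊗ D₍₂₎b distributes them over the two factors. -/
lemma pair_mul {m n : ℕ} {x y : Fin m → Env k A L} {x' y' : Fin n → Env k A L} {D E : Env k A L}
    (hD : cop D = ∑ j, x j ⊗ₜ[A] y j) (hE : cop E = ∑ i, x' i ⊗ₜ[A] y' i)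
    (u v : Jet k A L ⊗[k] Jet k A L) :
    pair D E (u * v) = ∑ i, ∑ j, pair (x j) (x' i) u * pair (y j) (y' i) v := by
  induction u with
  | zero => simp
  | add u u' hu hu' => simp only [add_mul, map_add, hu, hu', Finset.sum_add_distrib]
  | tmul φ ψ =>
    induction v with
    | zero => simp
    | add v v' hv hv' => simp only [mul_add, map_add, hv, hv', Finset.sum_add_distrib]
    | tmul φ' ψ' =>
      rw [Algebra.TensorProduct.tmul_mul_tmul, pair_tmul, ev_mul_eq_sum hE, map_sum,
        Finset.mul_sum, ev_map_sum]
      refine Finset.sum_congr rfl fun i _ => ?_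
      have h : cop (D * iA k A L (ψ.ev (x' i) * ψ'.ev (y' i))) =
          ∑ j, (x j * iA k A L (ψ.ev (x' i))) ⊗ₜ[A] (y j * iA k A L (ψ'.ev (y' i))) := by
        rw [cop_mul_iA_mul, hD]
        simp
      rw [ev_mul_eq_sum h]
      rfl

lemma ev_mul_mul {m n : ℕ} {x y : Fin m → Env k A L} {x' y' : Fin n → Env k A L}
    {D E : Env k A L} (hD : cop D = ∑ j, x j ⊗ₜ[A] y j) (hE : cop E = ∑ i, x' i ⊗ₜ[A] y' i)
    (φ ψ : Jet k A L) :
    (φ * ψ).ev (D * E) = ∑ i, ∑ j, φ.ev (x j * x' i) * ψ.ev (y j * y' i) := by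
  rw [ev_mul, cop_mul hE, hD]
  simp

lemma isMultiplicative (hΔ : IsDualCoproduct Δ) :
    IsMultiplicative (jetFil k A L) lam rho Δ where
  map_one := completion_ext fun n => by
    refine ((hΔ.mkQ_eq_iff 1 n _).2 fun D E _ _ => ?_).symm
    rw [pair_tmul, ev_one, ev_one, ev_one, eps_mul_iA, eps_apply, eps_apply, act_mul]
  map_mul h h' p := ⟨p, fun u v hu hv => (hΔ.mkQ_eq_iff _ p _).2 fun D E hD hE => by
    obtain ⟨a, ha, hD⟩ := hD
    obtain ⟨b, hb, hE⟩ := hE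
    obtain ⟨m, x, y, hx, hy, hcD⟩ := cop_eq_sum hD
    obtain ⟨n, x', y', hx', hy', hcE⟩ := cop_eq_sum hE
    rw [pair_mul hcD hcE, ev_mul_mul hcD hcE]
    refine Finset.sum_congr rfl fun i _ => Finset.sum_congr rfl fun j _ => ?_
    rw [(hΔ.mkQ_eq_iff h p u).1 hu _ _ ⟨a, ha, hx j⟩ ⟨b, hb, hx' i⟩,
      (hΔ.mkQ_eq_iff h' p v).1 hv _ _ ⟨a, ha, hy j⟩ ⟨b, hb, hy' i⟩]⟩

end Coproduct

end Jet

/-! ### The antipode -/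

namespace Env

variable (k A L) in
/-- The elements of the balanced tensor product of degree at most `p` in both factors. -/
def rlLE (p : ℕ) : Submodule k (TensorRL k A L) :=
  Submodule.span k {z | ∃ D E : Env k A L, D ∈ degLE k A L p ∧ E ∈ degLE k A L p ∧ z = rl D E}

lemma rl_mem_rlLE {p : ℕ} {D E : Env k A L} (hD : D ∈ degLE k A L p) (hE : E ∈ degLE k A L p) :
    rl D E ∈ rlLE k A L p :=
  Submodule.subset_span ⟨D, E, hD, hE, rfl⟩

lemma rlLE_map {p q : ℕ} (f : Module.End k (TensorRL k A L))
    (hf : ∀ D E, D ∈ degLE k A L p → E ∈ degLE k A L p → f (rl D E) ∈ rlLE k A L q)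
    {z : TensorRL k A L} (hz : z ∈ rlLE k A L p) : f z ∈ rlLE k A L q := by
  have h : rlLE k A L p ≤ (rlLE k A L q).comap f := by
    refine Submodule.span_le.2 ?_
    rintro _ ⟨D, E, hD, hE, rfl⟩
    exact hf D E hD hE
  exact h hz

lemma rlLE_mono {p q : ℕ} (h : p ≤ q) : rlLE k A L p ≤ rlLE k A L q := by
  refine Submodule.span_mono ?_
  rintro _ ⟨D, E, hD, hE, rfl⟩
  exact ⟨D, E, degLE_mono h hD, degLE_mono h hE, rfl⟩

lemma iL_mem_degLE (X : L) : iL k A L X ∈ degLE k A L 1 := by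
  have h := iL_mul_mem_degLE X (one_mem_degLE (k := k) (A := A) (L := L) 0)
  rwa [mul_one] at h

/-- Each step of the recursion for `trans` adds one factor X on the left or on the right. The bound
gives continuity of S and allows representatives of coproducts at a finite level. -/
lemma trans_mem_rlLE {p : ℕ} {D : Env k A L} (hD : D ∈ degLE k A L p) :
    trans D ∈ rlLE k A L p := by
  refine degLE_induction (P := fun p D => trans D ∈ rlLE k A L p) (fun p => ?_) (fun p => ?_)
    (fun p D D' hD hD' => ?_) (fun p a D hD => ?_) (fun p D hD => ?_) (fun p X D _ hD => ?_) hD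
  · rw [trans_one]; exact rl_mem_rlLE (one_mem_degLE p) (one_mem_degLE p)
  · simp
  · rw [map_add]; exact add_mem hD hD'
  · rw [smul_def, trans_iA_mul]
    exact rlLE_map (rlLeft (iA k A L a)) (fun D E hD hE => by
      rw [rlLeft_rl, ← smul_def]; exact rl_mem_rlLE (Submodule.smul_mem _ a hD) hE) hD
  · exact rlLE_mono (Nat.le_succ p) hD
  · have h₁ : rlLeft (iL k A L X) (trans D) ∈ rlLE k A L (p + 1) :=
      rlLE_map (rlLeft (iL k A L X)) (fun D E hD hE => by
        rw [rlLeft_rl]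
        exact rl_mem_rlLE (iL_mul_mem_degLE X hD) (degLE_mono (Nat.le_succ p) hE)) hD
    have h₂ : rlRight (iL k A L X) (trans D) ∈ rlLE k A L (p + 1) :=
      rlLE_map (rlRight (iL k A L X)) (fun D E hD hE => by
        rw [rlRight_rl]
        exact rl_mem_rlLE (degLE_mono (Nat.le_succ p) hD) (mul_mem_degLE hE (iL_mem_degLE X))) hD
    rw [trans_iL_mul]
    exact sub_mem h₁ h₂

end Env

namespace Jet

open Env Filtration

lemma actEv_rl (φ : Jet k A L) (D E : Env k A L) : φ.actEv (rl D E) = act D (φ.ev E) := rfl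

lemma actEv_rlLeft (φ : Jet k A L) (D : Env k A L) (z : TensorRL k A L) :
    φ.actEv (rlLeft D z) = act D (φ.actEv z) := by
  induction z using rl_induction with
  | add z w hz hw => simp only [map_add, hz, hw]
  | tmul F E => simp [actEv_rl]

lemma actEv_add (φ ψ : Jet k A L) (z : TensorRL k A L) :
    (φ + ψ).actEv z = φ.actEv z + ψ.actEv z := by
  induction z using rl_induction with
  | add z w hz hw => simp only [map_add, hz, hw]; abel
  | tmul F E => simp [actEv_rl, ev_add]

lemma actEv_smul (c : k) (φ : Jet k A L) (z : TensorRL k A L) :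
    (c • φ).actEv z = c • φ.actEv z := by
  induction z using rl_induction with
  | add z w hz hw => simp only [map_add, hz, hw, smul_add]
  | tmul F E => simp [actEv_rl, ev_smul]

variable (k A L) in
/-- The antipode `(Sφ)(D) = D₊(φ(D₋))`. -/
def antipode : Jet k A L →ₗ[k] Jet k A L where
  toFun φ := ofDual
    { toFun := fun D => φ.actEv (trans D)
      map_add' := fun D E => by rw [map_add, map_add]
      map_smul' := fun a D => by
        rw [smul_def, trans_iA_mul, actEv_rlLeft, act_iA, RingHom.id_apply, smul_eq_mul] }
  map_add' φ ψ := ev_ext fun D => by simp [ev_add, actEv_add]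
  map_smul' c φ := ev_ext fun D => by simp [ev_smul, actEv_smul]

lemma ev_antipode (φ : Jet k A L) (D : Env k A L) :
    (antipode k A L φ).ev D = φ.actEv (trans D) := rfl

lemma actEv_antipode (φ : Jet k A L) (z : TensorRL k A L) :
    (antipode k A L φ).actEv z = φ.actEv (transRight z) := by
  induction z using rl_induction with
  | add z w hz hw => simp only [map_add, hz, hw]
  | tmul F E => rw [actEv_rl, ev_antipode, transRight_rl, actEv_rlLeft]

/-- S²φ takes the value D₊D₋₊(φ(D₋₋)) at D, and D₊D₋₊ ⊗ D₋₋ = 1 ⊗ D. -/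
lemma antipode_antipode (φ : Jet k A L) : antipode k A L (antipode k A L φ) = φ :=
  ev_ext fun D => by
    rw [ev_antipode, actEv_antipode, transRight_trans, actEv_rl, map_one]
    rfl

lemma antipode_bimodule (a b : A) (φ : Jet k A L) :
    antipode k A L (target k A L a * φ * source k A L b) =
      target k A L b * antipode k A L φ * source k A L a :=
  ev_ext fun D => by
    have h : ∀ z : TensorRL k A L, (target k A L a * φ * source k A L b).actEv z =
        φ.actEv (rlMid b (rlRight (iA k A L a) z)) := fun z => by
      induction z using rl_induction with
      | add z w hz hw => simp only [map_add, hz, hw]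
      | tmul F E =>
        rw [actEv_rl, rlRight_rl, rlMid_rl, actEv_rl, act_mul, act_iA, mul_comm _ (source k A L b),
          ev_source_mul, ev_target_mul]
    -- The scalar a leaves D₋ by centrality of D₊ ⊗ D₋, and b is absorbed by (Db)₊ ⊗ (Db)₋ = D₊b ⊗
    -- D₋.
    rw [ev_antipode, h, trans_central, rlMid_rlLeft, actEv_rlLeft, act_iA,
      mul_comm _ (source k A L a), ev_source_mul, ev_target_mul, ev_antipode, trans_mul_iA]

lemma antipode_mem {p : ℕ} {φ : Jet k A L} (hφ : φ ∈ (jetFil k A L).part p) :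
    antipode k A L φ ∈ (jetFil k A L).part p := by
  rw [mem_jetFil] at hφ ⊢
  rintro D ⟨m, hm, hD⟩
  rw [ev_antipode]
  have h := trans_mem_rlLE hD
  generalize trans D = z at h
  induction h using Submodule.span_induction with
  | mem z hz =>
    obtain ⟨D, E, -, hE, rfl⟩ := hz
    rw [actEv_rl, hφ E ⟨m, hm, hE⟩, map_zero]
  | zero => simp
  | add x y _ _ hx hy => rw [map_add, hx, hy, add_zero]
  | smul c x _ hx => rw [map_smul, hx, smul_zero]

/-! ### The antipode axioms. -/

/-- The tensor `u` represents the coproduct of `h` in degree less than `n`. -/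
def IsRep (n : ℕ) (h : Jet k A L) (u : Jet k A L ⊗[k] Jet k A L) : Prop :=
  ∀ D E, DegLT n D → DegLT n E → pair D E u = h.ev (D * E)

/-- On a pure tensor this is h₍₁₎(E h₍₂₎(y)) = h(Ey) under D; a representative at level n guarantees
it only for E of degree less than n, hence the bound on z. -/
lemma sum_actEv {n m : ℕ} (hm : m < n) {h : Jet k A L} {T : Finset (Jet k A L × Jet k A L)}
    (hT : IsRep n h (∑ i ∈ T, i.1 ⊗ₜ[k] i.2)) {y : Env k A L} (hy : DegLT n y)
    {z : TensorRL k A L} (hz : z ∈ rlLE k A L m) :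
    ∑ i ∈ T, i.1.actEv (rlRight (iA k A L (i.2.ev y)) z) = h.actEv (rlRight y z) := by
  induction hz using Submodule.span_induction with
  | mem z hz =>
    obtain ⟨D, E, -, hE, rfl⟩ := hz
    simp only [rlRight_rl, actEv_rl]
    rw [← hT E y ⟨m, hm, hE⟩ hy, ← map_sum, map_sum (pair E y)]
    rfl
  | zero => simp
  | add x y _ _ hx hy => simp only [map_add, Finset.sum_add_distrib, hx, hy]
  | smul c x _ hx => simp only [map_smul, ← Finset.smul_sum, hx]

/-- (S(h₍₁₎)h₍₂₎)(D) = D₍₁₎₊(h₍₁₎(D₍₁₎₋h₍₂₎(D₍₂₎))) = D₍₁₎₊(h(D₍₁₎₋D₍₂₎)), and D₍₁₎₊ ⊗ D₍₁₎₋D₍₂₎ = D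
⊗ 1 by `galoisInv_cop`; D(h(1)) remains. -/
lemma IsRep.antipode_mul {n : ℕ} {h : Jet k A L} {u : Jet k A L ⊗[k] Jet k A L}
    (hu : IsRep n h u) {D : Env k A L} (hD : DegLT n D) :
    (TensorProduct.lift ((LinearMap.mul k (Jet k A L)).comp (antipode k A L)) u).ev D =
      (target k A L (h.ev 1)).ev D := by
  obtain ⟨T, rfl⟩ := TensorProduct.exists_finset u
  obtain ⟨m, hm, hD⟩ := hD
  obtain ⟨r, x, y, hx, hy, hc⟩ := cop_eq_sum hD
  have h1 : ∀ i : Jet k A L × Jet k A L, (antipode k A L i.1 * i.2).ev D =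
      ∑ j, i.1.actEv (rlRight (iA k A L (i.2.ev (y j))) (trans (x j))) := fun i => by
    rw [ev_mul_eq_sum hc]
    refine Finset.sum_congr rfl fun j _ => ?_
    rw [trans_central, actEv_rlLeft, act_iA, ev_antipode, mul_comm]
  rw [map_sum, ev_sum]
  simp only [TensorProduct.lift.tmul, LinearMap.comp_apply, LinearMap.mul_apply', h1]
  rw [Finset.sum_comm]
  have h2 : ∀ j, ∑ i ∈ T, i.1.actEv (rlRight (iA k A L (i.2.ev (y j))) (trans (x j))) =
      h.actEv (rlRight (y j) (trans (x j))) := fun j =>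
    sum_actEv hm hu ⟨m, hm, hy j⟩ (trans_mem_rlLE (hx j))
  simp only [h2]
  rw [← map_sum]
  have h3 : ∑ j, rlRight (y j) (trans (x j)) = rl D 1 := by
    rw [← galoisInv_cop, hc, map_sum]
    rfl
  rw [h3, actEv_rl, ev_target]

/-- The map `D ⊗ E ↦ φ(D ψ(E))` on the balanced tensor product. -/
def pairRL (φ ψ : Jet k A L) : TensorRL k A L →ₗ[k] A :=
  rlLift (LinearMap.mk₂ k (fun D E => pair D E (φ ⊗ₜ[k] ψ))
    (fun D D' E => by simp only [pair_tmul, add_mul, ev_map_add])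
    (fun c D E => by
      rw [pair_tmul, pair_tmul, smul_mul_assoc, ← algebraMap_smul A c (D * _), ev_map_smul,
        Algebra.smul_def])
    (fun D E E' => by simp only [pair_tmul, ev_map_add, map_add, mul_add])
    (fun c D E => by
      rw [pair_tmul, pair_tmul, ← algebraMap_smul A c E, ev_map_smul, ← Algebra.smul_def, map_smul,
        mul_smul_comm, ← algebraMap_smul A c (D * _), ev_map_smul, Algebra.smul_def]))
    (fun D E a => by
      simp only [LinearMap.mk₂_apply, pair_tmul]
      rw [← smul_def, ev_map_smul, map_mul, mul_assoc])

lemma pairRL_rl (φ ψ : Jet k A L) (D E : Env k A L) :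
    pairRL φ ψ (rl D E) = pair D E (φ ⊗ₜ[k] ψ) := rfl

/-- The map `D ⊗ E ↦ D₊(ψ(D₋E))`. -/
def actEvInv (ψ : Jet k A L) : Env k A L ⊗[A] Env k A L →ₗ[A] A where
  toFun w := ψ.actEv (galoisInv w)
  map_add' w w' := by rw [map_add, map_add]
  map_smul' a w := by
    rw [galoisInv_smul, actEv_rlLeft, act_iA, RingHom.id_apply, smul_eq_mul]

lemma actEvInv_apply (ψ : Jet k A L) (w : Env k A L ⊗[A] Env k A L) :
    actEvInv ψ w = ψ.actEv (galoisInv w) := rfl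

/-- The map `D ⊗ E ↦ φ(D₍₁₎) D₍₂₎₊(ψ(D₍₂₎₋E))`. -/
def convInv (φ ψ : Jet k A L) : Env k A L ⊗[A] Env k A L →ₗ[A] A :=
  (LinearMap.mul' A A).comp ((TensorProduct.map φ.toDual (actEvInv ψ)).comp
    ((TensorProduct.assoc A _ _ _).toLinearMap.comp (cop.rTensor _)))

lemma convInv_tmul_one (φ ψ : Jet k A L) (D : Env k A L) :
    convInv φ ψ (D ⊗ₜ[A] 1) = (φ * antipode k A L ψ).ev D := by
  rw [ev_mul]
  simp only [convInv, LinearMap.comp_apply, LinearMap.rTensor_tmul, LinearEquiv.coe_coe]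
  generalize cop D = w
  induction w with
  | zero => simp
  | add x y hx hy => simp only [TensorProduct.add_tmul, map_add, hx, hy]
  | tmul x y => simp [actEvInv_apply, ev_antipode]

lemma assoc_cop_lTensor (E : Env k A L) (w : Env k A L ⊗[A] Env k A L) :
    TensorProduct.assoc A _ _ _ (cop.rTensor _ ((mulRight E).lTensor _ w)) =
      ((mulRight E).lTensor _).lTensor _ (TensorProduct.assoc A _ _ _ (cop.rTensor _ w)) := by
  induction w with
  | zero => simp
  | add x y hx hy => simp only [map_add, hx, hy]
  | tmul x y =>
    simp only [LinearMap.lTensor_tmul, LinearMap.rTensor_tmul]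
    generalize cop x = v
    induction v with
    | zero => simp
    | add x y hx hy => simp only [TensorProduct.add_tmul, map_add, hx, hy]
    | tmul x' y' => simp

/-- Coassociativity rewrites the argument as D₍₁₎ ⊗ β(D₍₂₎ ⊗ E), so β is undone on the second part.
What is left, φ(D₍₁₎)D₍₂₎(ψ(E)), is the value of φ t(ψ(E)) at D. -/
lemma convInv_galois (φ ψ : Jet k A L) (z : TensorRL k A L) :
    convInv φ ψ (galois z) = pairRL φ ψ z := by
  induction z using rl_induction with
  | add z w hz hw => simp only [map_add, hz, hw]
  | tmul D E =>
    have hco : TensorProduct.assoc A _ _ _ (cop.rTensor _ (cop D)) = cop.lTensor _ (cop D) :=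
      Coalgebra.coassoc_apply D
    rw [pairRL_rl, pair_tmul, ← ev_target_mul, mul_comm, ev_mul, galois_rl]
    simp only [convInv, LinearMap.comp_apply, LinearEquiv.coe_coe]
    rw [assoc_cop_lTensor, hco]
    generalize cop D = w
    induction w with
    | zero => simp
    | add x y hx hy => simp only [map_add, hx, hy]
    | tmul x y =>
      simp only [LinearMap.lTensor_tmul, TensorProduct.map_tmul, LinearMap.mul'_apply,
        toDual_apply, ev_target]
      rw [← galois_rl, actEvInv_apply, galoisInv_galois, actEv_rl]

/-- Evaluating `convInv` at D ⊗ 1 = β(D₊ ⊗ D₋) in two ways avoids a formula for the coproduct of D₊.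
-/
lemma ev_mul_antipode (φ ψ : Jet k A L) (D : Env k A L) :
    (φ * antipode k A L ψ).ev D = pairRL φ ψ (trans D) := by
  rw [← convInv_tmul_one, ← galois_trans, convInv_galois]

/-- Pairing h₍₁₎ ⊗ h₍₂₎ with D₊ ⊗ D₋ gives h(D₊D₋) = h(ε(D)) = ε(D)h(1). -/
lemma IsRep.mul_antipode {n : ℕ} {h : Jet k A L} {u : Jet k A L ⊗[k] Jet k A L}
    (hu : IsRep n h u) {D : Env k A L} (hD : DegLT n D) :
    (TensorProduct.lift ((LinearMap.mul k (Jet k A L)).compl₂ (antipode k A L)) u).ev D =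
      (source k A L (h.ev 1)).ev D := by
  obtain ⟨T, rfl⟩ := TensorProduct.exists_finset u
  obtain ⟨m, hm, hD⟩ := hD
  have key : ∀ z ∈ rlLE k A L m, ∑ i ∈ T, pairRL i.1 i.2 z = h.ev (rlMul z) := fun z hz => by
    induction hz using Submodule.span_induction with
    | mem z hz =>
      obtain ⟨D, E, hD, hE, rfl⟩ := hz
      simp only [pairRL_rl, rlMul_rl]
      rw [← map_sum, hu D E ⟨m, hm, hD⟩ ⟨m, hm, hE⟩]
    | zero => simpa using (map_zero h.toDual).symm
    | add x y _ _ hx hy => simp only [map_add, Finset.sum_add_distrib, hx, hy, ev_map_add]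
    | smul c x _ hx =>
      simp only [map_smul, ← Finset.smul_sum, hx]
      rw [← algebraMap_smul A c (rlMul x), ev_map_smul, Algebra.smul_def]
  rw [map_sum, ev_sum]
  simp only [TensorProduct.lift.tmul, LinearMap.compl₂_apply, LinearMap.mul_apply', ev_mul_antipode]
  rw [key _ (trans_mem_rlLE hD), rlMul_trans, ev_iA, ev_source, mul_comm]

end Jet

end LieRinehart

namespace LieRinehart

variable {k A L : Type*} [CommRing k] [CommRing A] [Algebra k A] [LieRing L] [LieAlgebra k L]
  [Module A L] [LieRingModule L A] [LieRinehartRing A L] [LieRinehartAlgebra k A L]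

namespace Jet

open Env Filtration MulOpposite

/-! ### The Hopf algebroid structure -/

lemma isDualAction_left {s : A →ₐ[k] Jet k A L} {t : Aᵐᵒᵖ →ₐ[k] Jet k A L}
    (hs : ∀ a, s a = source k A L a) (ht : ∀ a, t (op a) = target k A L a) :
    IsDualAction (leftMulBy k s.toLinearMap) (leftMulBy k (unopLin k t)) where
  ev_lam a φ D := by
    change (s a * φ).ev D = _
    rw [hs, ev_source_mul]
  ev_rho a φ D := by
    change (t (op a) * φ).ev D = _
    rw [ht, ev_target_mul]

/-- In a commutative algebra, exchanging source and target while passing from left to right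
multiplications gives the same actions of A. -/
lemma isDualAction_right {s : A →ₐ[k] Jet k A L} {t : Aᵐᵒᵖ →ₐ[k] Jet k A L}
    (hs : ∀ a, s a = target k A L a) (ht : ∀ a, t (op a) = source k A L a) :
    IsDualAction (rightMulBy k (unopLin k t)) (rightMulBy k s.toLinearMap) where
  ev_lam a φ D := by
    change (φ * t (op a)).ev D = _
    rw [ht, mul_comm, ev_source_mul]
  ev_rho a φ D := by
    change (φ * s a).ev D = _
    rw [hs, mul_comm, ev_target_mul]

lemma pair_target_mul (a : A) (D E : Env k A L) (u : Jet k A L ⊗[k] Jet k A L) :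
    pair D E (target k A L a ⊗ₜ[k] 1 * u) = pair (D * iA k A L a) E u :=
  ext_pair (f := (pair D E).comp (LinearMap.mulLeft k (target k A L a ⊗ₜ[k] 1)))
    (g := pair (D * iA k A L a) E) (fun φ ψ => by
      rw [LinearMap.comp_apply, LinearMap.mulLeft_apply, Algebra.TensorProduct.tmul_mul_tmul,
        one_mul, pair_tmul, pair_tmul, ev_target_mul, mul_assoc, mul_assoc, ← map_mul, ← map_mul,
        mul_comm a]) u

lemma pair_source_mul (a : A) (D E : Env k A L) (u : Jet k A L ⊗[k] Jet k A L) :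
    pair D E (1 ⊗ₜ[k] source k A L a * u) = pair D (iA k A L a * E) u :=
  ext_pair (f := (pair D E).comp (LinearMap.mulLeft k (1 ⊗ₜ[k] source k A L a)))
    (g := pair D (iA k A L a * E)) (fun φ ψ => by
      rw [LinearMap.comp_apply, LinearMap.mulLeft_apply, Algebra.TensorProduct.tmul_mul_tmul,
        one_mul, pair_tmul, pair_tmul, ev_source_mul, ← smul_def, ev_map_smul]) u

lemma ev_source_one (a : A) : (source k A L a).ev 1 = a := by
  rw [ev_source, eps_one, mul_one]

lemma ev_target_one (a : A) : (target k A L a).ev 1 = a := by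
  rw [ev_target, map_one]
  rfl

variable (k A L) in
/-- The source map as a morphism on the opposite algebra. -/
def sourceOp : Aᵐᵒᵖ →ₐ[k] Jet k A L :=
  (source k A L).comp (AlgEquiv.toOpposite k A).symm.toAlgHom

lemma sourceOp_op (a : A) : sourceOp k A L (op a) = source k A L a := rfl

variable (k A L) in
/-- The target map as a morphism on the opposite algebra. -/
def targetOp : Aᵐᵒᵖ →ₐ[k] Jet k A L :=
  (target k A L).comp (AlgEquiv.toOpposite k A).symm.toAlgHom

lemma targetOp_op (a : A) : targetOp k A L (op a) = target k A L a := rfl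

variable (k A L) in
lemma isDualAction_source_target : IsDualAction
    (leftMulBy k (source k A L).toLinearMap) (leftMulBy k (unopLin k (targetOp k A L))) :=
  isDualAction_left (fun _ => rfl) (fun _ => rfl)

variable (k A L) in
lemma isDualAction_target_source : IsDualAction
    (rightMulBy k (unopLin k (sourceOp k A L))) (rightMulBy k (target k A L).toLinearMap) :=
  isDualAction_right (fun _ => rfl) (fun _ => rfl)

variable [Module.Finite A L] [Module.Projective A L]

variable (k A L) in
/-- The left bialgebroid of infinite jets. -/
def leftBialgebroid : LeftBialgebroid k A (Jet k A L) (jetFil k A L) where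
  s := source k A L
  t := targetOp k A L
  commute a b := mul_comm _ _
  comul := comul (isDualAction_source_target k A L)
  counit := evₗ 1
  coring := isCoring (isDualAction_source_target k A L) (isDualCoproduct_comul _)
  takeuchi h a := exists_takeuchi (isDualAction_source_target k A L)
    (isDualCoproduct_comul _) h a
    (fun D E u => by
      rw [LinearMap.mulRight_apply, mul_comm u, targetOp_op, pair_target_mul])
    (fun D E u => by rw [LinearMap.mulRight_apply, mul_comm u, pair_source_mul])
  multiplicative := isMultiplicative (isDualCoproduct_comul _)
  counit_one := by rw [evₗ_apply, ev_one, eps_one]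
  counit_mul_s h h' := by
    simp only [evₗ_apply, ev_mul_one, ev_source_one]
  counit_mul_t h h' := by
    simp only [evₗ_apply, ev_mul_one, targetOp_op, ev_target_one]

variable (k A L) in
/-- The right bialgebroid of infinite jets. -/
def rightBialgebroid : RightBialgebroid k A (Jet k A L) (jetFil k A L) where
  s := target k A L
  t := sourceOp k A L
  commute a b := mul_comm _ _
  comul := comul (isDualAction_target_source k A L)
  counit := evₗ 1
  coring := isCoring (isDualAction_target_source k A L) (isDualCoproduct_comul _)
  takeuchi h a := exists_takeuchi (isDualAction_target_source k A L)
    (isDualCoproduct_comul _) h a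
    (fun D E u => by rw [LinearMap.mulLeft_apply, pair_target_mul])
    (fun D E u => by rw [LinearMap.mulLeft_apply, sourceOp_op, pair_source_mul])
  multiplicative := isMultiplicative (isDualCoproduct_comul _)
  counit_one := by rw [evₗ_apply, ev_one, eps_one]
  counit_s_mul h h' := by
    simp only [evₗ_apply, ev_mul_one, ev_target_one]
  counit_t_mul h h' := by
    simp only [evₗ_apply, ev_mul_one, sourceOp_op, ev_source_one]

lemma isDualCoproduct_left : IsDualCoproduct (leftBialgebroid k A L).comul :=
  isDualCoproduct_comul (isDualAction_source_target k A L)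

lemma isDualCoproduct_right : IsDualCoproduct (rightBialgebroid k A L).comul :=
  isDualCoproduct_comul (isDualAction_target_source k A L)

variable (k A L) in
/-- The Hopf algebroid of infinite jets. -/
def hopfAlgebroid : HopfAlgebroid k A A (Jet k A L) (jetFil k A L) where
  left := leftBialgebroid k A L
  right := rightBialgebroid k A L
  S := antipode k A L
  sl_el_tr a := congrArg (source k A L) (ev_source_one a)
  tl_el_sr a := congrArg (target k A L) (ev_target_one a)
  sr_er_tl a := congrArg (target k A L) (ev_target_one a)
  tr_er_sl a := congrArg (source k A L) (ev_source_one a)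
  coassoc_left_right := coassoc (isDualAction_source_target k A L)
    (isDualAction_target_source k A L) isDualCoproduct_left isDualCoproduct_right
  coassoc_right_left := coassoc (isDualAction_target_source k A L)
    (isDualAction_source_target k A L) isDualCoproduct_right isDualCoproduct_left
  S_bimodule a b h := antipode_bimodule a b h
  S_continuous p := ⟨p, fun h hh => antipode_mem hh⟩
  antipode_left h p := ⟨p, fun u hu => (Submodule.Quotient.eq _).2 (mem_jetFil.2 fun D hD => by
    have hrep : IsRep p h u := (isDualCoproduct_left.mkQ_eq_iff h p u).1 hu
    rw [ev_sub, hrep.antipode_mul hD]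
    exact sub_self _)⟩
  antipode_right h p := ⟨p, fun u hu => (Submodule.Quotient.eq _).2 (mem_jetFil.2 fun D hD => by
    have hrep : IsRep p h u := (isDualCoproduct_right.mkQ_eq_iff h p u).1 hu
    rw [ev_sub, hrep.mul_antipode hD]
    exact sub_self _)⟩

lemma isJetHopfAlgebroid_hopfAlgebroid : IsJetHopfAlgebroid (hopfAlgebroid k A L) where
  left_s _ _ := rfl
  left_t _ _ := rfl
  right_s _ _ := rfl
  right_t _ _ := rfl
  left_comul φ D E := (isDualCoproduct_left φ).extendsTo D E
  right_comul φ D E := (isDualCoproduct_right φ).extendsTo D E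
  left_counit _ := rfl
  right_counit _ := rfl
  antipode φ D z hz := by
    rw [eq_trans_of_galois_eq hz]
    rfl

/-! ### Uniqueness -/

lemma leftBialgebroid_unique {B : LeftBialgebroid k A (Jet k A L) (jetFil k A L)}
    (hs : ∀ a, B.s a = source k A L a) (ht : ∀ a, B.t (op a) = target k A L a)
    (hΔ : ∀ (φ : Jet k A L) (D E : Env k A L),
      Filtration.ExtendsTo _ (pair D E) (B.comul φ) (φ.ev (D * E)))
    (hε : ∀ φ, B.counit φ = φ.ev 1) : B = leftBialgebroid k A L := by
  have H := isDualAction_left hs ht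
  obtain ⟨s, t, _, Δ, ε⟩ := B
  -- The type of the coproduct depends on s and t, so these are identified before the coproducts can
  -- be compared.
  obtain rfl : s = source k A L := AlgHom.ext hs
  obtain rfl : t = targetOp k A L := AlgHom.ext fun a => ht a.unop
  obtain rfl : ε = evₗ 1 := LinearMap.ext hε
  have h : IsDualCoproduct Δ := fun φ => H.represents_of_extendsTo (hΔ φ)
  obtain rfl := h.unique (isDualCoproduct_comul (isDualAction_source_target k A L))
  rfl

lemma rightBialgebroid_unique {B : RightBialgebroid k A (Jet k A L) (jetFil k A L)}
    (hs : ∀ a, B.s a = target k A L a) (ht : ∀ a, B.t (op a) = source k A L a)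
    (hΔ : ∀ (φ : Jet k A L) (D E : Env k A L),
      Filtration.ExtendsTo _ (pair D E) (B.comul φ) (φ.ev (D * E)))
    (hε : ∀ φ, B.counit φ = φ.ev 1) : B = rightBialgebroid k A L := by
  have H := isDualAction_right hs ht
  obtain ⟨s, t, _, Δ, ε⟩ := B
  obtain rfl : s = target k A L := AlgHom.ext hs
  obtain rfl : t = sourceOp k A L := AlgHom.ext fun a => ht a.unop
  obtain rfl : ε = evₗ 1 := LinearMap.ext hε
  have h : IsDualCoproduct Δ := fun φ => H.represents_of_extendsTo (hΔ φ)
  obtain rfl := h.unique (isDualCoproduct_comul (isDualAction_target_source k A L))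
  rfl

lemma hopfAlgebroid_unique {𝓗 : HopfAlgebroid k A A (Jet k A L) (jetFil k A L)}
    (h : IsJetHopfAlgebroid 𝓗) : 𝓗 = hopfAlgebroid k A L := by
  have hl := leftBialgebroid_unique (fun a => ev_ext (h.left_s a)) (fun a => ev_ext (h.left_t a))
    h.left_comul h.left_counit
  have hr := rightBialgebroid_unique (fun a => ev_ext (h.right_s a))
    (fun a => ev_ext (h.right_t a)) h.right_comul h.right_counit
  have hS : 𝓗.S = antipode k A L :=
    LinearMap.ext fun φ => ev_ext fun D => h.antipode φ D (trans D) (galois_trans D)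
  exact HopfAlgebroid.ext hl hr hS

end Jet

end LieRinehart

end

open LieRinehart in
theorem theorem3p12 {k A L : Type*} [CommRing k] [CommRing A] [Algebra k A] [Algebra ℚ A]
    [LieRing L] [LieAlgebra k L] [Module A L] [LieRingModule L A] [LieRinehartRing A L]
    [LieRinehartAlgebra k A L] [Module.Finite A L] [Module.Projective A L]
    (hrank : ∃ r : ℕ, ∀ P : PrimeSpectrum A, Module.rankAtStalk L P = r) :
    (jetFil k A L).IsCompleteAlgebra ∧
    (∀ (φ ψ : Jet k A L) (D : Env k A L), (φ * ψ).ev D =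
      LinearMap.mul' A A (TensorProduct.map φ.toDual ψ.toDual (Env.cop D))) ∧
    (∀ D : Env k A L, (1 : Jet k A L).ev D = Env.eps D) ∧
    Function.Bijective (Env.galois (k := k) (A := A) (L := L)) ∧
    (∃! 𝓗 : HopfAlgebroid k A A (Jet k A L) (jetFil k A L), IsJetHopfAlgebroid 𝓗) ∧
    (∀ 𝓗 : HopfAlgebroid k A A (Jet k A L) (jetFil k A L), IsJetHopfAlgebroid 𝓗 →
      ∀ φ : Jet k A L, 𝓗.S (𝓗.S φ) = φ) := by
  refine ⟨Jet.jetFil_isCompleteAlgebra, Jet.ev_mul, Jet.ev_one, Env.galois_bijective,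
    ⟨Jet.hopfAlgebroid k A L, Jet.isJetHopfAlgebroid_hopfAlgebroid,
      fun 𝓗 h => Jet.hopfAlgebroid_unique h⟩, fun 𝓗 h φ => ?_⟩
  rw [Jet.hopfAlgebroid_unique h]
  exact Jet.antipode_antipode φ
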